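/- Let $n\ge 1$, $R>0$, $b>R$, $0<\mu_1\le\mu_2$ and $M>0$. Write points of $\mathbb R^n$ as $\mathbf x=(x_1,\dots,x_{n-1},z)$ (so $x_n=z$), let $\Omega=(-R,R)^n$ and $\Gamma_+=\{\mathbf x\in\partial\Omega: z=R\}$. Let $H^2_{0,\#}(\Omega)$ be the set of real-valued $u\in H^2(\Omega)$ with $u=0$ on $\partial\Omega$ and $\partial_z u=0$ on $\Gamma_+$ in the sense of traces. Then there are numbers $p_0>1$ and $\lambda_0\ge 1$, depending only on $\mu_1,\mu_2,b,n,R,M$, and for every $p\ge p_0$ a number $C_2>0$ depending only on $\mu_1,\mu_2,b,p,n,R,M$, such that the following holds. Let $a_{ij}\in C^1(\overline\Omega)$, $1\le i,j\le n$, be real functions with $\max_{i,j}\|a_{ij}\|_{C^1(\overline\Omega)}\le M$ such that $a_{ij}=a_{ji}$ and $$\mu_1|\xi|^2\le\sum_{i,j=1}^n a_{ij}(\mathbf x)\xi_i\xi_j\le\mu_2|\xi|^2\qquad\text{for all }\mathbf x\in\overline\Omega,\ \xi\in\mathbb R^n,$$ and $a_{in}(\mathbf x)=0$ for all $\mathbf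 x\in\partial\Omega\setminus\{z=\pm R\}$ and all $i\neq n$. Put $L_0u=\sum_{i,j=1}^n a_{ij}u_{x_ix_j}$. Then $$\int_\Omega (L_0u)^2\,e^{2\lambda(z+b)^p}\,d\mathbf x\ \ge\ C_2\lambda\int_\Omega\left(|\nabla u|^2+\lambda^2u^2\right)e^{2\lambda(z+b)^p}\,d\mathbf x$$ for all real $\lambda\ge\lambda_0$, all real $p\ge p_0$ and all $u\in H^2_{0,\#}(\Omega)$. -/

import Mathlib

open MeasureTheory Filter Topology Set
open scoped ContDiff ENNReal

noncomputable section

namespace CarlemanCube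

/-- Points `x = (x₁, …, x_{n-1}, z)` of `ℝⁿ`, where `n = d + 1`; the last coordinate is `z`.
Only the topology, the Lebesgue measure and the coordinates of this space are used below;
Euclidean lengths are written out as sums of squares. -/
abbrev Pt (d : ℕ) : Type := Fin (d + 1) → ℝ

/-- The last coordinate `z` of a point. -/
def zc {d : ℕ} (x : Pt d) : ℝ := x (Fin.last d)

/-- The open cube `Ω = (-R, R)ⁿ`. -/
def cube (d : ℕ) (R : ℝ) : Set (Pt d) := Set.pi Set.univ fun _ => Set.Ioo (-R) R

/-- The closed cube `[-R, R]ⁿ`, the closure of `Ω` (for `R > 0`). -/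
def closedCube (d : ℕ) (R : ℝ) : Set (Pt d) := Set.pi Set.univ fun _ => Set.Icc (-R) R

/-- Lebesgue measure on `Ω`. -/
def cubeMeasure (d : ℕ) (R : ℝ) : Measure (Pt d) := volume.restrict (cube d R)

/-- The classical partial derivative `∂ᵢ f`. -/
def partialDeriv {d : ℕ} (i : Fin (d + 1)) (f : Pt d → ℝ) (x : Pt d) : ℝ :=
  fderiv ℝ f x (Pi.single i 1)

/-- The partial derivative `∂ᵢ f` on the closed cube (one-sided at the boundary). -/
def partialDerivOn {d : ℕ} (R : ℝ) (i : Fin (d + 1)) (f : Pt d → ℝ) (x : Pt d) : ℝ :=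
  fderivWithin ℝ f (closedCube d R) x (Pi.single i 1)

/-- `f ∈ C¹` of the closed cube and `‖f‖_{C¹} ≤ M`, where the `C¹` norm is the maximum of the
sup norms of `f` and of its first partial derivatives. -/
structure C1NormLE {d : ℕ} (R M : ℝ) (f : Pt d → ℝ) : Prop where
  contDiffOn : ContDiffOn ℝ 1 f (closedCube d R)
  bound : ∀ x ∈ closedCube d R, |f x| ≤ M
  bound_deriv : ∀ x ∈ closedCube d R, ∀ k, |partialDerivOn R k f x| ≤ M

/-- Symmetric, uniformly elliptic coefficients with ellipticity constants `μ₁, μ₂`, with `C¹`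
norms at most `M` on the closed cube, such that `a_{in} = 0` for `i ≠ n` on the part
`∂Ω \ {z = ± R}` of the boundary. -/
structure Admissible {d : ℕ} (R μ₁ μ₂ M : ℝ)
    (a : Fin (d + 1) → Fin (d + 1) → Pt d → ℝ) : Prop where
  symm : ∀ x ∈ closedCube d R, ∀ i j, a i j x = a j i x
  elliptic : ∀ x ∈ closedCube d R, ∀ ξ : Fin (d + 1) → ℝ,
    μ₁ * ∑ i, ξ i ^ 2 ≤ ∑ i, ∑ j, a i j x * ξ i * ξ j ∧
      ∑ i, ∑ j, a i j x * ξ i * ξ j ≤ μ₂ * ∑ i, ξ i ^ 2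
  c1 : ∀ i j, C1NormLE R M (a i j)
  lateral : ∀ x ∈ frontier (cube d R), zc x ≠ R → zc x ≠ -R →
    ∀ i, i ≠ Fin.last d → a i (Fin.last d) x = 0

/-- `g` is the weak partial derivative `∂ᵢ u` in `Ω`. -/
def HasWeakPartial {d : ℕ} (R : ℝ) (i : Fin (d + 1)) (u g : Pt d → ℝ) : Prop :=
  ∀ φ : Pt d → ℝ, ContDiff ℝ ∞ φ → HasCompactSupport φ → tsupport φ ⊆ cube d R →
    ∫ x, u x * partialDeriv i φ x ∂cubeMeasure d R = -∫ x, g x * φ x ∂cubeMeasure d R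

/-- `u ∈ H¹(Ω)` with weak gradient `Du`. -/
structure MemH1 {d : ℕ} (R : ℝ) (u : Pt d → ℝ) (Du : Fin (d + 1) → Pt d → ℝ) : Prop where
  memLp : MemLp u 2 (cubeMeasure d R)
  memLp_deriv : ∀ i, MemLp (Du i) 2 (cubeMeasure d R)
  weak : ∀ i, HasWeakPartial R i u (Du i)

/-- `u ∈ H²(Ω)` with weak gradient `Du` and weak second derivatives
`D2u i j = ∂ⱼ ∂ᵢ u`. -/
structure MemH2 {d : ℕ} (R : ℝ) (u : Pt d → ℝ) (Du : Fin (d + 1) → Pt d → ℝ)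
    (D2u : Fin (d + 1) → Fin (d + 1) → Pt d → ℝ) : Prop where
  h1 : MemH1 R u Du
  h1_deriv : ∀ i, MemH1 R (Du i) (D2u i)

/-- The `(n-1)`-dimensional cube that parametrizes every face of `Ω`, with Lebesgue measure. -/
def faceMeasure (d : ℕ) (R : ℝ) : Measure (Fin d → ℝ) :=
  volume.restrict (Set.pi Set.univ fun _ => Set.Ioo (-R) R)

/-- The function `g ∈ L²` is the trace of `u ∈ H¹(Ω)` (with weak gradient `Du`) on the face
`{xᵢ = c}` of `Ω`, where `c = R` or `c = -R`: the restrictions to the face of some smooth functions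
that converge to `u` in `H¹(Ω)` converge to `g` in `L²` of the face. The point `y` of the
`(n-1)`-dimensional cube stands for the point of the face with the other coordinates `y`. -/
def HasTrace {d : ℕ} (R : ℝ) (i : Fin (d + 1)) (c : ℝ) (u : Pt d → ℝ)
    (Du : Fin (d + 1) → Pt d → ℝ) (g : (Fin d → ℝ) → ℝ) : Prop :=
  MemLp g 2 (faceMeasure d R) ∧
  ∃ v : ℕ → Pt d → ℝ, (∀ k, ContDiff ℝ ∞ (v k)) ∧
    Tendsto (fun k => eLpNorm (fun x => v k x - u x) 2 (cubeMeasure d R)) atTop (𝓝 0) ∧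
    (∀ j, Tendsto (fun k => eLpNorm (fun x => partialDeriv j (v k) x - Du j x) 2
      (cubeMeasure d R)) atTop (𝓝 0)) ∧
    Tendsto (fun k => eLpNorm (fun y => v k (Fin.insertNth (α := fun _ => ℝ) i c y) - g y) 2
      (faceMeasure d R)) atTop (𝓝 0)

/-- The real-valued functions `u ∈ H²(Ω)` (with their weak derivatives) such that `u = 0` on `∂Ω`
and `∂_z u = 0` on the top face `Γ₊ = {x ∈ ∂Ω : z = R}`, in the sense of traces. -/
structure MemH2ZeroSharp {d : ℕ} (R : ℝ) (u : Pt d → ℝ) (Du : Fin (d + 1) → Pt d → ℝ)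
    (D2u : Fin (d + 1) → Fin (d + 1) → Pt d → ℝ) : Prop where
  h2 : MemH2 R u Du D2u
  trace_pos : ∀ i, HasTrace R i R u Du 0
  trace_neg : ∀ i, HasTrace R i (-R) u Du 0
  trace_top : HasTrace R (Fin.last d) R (Du (Fin.last d)) (D2u (Fin.last d)) 0

/-- The principal part `L₀ u = ∑ᵢⱼ aᵢⱼ u_{xᵢ xⱼ}`. -/
def L0 {d : ℕ} (a D2u : Fin (d + 1) → Fin (d + 1) → Pt d → ℝ) (x : Pt d) : ℝ :=
  ∑ i, ∑ j, a i j x * D2u i j x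

/-- The Carleman weight `exp (2 λ (z + b)ᵖ)`. -/
def weight {d : ℕ} (b lam p : ℝ) (x : Pt d) : ℝ := Real.exp (2 * lam * (zc x + b) ^ p)

end CarlemanCube

end

/-!
# The Carleman estimate on the cube

The weight `exp (2 λ ψ)` with `ψ = (z + b) ^ p` depends on `z` only. With `v = exp (λ ψ) u`,
`q = ψ'` and `n` for the last index, the conjugated operator is
`F = L v + λ² q² aₙₙ v - 2 λ q T - λ q' aₙₙ v`, where `L v = ∑ aᵢⱼ vᵢⱼ` and `T = ∑ aₖₙ vₖ`.

*Smooth functions.* The cross term of `F² / q` between `-2 λ q T` and the even part of `F` is, up to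
divergences, a quadratic form in `∇v` with coefficients of size `λ` that do not depend on `p`, plus
`4 λ³ q q' aₙₙ² v²` and a term of size `λ³ q² v²` (`sum_rellich`,
`Admissible.integral_rellich_le`, `Admissible.integral_zeroth_order`). Since `q' / q = (p - 1) / (z + b)`, the
term in `v²` is as large as desired when `p` is large. Adding `-K λ F v` with a constant `K`
independent of `p` trades a part of it for a positive multiple of `λ |∇v|²`
(`carleman_scalar`, `Admissible.carleman_conjugated`). As `v = 0` on the boundary, only
the Rellich-type field contributes boundary terms: on the lateral faces they vanish because
`aₖₙ = 0` there, on the bottom face they have the right sign, and on the top face they are bounded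
by `∫ (∂_z u)²` (`Admissible.carleman_smooth`).

*Functions in `H²`.* Let `u` have zero traces on the boundary. Integration by parts against smooth
functions without compact support is justified by the traces and by cutoffs
(`integral_parts_of_traces_zero`, `HasWeakPartial.integral_parts`, `MemH2.integral_parts_of_ne`).
Hence the sine series of `u` may be differentiated termwise twice: the derivatives of its partial
sums are the partial sums of the sine and cosine series of the derivatives, which
converge in `L²` (`tendsto_trigSum`, `partialDeriv_trigSum`). So `u` is the `H²` limit of
smooth functions that vanish on the boundary, and by the trace inequality their derivatives `∂_z`
tend to zero in `L²` of the top face (`MemH2ZeroSharp.exists_smooth_approx`). In the limit the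
boundary term disappears (`Admissible.carleman_large`).

*Range of `λ`.* The argument needs `λ ≥ Λ(p)`. For `1 ≤ λ ≤ Λ(p)` the estimate follows from the one at
`Λ(p)`, because the weights are bounded above and below there; this costs a factor of
`C₂` that depends on `p`.
-/

namespace CarlemanCube

/-! ### The cube and the divergence theorem -/

section CubeBasics

variable {d : ℕ} {R : ℝ}

theorem mem_cube {x : Pt d} : x ∈ cube d R ↔ ∀ i, -R < x i ∧ x i < R := by
  simp [cube]

theorem mem_closedCube {x : Pt d} : x ∈ closedCube d R ↔ ∀ i, -R ≤ x i ∧ x i ≤ R := by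
  simp only [closedCube, mem_univ_pi, mem_Icc]

theorem cube_subset_closedCube : cube d R ⊆ closedCube d R := fun _ hx =>
  mem_closedCube.2 fun i => ⟨(mem_cube.1 hx i).1.le, (mem_cube.1 hx i).2.le⟩

theorem isOpen_cube : IsOpen (cube d R) := isOpen_set_pi finite_univ fun _ _ => isOpen_Ioo

theorem isCompact_closedCube : IsCompact (closedCube d R) :=
  isCompact_univ_pi fun _ => isCompact_Icc

theorem convex_closedCube : Convex ℝ (closedCube d R) :=
  convex_pi fun _ _ => convex_Icc _ _

theorem closedCube_eq_Icc : closedCube d R = Icc (fun _ => -R) (fun _ => R) :=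
  pi_univ_Icc _ _

theorem measurableSet_cube : MeasurableSet (cube d R) := isOpen_cube.measurableSet

theorem closedCube_mem_nhds {x : Pt d} (hx : x ∈ cube d R) : closedCube d R ∈ 𝓝 x :=
  mem_of_superset (isOpen_cube.mem_nhds hx) cube_subset_closedCube

theorem cube_ae_eq_closedCube : cube d R =ᵐ[volume] closedCube d R := by
  rw [closedCube_eq_Icc]
  exact Measure.univ_pi_Ioo_ae_eq_Icc

theorem cubeMeasure_eq_restrict_closedCube :
    cubeMeasure d R = volume.restrict (closedCube d R) :=
  Measure.restrict_congr_set cube_ae_eq_closedCube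

theorem cubeMeasure_eq_pi :
    cubeMeasure d R = Measure.pi fun _ : Fin (d + 1) => volume.restrict (Ioo (-R) R) := by
  rw [cubeMeasure, cube, volume_pi, Measure.restrict_pi_pi]

instance isFiniteMeasure_cubeMeasure : IsFiniteMeasure (cubeMeasure d R) := by
  rw [cubeMeasure_eq_restrict_closedCube]
  exact ⟨by simpa using isCompact_closedCube.measure_lt_top⟩

instance isFiniteMeasure_faceMeasure : IsFiniteMeasure (faceMeasure d R) :=
  ⟨by
    rw [faceMeasure, Measure.restrict_apply_univ]
    exact (measure_mono (pi_mono fun _ _ => Ioo_subset_Icc_self)).trans_lt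
      (isCompact_univ_pi fun _ => isCompact_Icc).measure_lt_top⟩

theorem ae_mem_cube : ∀ᵐ x ∂cubeMeasure d R, x ∈ cube d R :=
  ae_restrict_mem measurableSet_cube

theorem integrable_of_continuousOn {f : Pt d → ℝ} (hf : ContinuousOn f (closedCube d R)) :
    Integrable f (cubeMeasure d R) := by
  rw [cubeMeasure_eq_restrict_closedCube]
  exact hf.integrableOn_compact isCompact_closedCube

theorem memLp_of_continuousOn {f : Pt d → ℝ} (hf : ContinuousOn f (closedCube d R)) {p : ℝ≥0∞} :
    MemLp f p (cubeMeasure d R) := by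
  obtain ⟨C, hC⟩ := isCompact_closedCube.exists_bound_of_continuousOn hf
  refine MemLp.of_bound (integrable_of_continuousOn hf).1 C ?_
  filter_upwards [ae_mem_cube] with x hx using hC x (cube_subset_closedCube hx)

/-- The point of the face `{xᵢ = c}` with the other coordinates `y`. -/
abbrev facePt (i : Fin (d + 1)) (c : ℝ) (y : Fin d → ℝ) : Pt d :=
  Fin.insertNth (α := fun _ => ℝ) i c y

/-- The open `d`-dimensional cube that parametrizes the faces. -/
abbrev faceCube (d : ℕ) (R : ℝ) : Set (Fin d → ℝ) := Set.pi Set.univ fun _ => Set.Ioo (-R) R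

theorem measurableSet_faceCube : MeasurableSet (faceCube d R) :=
  (isOpen_set_pi finite_univ fun _ _ => isOpen_Ioo).measurableSet

theorem facePt_mem_closedCube (hR : 0 < R) {c : ℝ} (hc : c = R ∨ c = -R) {i : Fin (d + 1)}
    {y : Fin d → ℝ} (hy : y ∈ faceCube d R) : facePt i c y ∈ closedCube d R := by
  rw [mem_closedCube]
  intro k
  rcases Fin.eq_self_or_eq_succAbove i k with rfl | ⟨j, rfl⟩
  · rcases hc with rfl | rfl <;> simp [facePt] <;> linarith
  · have := hy j (mem_univ _)
    simp only [facePt, Fin.insertNth_apply_succAbove]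
    exact ⟨this.1.le, this.2.le⟩

theorem ae_mem_faceCube : ∀ᵐ y ∂faceMeasure d R, y ∈ faceCube d R :=
  ae_restrict_mem measurableSet_faceCube

theorem face_restrict_closed :
    faceMeasure d R = volume.restrict (Icc (fun _ => -R) (fun _ => R)) :=
  Measure.restrict_congr_set Measure.univ_pi_Ioo_ae_eq_Icc

end CubeBasics

section CubeC1

variable {d : ℕ} {R : ℝ}

/-- The linear form with coefficients `c`. -/
noncomputable def linForm (c : Fin (d + 1) → ℝ) : Pt d →L[ℝ] ℝ :=
  ∑ k, c k • ContinuousLinearMap.proj k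

theorem linForm_apply (c : Fin (d + 1) → ℝ) (x : Pt d) : linForm c x = ∑ k, c k * x k := by
  simp [linForm]

theorem linForm_single (c : Fin (d + 1) → ℝ) (k : Fin (d + 1)) :
    linForm c (Pi.single k 1) = c k := by
  simp [linForm_apply, Pi.single_apply]

theorem eq_linForm (A : Pt d →L[ℝ] ℝ) : A = linForm fun k => A (Pi.single k 1) := by
  refine ContinuousLinearMap.ext fun x => ?_
  rw [linForm_apply]
  conv_lhs => rw [pi_eq_sum_univ' x]
  simp [map_sum, mul_comm]

/-- `f` is continuously differentiable in the open cube, and `f` and its partial derivatives `f'`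
extend continuously to the closed cube. -/
structure CubeC1 (R : ℝ) (f : Pt d → ℝ) (f' : Fin (d + 1) → Pt d → ℝ) : Prop where
  cont : ContinuousOn f (closedCube d R)
  cont' : ∀ k, ContinuousOn (f' k) (closedCube d R)
  hasFDerivAt : ∀ x ∈ cube d R, HasFDerivAt f (linForm fun k => f' k x) x

namespace CubeC1

variable {f g : Pt d → ℝ} {f' g' : Fin (d + 1) → Pt d → ℝ}

theorem add (hf : CubeC1 R f f') (hg : CubeC1 R g g') :
    CubeC1 R (fun x => f x + g x) fun k x => f' k x + g' k x where
  cont := hf.cont.add hg.cont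
  cont' k := (hf.cont' k).add (hg.cont' k)
  hasFDerivAt x hx := by
    refine ((hf.hasFDerivAt x hx).add (hg.hasFDerivAt x hx)).congr_fderiv ?_
    ext y
    simp [linForm_apply, Finset.sum_add_distrib, add_mul]

theorem mul (hf : CubeC1 R f f') (hg : CubeC1 R g g') :
    CubeC1 R (fun x => f x * g x) fun k x => f' k x * g x + f x * g' k x where
  cont := hf.cont.mul hg.cont
  cont' k := ((hf.cont' k).mul hg.cont).add (hf.cont.mul (hg.cont' k))
  hasFDerivAt x hx := by
    refine ((hf.hasFDerivAt x hx).mul (hg.hasFDerivAt x hx)).congr_fderiv ?_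
    ext y
    simp only [add_apply, smul_apply, linForm_apply,
      smul_eq_mul, Finset.mul_sum, ← Finset.sum_add_distrib]
    exact Finset.sum_congr rfl fun k _ => by ring

theorem const (c : ℝ) : CubeC1 R (fun _ : Pt d => c) fun _ _ => 0 where
  cont := continuousOn_const
  cont' _ := continuousOn_const
  hasFDerivAt x _ := (hasFDerivAt_const c x).congr_fderiv (by ext y; simp [linForm_apply])

theorem const_mul (c : ℝ) (hf : CubeC1 R f f') :
    CubeC1 R (fun x => c * f x) fun k x => c * f' k x := by
  simpa using (const c).mul hf

theorem sum {ι : Type*} (s : Finset ι) {F : ι → Pt d → ℝ} {F' : ι → Fin (d + 1) → Pt d → ℝ}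
    (h : ∀ i ∈ s, CubeC1 R (F i) (F' i)) :
    CubeC1 R (fun x => ∑ i ∈ s, F i x) fun k x => ∑ i ∈ s, F' i k x where
  cont := continuousOn_finsetSum _ fun i hi => (h i hi).cont
  cont' k := continuousOn_finsetSum _ fun i hi => (h i hi).cont' k
  hasFDerivAt x hx := by
    refine (HasFDerivAt.fun_sum fun i hi => (h i hi).hasFDerivAt x hx).congr_fderiv ?_
    ext y
    simp only [sum_apply, linForm_apply, Finset.sum_mul]
    exact Finset.sum_comm

theorem of_contDiff {n : WithTop ℕ∞} (hn : 1 ≤ n) (hf : ContDiff ℝ n f) :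
    CubeC1 R f fun k => partialDeriv k f where
  cont := hf.continuous.continuousOn
  cont' k := ((hf.continuous_fderiv (by positivity)).clm_apply continuous_const).continuousOn
  hasFDerivAt x _ := by
    have := ((hf.differentiable (by positivity)) x).hasFDerivAt
    rwa [eq_linForm (fderiv ℝ f x)] at this

theorem of_contDiffOn (hR : 0 < R) (hf : ContDiffOn ℝ 1 f (closedCube d R)) :
    CubeC1 R f fun k => partialDerivOn R k f where
  cont := hf.continuousOn
  cont' k := by
    have hu : UniqueDiffOn ℝ (closedCube d R) :=
      UniqueDiffOn.univ_pi fun _ => uniqueDiffOn_Icc (by linarith)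
    exact (hf.continuousOn_fderivWithin hu le_rfl).clm_apply continuousOn_const
  hasFDerivAt x hx := by
    have hm := closedCube_mem_nhds hx
    have := ((hf x (cube_subset_closedCube hx)).contDiffAt hm).differentiableAt one_ne_zero
    have h2 := this.hasFDerivAt
    rw [← fderivWithin_of_mem_nhds hm, eq_linForm (fderivWithin ℝ f _ x)] at h2
    exact h2

/-- The divergence theorem for one component of a vector field. -/
theorem integral_partial (hR : 0 < R) (hf : CubeC1 R f f') (i : Fin (d + 1)) :
    ∫ x, f' i x ∂cubeMeasure d R =
      ∫ y, f (facePt i R y) ∂faceMeasure d R - ∫ y, f (facePt i (-R) y) ∂faceMeasure d R := by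
  have hle : (fun _ => -R : Pt d) ≤ fun _ => R := fun _ => by dsimp only; linarith
  have key := integral_divergence_of_hasFDerivAt_off_countable' (E := ℝ)
    (fun _ => -R : Pt d) (fun _ => R) hle
    (fun j x => if j = i then f x else 0)
    (fun j x => if j = i then linForm (fun k => f' k x) else 0) ∅ countable_empty
    (fun j => ?_) (fun x hx j => ?_) ?_
  · have e : ∀ x : Pt d, (∑ j, (if j = i then linForm (fun k => f' k x) else 0)
        (Pi.single j 1)) = f' i x := by
      intro x
      rw [Finset.sum_eq_single i (fun j _ hj => by simp [hj]) (by simp)]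
      simp [linForm_single]
    simp only [e] at key
    rw [Finset.sum_eq_single i (fun j _ hj => by simp [hj]) (by simp)] at key
    simp only [if_true] at key
    rw [cubeMeasure_eq_restrict_closedCube, closedCube_eq_Icc, face_restrict_closed]
    exact key
  · by_cases h : j = i
    · simpa [h, ← closedCube_eq_Icc] using hf.cont
    · simpa [h] using continuousOn_const
  · by_cases h : j = i
    · simpa [h] using hf.hasFDerivAt x hx.1
    · simpa [h] using hasFDerivAt_const (0 : ℝ) x
  · have e : ∀ x : Pt d, (∑ j, (if j = i then linForm (fun k => f' k x) else 0)
        (Pi.single j 1)) = f' i x := by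
      intro x
      rw [Finset.sum_eq_single i (fun j _ hj => by simp [hj]) (by simp)]
      simp [linForm_single]
    simp only [e]
    rw [← closedCube_eq_Icc]
    exact (hf.cont' i).integrableOn_compact isCompact_closedCube

end CubeC1

end CubeC1

/-! ### Convergence in `L²` -/

section L2

variable {α : Type*} {m : MeasurableSpace α} {μ : Measure α}

theorem inner_toLp {f g : α → ℝ} (hf : MemLp f 2 μ) (hg : MemLp g 2 μ) :
    inner ℝ (hf.toLp f) (hg.toLp g) = ∫ x, f x * g x ∂μ := by
  rw [L2.inner_def]
  refine integral_congr_ae ?_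
  filter_upwards [hf.coeFn_toLp, hg.coeFn_toLp] with x h1 h2
  simp [h1, h2, mul_comm]

theorem integrable_mul_of_memLp {f g : α → ℝ} (hf : MemLp f 2 μ) (hg : MemLp g 2 μ) :
    Integrable (fun x => f x * g x) μ :=
  MemLp.integrable_mul hf hg

/-- Integrals of products depend continuously on the factors in `L²`. -/
theorem tendsto_integral_mul {F G : ℕ → α → ℝ} {f g : α → ℝ} (hF : ∀ n, MemLp (F n) 2 μ)
    (hG : ∀ n, MemLp (G n) 2 μ) (hf : MemLp f 2 μ) (hg : MemLp g 2 μ)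
    (h1 : Tendsto (fun n => eLpNorm (fun x => F n x - f x) 2 μ) atTop (𝓝 0))
    (h2 : Tendsto (fun n => eLpNorm (fun x => G n x - g x) 2 μ) atTop (𝓝 0)) :
    Tendsto (fun n => ∫ x, F n x * G n x ∂μ) atTop (𝓝 (∫ x, f x * g x ∂μ)) := by
  have k1 := (Lp.tendsto_Lp_iff_tendsto_eLpNorm'' F hF f hf).2 h1
  have k2 := (Lp.tendsto_Lp_iff_tendsto_eLpNorm'' G hG g hg).2 h2
  have := k1.inner (𝕜 := ℝ) k2
  simpa only [inner_toLp] using this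

theorem tendsto_integral_mul_const {F : ℕ → α → ℝ} {f g : α → ℝ} (hF : ∀ n, MemLp (F n) 2 μ)
    (hf : MemLp f 2 μ) (hg : MemLp g 2 μ)
    (h1 : Tendsto (fun n => eLpNorm (fun x => F n x - f x) 2 μ) atTop (𝓝 0)) :
    Tendsto (fun n => ∫ x, F n x * g x ∂μ) atTop (𝓝 (∫ x, f x * g x ∂μ)) :=
  tendsto_integral_mul hF (fun _ => hg) hf hg h1 (by simp)

end L2

/-! ### Partial derivatives of smooth functions -/

section PartialDeriv

variable {d : ℕ} {R : ℝ} {f g : Pt d → ℝ}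

theorem contDiff_partialDeriv (hf : ContDiff ℝ ∞ f) (i : Fin (d + 1)) :
    ContDiff ℝ ∞ (partialDeriv i f) :=
  (hf.fderiv_right (m := ∞) (by simp)).clm_apply contDiff_const

theorem partialDeriv_mul (hf : ContDiff ℝ ∞ f) (hg : ContDiff ℝ ∞ g) (i : Fin (d + 1)) (x : Pt d) :
    partialDeriv i (fun x => f x * g x) x
      = partialDeriv i f x * g x + f x * partialDeriv i g x := by
  have h1 := (hf.differentiable (by simp)) x
  have h2 := (hg.differentiable (by simp)) x
  simp only [partialDeriv, fderiv_fun_mul h1 h2, add_apply, smul_apply, smul_eq_mul]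
  ring

theorem partialDeriv_sub (hf : ContDiff ℝ ∞ f) (hg : ContDiff ℝ ∞ g) (i : Fin (d + 1)) (x : Pt d) :
    partialDeriv i (fun x => f x - g x) x = partialDeriv i f x - partialDeriv i g x := by
  have h1 := (hf.differentiable (by simp)) x
  have h2 := (hg.differentiable (by simp)) x
  simp [partialDeriv, fderiv_fun_sub h1 h2]

theorem partialDeriv_add (hf : ContDiff ℝ ∞ f) (hg : ContDiff ℝ ∞ g) (i : Fin (d + 1)) (x : Pt d) :
    partialDeriv i (fun x => f x + g x) x = partialDeriv i f x + partialDeriv i g x := by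
  have h1 := (hf.differentiable (by simp)) x
  have h2 := (hg.differentiable (by simp)) x
  simp [partialDeriv, fderiv_fun_add h1 h2]

theorem partialDeriv_comm (hf : ContDiff ℝ ∞ f) (i j : Fin (d + 1)) (x : Pt d) :
    partialDeriv i (partialDeriv j f) x = partialDeriv j (partialDeriv i f) x := by
  have hs : IsSymmSndFDerivAt ℝ f x :=
    (hf.contDiffAt (x := x)).isSymmSndFDerivAt
      (by simpa using (mod_cast le_top : ((2 : ℕ∞) : WithTop ℕ∞) ≤ (∞ : WithTop ℕ∞)))
  have hd : DifferentiableAt ℝ (fderiv ℝ f) x :=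
    ((hf.fderiv_right (m := ∞) (by simp)).differentiable (by simp)) x
  have e : ∀ a b : Fin (d + 1), partialDeriv a (partialDeriv b f) x
      = fderiv ℝ (fderiv ℝ f) x (Pi.single a 1) (Pi.single b 1) := by
    intro a b
    have : partialDeriv b f = fun y => fderiv ℝ f y (Pi.single b 1) := rfl
    rw [this, partialDeriv, fderiv_clm_apply hd (differentiableAt_const _)]
    simp
  rw [e, e]
  exact hs _ _

theorem contDiff_comp_coord {h : ℝ → ℝ} (hh : ContDiff ℝ ∞ h) (m : Fin (d + 1)) :
    ContDiff ℝ ∞ fun x : Pt d => h (x m) :=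
  hh.comp (contDiff_apply ℝ ℝ m)

theorem partialDeriv_comp_coord {h : ℝ → ℝ} (hh : ContDiff ℝ ∞ h) (i m : Fin (d + 1)) (x : Pt d) :
    partialDeriv i (fun x : Pt d => h (x m)) x = if m = i then deriv h (x m) else 0 := by
  have h1 : HasDerivAt h (deriv h (x m)) (x m) :=
    (hh.differentiable (by simp) _).hasDerivAt
  have h2 : HasFDerivAt (fun x : Pt d => x m) (ContinuousLinearMap.proj m : Pt d →L[ℝ] ℝ) x :=
    hasFDerivAt_apply m x
  have := h1.comp_hasFDerivAt x h2
  rw [partialDeriv, show (fun x : Pt d => h (x m)) = h ∘ fun x => x m from rfl, this.fderiv]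
  simp [Pi.single_apply]

theorem memLp_smooth (hf : ContDiff ℝ ∞ f) {p : ℝ≥0∞} : MemLp f p (cubeMeasure d R) :=
  memLp_of_continuousOn hf.continuous.continuousOn

theorem continuous_facePt (i : Fin (d + 1)) (c : ℝ) : Continuous (facePt (d := d) i c) :=
  continuous_const.finInsertNth i continuous_id

theorem memLp_face {h : (Fin d → ℝ) → ℝ} (hh : Continuous h) {p : ℝ≥0∞} :
    MemLp h p (faceMeasure d R) := by
  obtain ⟨C, hC⟩ := (isCompact_univ_pi fun _ : Fin d => isCompact_Icc
    (a := -R) (b := R)).exists_bound_of_continuousOn hh.continuousOn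
  refine MemLp.of_bound hh.aestronglyMeasurable C ?_
  filter_upwards [ae_mem_faceCube] with x hx using
    hC x (pi_mono (fun _ _ => Ioo_subset_Icc_self) hx)

theorem exists_bound_smooth (hf : ContDiff ℝ ∞ f) :
    ∃ C, 0 ≤ C ∧ ∀ x ∈ closedCube d R, |f x| ≤ C := by
  obtain ⟨C, hC⟩ := isCompact_closedCube.exists_bound_of_continuousOn
    (hf.continuous.continuousOn (s := closedCube d R))
  exact ⟨|C|, abs_nonneg _, fun x hx => (hC x hx).trans (le_abs_self _)⟩

/-- Integration by parts in the cube for two smooth functions. -/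
theorem integral_parts_smooth (hR : 0 < R) (hf : ContDiff ℝ ∞ f) (hg : ContDiff ℝ ∞ g)
    (i : Fin (d + 1)) :
    ∫ x, f x * partialDeriv i g x ∂cubeMeasure d R + ∫ x, partialDeriv i f x * g x ∂cubeMeasure d R
      = ∫ y, f (facePt i R y) * g (facePt i R y) ∂faceMeasure d R
        - ∫ y, f (facePt i (-R) y) * g (facePt i (-R) y) ∂faceMeasure d R := by
  have h := (CubeC1.of_contDiff (R := R) (by simp) (hf.mul hg)).integral_partial hR i
  rw [← h, ← integral_add]
  · exact integral_congr_ae (.of_forall fun x => by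
      simp only []; rw [partialDeriv_mul hf hg]; ring)
  · exact integrable_mul_of_memLp (memLp_smooth hf) (memLp_smooth (contDiff_partialDeriv hg i))
  · exact integrable_mul_of_memLp (memLp_smooth (contDiff_partialDeriv hf i)) (memLp_smooth hg)

end PartialDeriv

/-! ### Weak derivatives tested against functions that need not have compact support -/

section Weak

variable {d : ℕ} {R : ℝ} {u : Pt d → ℝ} {Du : Fin (d + 1) → Pt d → ℝ}
  {D2u : Fin (d + 1) → Fin (d + 1) → Pt d → ℝ} {φ : Pt d → ℝ}

/-- Weak integration by parts up to one face, on which the trace vanishes. -/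
theorem integral_parts_of_trace_zero (hR : 0 < R) {i : Fin (d + 1)} {c : ℝ} (hc : c = R ∨ c = -R)
    (hu : MemLp u 2 (cubeMeasure d R)) (hDu : MemLp (Du i) 2 (cubeMeasure d R))
    (ht : HasTrace R i c u Du 0) (hφ : ContDiff ℝ ∞ φ) (h0 : ∀ x : Pt d, x i = -c → φ x = 0) :
    ∫ x, u x * partialDeriv i φ x ∂cubeMeasure d R = -∫ x, Du i x * φ x ∂cubeMeasure d R := by
  obtain ⟨-, v, hv, hv0, hv1, hvt⟩ := ht
  have hφ' := contDiff_partialDeriv hφ i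
  have l1 := tendsto_integral_mul_const (fun k => memLp_smooth (hv k)) hu
    (memLp_smooth (R := R) hφ') hv0
  have l2 := tendsto_integral_mul_const
    (fun k => memLp_smooth (contDiff_partialDeriv (hv k) i)) hDu (memLp_smooth (R := R) hφ) (hv1 i)
  have l3 := tendsto_integral_mul_const (g := fun y => φ (facePt i c y))
    (fun k => memLp_face ((hv k).continuous.comp (continuous_facePt i c))) (f := 0) (by simp)
    (memLp_face (hφ.continuous.comp (continuous_facePt i c))) hvt
  have e : ∀ k, ∫ x, v k x * partialDeriv i φ x ∂cubeMeasure d R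
      + ∫ x, partialDeriv i (v k) x * φ x ∂cubeMeasure d R
      = (if c = R then 1 else -1) * ∫ y, v k (facePt i c y) * φ (facePt i c y)
        ∂faceMeasure d R := by
    intro k
    rw [integral_parts_smooth hR (hv k) hφ i]
    have hz : ∀ y, φ (facePt i (-c) y) = 0 := fun y => h0 _ (by simp [facePt])
    rcases hc with rfl | rfl
    · simp [hz]
    · have : -R ≠ R := by linarith
      simp only [neg_neg] at hz
      simp [hz, this]
  have l4 := (l1.add l2)
  simp only [e] at l4
  have l5 := tendsto_nhds_unique l4 (l3.const_mul _)
  simp only [Pi.zero_apply, zero_mul, integral_zero, mul_zero] at l5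
  linarith

/-- If the traces of `u ∈ H¹` on the two faces orthogonal to the direction `i` vanish, then
integration by parts in this direction produces no boundary term, for every smooth test function. -/
theorem integral_parts_of_traces_zero (hR : 0 < R) {i : Fin (d + 1)}
    (hu : MemLp u 2 (cubeMeasure d R)) (hDu : MemLp (Du i) 2 (cubeMeasure d R))
    (ht : HasTrace R i R u Du 0) (ht' : HasTrace R i (-R) u Du 0) (hφ : ContDiff ℝ ∞ φ) :
    ∫ x, u x * partialDeriv i φ x ∂cubeMeasure d R = -∫ x, Du i x * φ x ∂cubeMeasure d R := by
  have c1 : ContDiff ℝ ∞ fun x : Pt d => φ x * ((x i + R) / (2 * R)) := by fun_prop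
  have c2 : ContDiff ℝ ∞ fun x : Pt d => φ x * ((R - x i) / (2 * R)) := by fun_prop
  have h1 := integral_parts_of_trace_zero hR (Or.inl rfl) hu hDu ht c1
    (fun x hx => by simp [hx])
  have h2 := integral_parts_of_trace_zero hR (Or.inr rfl) hu hDu ht' c2
    (fun x hx => by simp [hx])
  have e : φ = fun x => φ x * ((x i + R) / (2 * R)) + φ x * ((R - x i) / (2 * R)) := by
    ext x; field_simp; ring
  have e2 : partialDeriv i φ = fun x => partialDeriv i (fun x => φ x * ((x i + R) / (2 * R))) x
      + partialDeriv i (fun x => φ x * ((R - x i) / (2 * R))) x := by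
    ext x; conv_lhs => rw [e]
    exact partialDeriv_add c1 c2 i x
  rw [e2]
  conv_rhs => rw [e]
  simp only [mul_add]
  rw [integral_add, integral_add, h1, h2, neg_add]
  · exact integrable_mul_of_memLp hDu (memLp_smooth c1)
  · exact integrable_mul_of_memLp hDu (memLp_smooth c2)
  · exact integrable_mul_of_memLp hu (memLp_smooth (contDiff_partialDeriv c1 i))
  · exact integrable_mul_of_memLp hu (memLp_smooth (contDiff_partialDeriv c2 i))

end Weak

/-! ### Cutoff functions and weak identities up to the boundary -/

section Cutoff

variable {R : ℝ}

theorem deriv_smoothTransition_of_one_lt {s : ℝ} (hs : 1 < s) :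
    deriv Real.smoothTransition s = 0 := by
  have : Real.smoothTransition =ᶠ[𝓝 s] fun _ => 1 := by
    filter_upwards [lt_mem_nhds hs] with t ht using Real.smoothTransition.one_of_one_le ht.le
  rw [this.deriv_eq]; simp

theorem deriv_smoothTransition_of_neg {s : ℝ} (hs : s < 0) :
    deriv Real.smoothTransition s = 0 := by
  have : Real.smoothTransition =ᶠ[𝓝 s] fun _ => 0 := by
    filter_upwards [gt_mem_nhds hs] with t ht using Real.smoothTransition.zero_of_nonpos ht.le
  rw [this.deriv_eq]; simp

theorem contDiff_smoothTransition : ContDiff ℝ ∞ Real.smoothTransition :=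
  Real.smoothTransition.contDiff

theorem exists_bound_deriv_smoothTransition :
    ∃ C, 0 ≤ C ∧ ∀ s, |deriv Real.smoothTransition s| ≤ C := by
  have hc : Continuous (deriv Real.smoothTransition) :=
    contDiff_smoothTransition.continuous_deriv (by simp)
  obtain ⟨C, hC⟩ := (isCompact_Icc (a := (0 : ℝ)) (b := 1)).exists_bound_of_continuousOn
    hc.continuousOn
  refine ⟨|C|, abs_nonneg _, fun s => ?_⟩
  rcases lt_or_ge s 0 with h | h
  · simp [deriv_smoothTransition_of_neg h]
  rcases lt_or_ge 1 s with h' | h'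
  · simp [deriv_smoothTransition_of_one_lt h']
  · exact (hC s ⟨h, h'⟩).trans (le_abs_self _)

/-- A smooth cutoff that vanishes within distance `1 / N` of `± R`, and equals `1` on the points
of `[-R, R]` at distance at least `2 / N` from `± R`. -/
noncomputable def cutoff (R : ℝ) (N : ℕ) (t : ℝ) : ℝ :=
  Real.smoothTransition (N * (t + R) - 1) * Real.smoothTransition (N * (R - t) - 1)

theorem contDiff_cutoff (N : ℕ) : ContDiff ℝ ∞ (cutoff R N) :=
  (contDiff_smoothTransition.comp (by fun_prop)).mul (contDiff_smoothTransition.comp (by fun_prop))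

theorem cutoff_nonneg (N : ℕ) (t : ℝ) : 0 ≤ cutoff R N t :=
  mul_nonneg (Real.smoothTransition.nonneg _) (Real.smoothTransition.nonneg _)

theorem cutoff_le_one (N : ℕ) (t : ℝ) : cutoff R N t ≤ 1 :=
  mul_le_one₀ (Real.smoothTransition.le_one _) (Real.smoothTransition.nonneg _)
    (Real.smoothTransition.le_one _)

theorem abs_cutoff_le_one (N : ℕ) (t : ℝ) : |cutoff R N t| ≤ 1 := by
  rw [abs_of_nonneg (cutoff_nonneg N t)]; exact cutoff_le_one N t

theorem le_of_cutoff_ne_zero {N : ℕ} {t : ℝ} (h : cutoff R N t ≠ 0) :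
    1 ≤ N * (t + R) ∧ 1 ≤ N * (R - t) := by
  constructor <;> by_contra! h'
  · exact h (by rw [cutoff, Real.smoothTransition.zero_of_nonpos (by linarith), zero_mul])
  · exact h (by rw [cutoff, Real.smoothTransition.zero_of_nonpos (x := N * (R - t) - 1)
      (by linarith), mul_zero])

theorem cutoff_eq_zero_of_endpoint {N : ℕ} {t : ℝ} (h : t = R ∨ t = -R) : cutoff R N t = 0 := by
  by_contra h'
  have := le_of_cutoff_ne_zero h'
  rcases h with rfl | rfl <;> norm_num at this

theorem deriv_cutoff (N : ℕ) (t : ℝ) : deriv (cutoff R N) t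
    = (N * deriv Real.smoothTransition (N * (t + R) - 1))
        * Real.smoothTransition (N * (R - t) - 1)
      - Real.smoothTransition (N * (t + R) - 1)
        * (N * deriv Real.smoothTransition (N * (R - t) - 1)) := by
  have hd : ∀ s, HasDerivAt Real.smoothTransition (deriv Real.smoothTransition s) s := fun s =>
    (contDiff_smoothTransition.differentiable (by simp) s).hasDerivAt
  have l1 : HasDerivAt (fun t : ℝ => N * (t + R) - 1) (N : ℝ) t := by
    simpa using (((hasDerivAt_id t).add_const R).const_mul (N : ℝ)).sub_const 1
  have l2 : HasDerivAt (fun t : ℝ => N * (R - t) - 1) (-(N : ℝ)) t := by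
    simpa using (((hasDerivAt_id t).const_sub R).const_mul (N : ℝ)).sub_const 1
  have := ((hd _).comp t l1).mul ((hd _).comp t l2)
  rw [show cutoff R N = _ from rfl]
  refine this.deriv.trans ?_
  simp only [Function.comp]
  ring

theorem eventually_two_lt_mul {a : ℝ} (ha : 0 < a) : ∀ᶠ N : ℕ in atTop, 2 < N * a := by
  have : Tendsto (fun N : ℕ => (N : ℝ) * a) atTop atTop :=
    tendsto_natCast_atTop_atTop.atTop_mul_const ha
  exact this.eventually_gt_atTop 2

theorem cutoff_eventually_eq_one {t : ℝ} (h1 : -R < t) (h2 : t < R) :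
    ∀ᶠ N : ℕ in atTop, cutoff R N t = 1 ∧ deriv (cutoff R N) t = 0 := by
  filter_upwards [eventually_two_lt_mul (a := t + R) (by linarith),
    eventually_two_lt_mul (a := R - t) (by linarith)] with N ha hb
  constructor
  · rw [cutoff, Real.smoothTransition.one_of_one_le (by linarith),
      Real.smoothTransition.one_of_one_le (by linarith), one_mul]
  · rw [deriv_cutoff, deriv_smoothTransition_of_one_lt (by linarith),
      deriv_smoothTransition_of_one_lt (by linarith)]
    simp

/-- The derivative of the cutoff is at most a constant over the distance to `± R`. -/
theorem exists_bound_deriv_cutoff (R : ℝ) : ∃ C, 0 ≤ C ∧ ∀ (N : ℕ) (t y : ℝ), -R ≤ t → t ≤ R →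
    |y| ≤ t + R → |y| ≤ R - t → |y * deriv (cutoff R N) t| ≤ C := by
  obtain ⟨C, hC0, hC⟩ := exists_bound_deriv_smoothTransition
  have key : ∀ (N : ℕ) (a y : ℝ), |y| ≤ a →
      |y * (N * deriv Real.smoothTransition (N * a - 1))| ≤ 2 * C := by
    intro N a y hy
    rcases lt_or_ge 1 (N * a - 1) with h | h
    · simp [deriv_smoothTransition_of_one_lt h, hC0]
    · have hN : (0 : ℝ) ≤ N := Nat.cast_nonneg N
      rw [← mul_assoc, abs_mul]
      refine mul_le_mul ?_ (hC _) (abs_nonneg _) (by norm_num)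
      rw [abs_mul, abs_of_nonneg hN]
      calc |y| * N ≤ a * N := by gcongr
        _ ≤ 2 := by linarith
  refine ⟨4 * C, by positivity, fun N t y _ _ h1 h2 => ?_⟩
  have k1 := key N (t + R) y h1
  have k2 := key N (R - t) y h2
  have s1 : ∀ s, |Real.smoothTransition s| ≤ 1 := fun s => by
    rw [abs_of_nonneg (Real.smoothTransition.nonneg _)]; exact Real.smoothTransition.le_one _
  rw [deriv_cutoff, mul_sub]
  have e1 := abs_sub (y * ((N * deriv Real.smoothTransition (N * (t + R) - 1))
    * Real.smoothTransition (N * (R - t) - 1))) (y * (Real.smoothTransition (N * (t + R) - 1)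
        * (N * deriv Real.smoothTransition (N * (R - t) - 1))))
  have e2 : |y * ((N * deriv Real.smoothTransition (N * (t + R) - 1))
      * Real.smoothTransition (N * (R - t) - 1))| ≤ 2 * C := by
    rw [← mul_assoc, abs_mul]
    exact (mul_le_of_le_one_right (abs_nonneg _) (s1 _)).trans k1
  have e3 : |y * (Real.smoothTransition (N * (t + R) - 1)
        * (N * deriv Real.smoothTransition (N * (R - t) - 1)))| ≤ 2 * C := by
    rw [mul_left_comm, abs_mul]
    exact (mul_le_of_le_one_left (abs_nonneg _) (s1 _)).trans k2
  linarith

end Cutoff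

section WeakUpToBoundary

variable {d : ℕ} {R : ℝ} {u : Pt d → ℝ} {Du : Fin (d + 1) → Pt d → ℝ}
  {D2u : Fin (d + 1) → Fin (d + 1) → Pt d → ℝ} {φ : Pt d → ℝ}

theorem partialDeriv_prod {h : Fin (d + 1) → ℝ → ℝ} (hh : ∀ m, ContDiff ℝ ∞ (h m))
    (j : Fin (d + 1)) (x : Pt d) :
    partialDeriv j (fun x : Pt d => ∏ m, h m (x m)) x
      = deriv (h j) (x j) * ∏ m ∈ Finset.univ.erase j, h m (x m) := by
  have h1 : ∀ m ∈ Finset.univ, HasFDerivAt (fun x : Pt d => h m (x m))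
      (fderiv ℝ (fun x : Pt d => h m (x m)) x) x := fun m _ =>
    ((contDiff_comp_coord (hh m) m).differentiable (by simp) x).hasFDerivAt
  have h2 := HasFDerivAt.finsetProd h1
  rw [partialDeriv, h2.fderiv, sum_apply,
    Finset.sum_eq_single j]
  · have := partialDeriv_comp_coord (hh j) j j x
    rw [partialDeriv] at this
    simp [this, mul_comm]
  · intro m _ hm
    have := partialDeriv_comp_coord (hh m) j m x
    rw [partialDeriv, if_neg hm] at this
    simp [this]
  · simp

theorem contDiff_prod_coord {h : Fin (d + 1) → ℝ → ℝ} (hh : ∀ m, ContDiff ℝ ∞ (h m)) :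
    ContDiff ℝ ∞ fun x : Pt d => ∏ m, h m (x m) :=
  contDiff_prod fun m _ => contDiff_comp_coord (hh m) m

/-- The product of the cutoffs in all coordinates. -/
noncomputable def cubeCutoff (R : ℝ) (N : ℕ) (x : Pt d) : ℝ := ∏ m, cutoff R N (x m)

theorem contDiff_cubeCutoff (N : ℕ) : ContDiff ℝ ∞ (cubeCutoff (d := d) R N) :=
  contDiff_prod_coord fun _ => contDiff_cutoff N

theorem abs_prod_cutoff_le_one (N : ℕ) (s : Finset (Fin (d + 1))) (x : Pt d) :
    |∏ m ∈ s, cutoff R N (x m)| ≤ 1 := by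
  rw [Finset.abs_prod]
  exact Finset.prod_le_one (fun _ _ => abs_nonneg _) fun m _ => abs_cutoff_le_one N (x m)

theorem tsupport_mul_cubeCutoff_subset (N : ℕ) (φ : Pt d → ℝ) :
    tsupport (fun x => φ x * cubeCutoff R N x) ⊆ cube d R := by
  have h1 : tsupport (fun x => φ x * cubeCutoff R N x) ⊆
      {x | ∀ m, 1 ≤ N * (x m + R) ∧ 1 ≤ N * (R - x m)} := by
    refine closure_minimal (fun x hx m => le_of_cutoff_ne_zero fun h => hx ?_) ?_
    · simp only [cubeCutoff]
      rw [Finset.prod_eq_zero (Finset.mem_univ m) h, mul_zero]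
    · simp only [ofPred_forall, ofPred_and]
      refine isClosed_iInter fun m => IsClosed.inter ?_ ?_
      · exact isClosed_le continuous_const (by fun_prop)
      · exact isClosed_le continuous_const (by fun_prop)
  refine h1.trans fun x hx => mem_cube.2 fun m => ?_
  have hN : (0 : ℝ) ≤ N := Nat.cast_nonneg N
  obtain ⟨ha, hb⟩ := hx m
  constructor
  · by_contra! h
    have := mul_nonpos_of_nonneg_of_nonpos hN (by linarith : x m + R ≤ 0)
    linarith
  · by_contra! h
    have := mul_nonpos_of_nonneg_of_nonpos hN (by linarith : R - x m ≤ 0)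
    linarith

theorem hasCompactSupport_mul_cubeCutoff (N : ℕ) (φ : Pt d → ℝ) :
    HasCompactSupport fun x => φ x * cubeCutoff R N x :=
  isCompact_closedCube.of_isClosed_subset (isClosed_tsupport _)
    ((tsupport_mul_cubeCutoff_subset N φ).trans cube_subset_closedCube)

theorem cubeCutoff_eventually_eq_one {x : Pt d} (hx : x ∈ cube d R) :
    ∀ᶠ N : ℕ in atTop, ∀ m, cutoff R N (x m) = 1 ∧ deriv (cutoff R N) (x m) = 0 :=
  eventually_all.2 fun m => cutoff_eventually_eq_one (mem_cube.1 hx m).1 (mem_cube.1 hx m).2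

/-- A smooth function that vanishes on a face of the cube is bounded by a multiple of the distance
to this face. -/
theorem exists_bound_dist_face (hφ : ContDiff ℝ ∞ φ) {j : Fin (d + 1)} {c : ℝ}
    (hc : c ∈ Icc (-R) R) (h0 : ∀ x : Pt d, x j = c → φ x = 0) :
    ∃ L, 0 < L ∧ ∀ x ∈ closedCube d R, |φ x| ≤ L * |x j - c| := by
  obtain ⟨L, hL⟩ := isCompact_closedCube.exists_bound_of_continuousOn
    ((hφ.continuous_fderiv (by simp)).continuousOn (s := closedCube d R))
  refine ⟨|L| + 1, by positivity, fun x hx => ?_⟩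
  have hy : Function.update x j c ∈ closedCube d R := by
    rw [mem_closedCube]
    intro m
    rcases eq_or_ne m j with rfl | h
    · simpa using hc
    · simpa [h] using mem_closedCube.1 hx m
  have h1 := convex_closedCube.norm_image_sub_le_of_norm_fderiv_le
    (fun y _ => hφ.differentiable (by simp) y) hL hy hx
  rw [h0 (Function.update x j c) (by simp), sub_zero, Real.norm_eq_abs] at h1
  refine h1.trans ?_
  have h2 : ‖x - Function.update x j c‖ ≤ |x j - c| := by
    rw [pi_norm_le_iff_of_nonneg (abs_nonneg _)]
    intro m
    rcases eq_or_ne m j with rfl | h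
    · simp
    · simp [h]
  have := le_abs_self L
  gcongr
  linarith

/-- Weak integration by parts in the direction `j` for test functions that need to vanish only on
the two faces orthogonal to this direction: cutoffs in the other variables do no harm, and the
derivative of the cutoff in `xⱼ` is compensated by the factor that vanishes on the faces. -/
theorem HasWeakPartial.integral_parts (hR : 0 < R) {f g : Pt d → ℝ} {j : Fin (d + 1)}
    (hw : HasWeakPartial R j f g) (hf : MemLp f 2 (cubeMeasure d R))
    (hg : MemLp g 2 (cubeMeasure d R)) (hφ : ContDiff ℝ ∞ φ)
    (h0 : ∀ x : Pt d, x j = R ∨ x j = -R → φ x = 0) :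
    ∫ x, f x * partialDeriv j φ x ∂cubeMeasure d R = -∫ x, g x * φ x ∂cubeMeasure d R := by
  have hf1 : Integrable f (cubeMeasure d R) := hf.integrable (by norm_num)
  have hg1 : Integrable g (cubeMeasure d R) := hg.integrable (by norm_num)
  have hφ' := contDiff_partialDeriv hφ j
  obtain ⟨C0, hC0, hb0⟩ := exists_bound_smooth (R := R) hφ
  obtain ⟨C1, hC1, hb1⟩ := exists_bound_smooth (R := R) hφ'
  obtain ⟨L1, hL1, hb2⟩ := exists_bound_dist_face (c := R) (R := R) hφ ⟨by linarith, le_rfl⟩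
    (j := j) (fun x hx => h0 x (Or.inl hx))
  obtain ⟨L2, hL2, hb3⟩ := exists_bound_dist_face (c := -R) (R := R) hφ ⟨le_rfl, by linarith⟩
    (j := j) (fun x hx => h0 x (Or.inr hx))
  obtain ⟨K, hK, hbK⟩ := exists_bound_deriv_cutoff R
  have hder : ∀ N x, partialDeriv j (fun x => φ x * cubeCutoff R N x) x
      = partialDeriv j φ x * cubeCutoff R N x + φ x * (deriv (cutoff R N) (x j)
        * ∏ m ∈ Finset.univ.erase j, cutoff R N (x m)) := by
    intro N x
    rw [partialDeriv_mul hφ (contDiff_cubeCutoff N)]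
    congr 2
    exact partialDeriv_prod (fun _ => contDiff_cutoff N) j x
  have hφN : ∀ N, ContDiff ℝ ∞ fun x => φ x * cubeCutoff R N x := fun N =>
    hφ.mul (contDiff_cubeCutoff N)
  have hbound : ∀ N, ∀ x ∈ closedCube d R,
      |φ x * (deriv (cutoff R N) (x j) * ∏ m ∈ Finset.univ.erase j, cutoff R N (x m))|
        ≤ (L1 + L2) * K := by
    intro N x hx
    have hxj := mem_closedCube.1 hx j
    have hL : 0 < L1 + L2 := by positivity
    have a1 := hb2 x hx
    have a2 := hb3 x hx
    rw [abs_of_nonpos (by linarith : x j - R ≤ 0)] at a1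
    rw [abs_of_nonneg (by linarith : 0 ≤ x j - -R)] at a2
    have a3 := hbK N (x j) (φ x / (L1 + L2)) hxj.1 hxj.2
      (by
        rw [abs_div, abs_of_pos hL, div_le_iff₀ hL]
        nlinarith)
      (by
        rw [abs_div, abs_of_pos hL, div_le_iff₀ hL]
        nlinarith)
    rw [← mul_assoc, abs_mul]
    refine (mul_le_of_le_one_right (abs_nonneg _) (abs_prod_cutoff_le_one N _ x)).trans ?_
    have e : φ x * deriv (cutoff R N) (x j)
        = (L1 + L2) * (φ x / (L1 + L2) * deriv (cutoff R N) (x j)) := by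
      field_simp
    rw [e, abs_mul, abs_of_pos hL]
    gcongr
  have t1 : Tendsto (fun N : ℕ => ∫ x, f x * partialDeriv j (fun x => φ x * cubeCutoff R N x) x
      ∂cubeMeasure d R) atTop (𝓝 (∫ x, f x * partialDeriv j φ x ∂cubeMeasure d R)) := by
    refine tendsto_integral_of_dominated_convergence (fun x => |f x| * (C1 + (L1 + L2) * K))
      (fun N => hf.1.mul (contDiff_partialDeriv (hφN N) j).continuous.aestronglyMeasurable)
      (hf1.abs.mul_const _) (fun N => ?_) ?_
    · filter_upwards [ae_mem_cube] with x hx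
      have hx' := cube_subset_closedCube hx
      rw [hder, Real.norm_eq_abs, abs_mul]
      gcongr
      refine (abs_add_le _ _).trans (add_le_add ?_ (hbound N x hx'))
      rw [abs_mul]
      exact (mul_le_of_le_one_right (abs_nonneg _) (abs_prod_cutoff_le_one N _ x)).trans
        (hb1 x hx')
    · filter_upwards [ae_mem_cube] with x hx
      refine tendsto_const_nhds.congr' ?_
      filter_upwards [cubeCutoff_eventually_eq_one hx] with N hN
      rw [hder, (hN j).2, cubeCutoff, Finset.prod_eq_one fun m _ => (hN m).1]
      simp
  have t2 : Tendsto (fun N : ℕ => -∫ x, g x * (φ x * cubeCutoff R N x) ∂cubeMeasure d R) atTop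
      (𝓝 (-∫ x, g x * φ x ∂cubeMeasure d R)) := by
    refine Tendsto.neg ?_
    refine tendsto_integral_of_dominated_convergence (fun x => |g x| * C0)
      (fun N => hg.1.mul (hφN N).continuous.aestronglyMeasurable) (hg1.abs.mul_const _)
      (fun N => ?_) ?_
    · filter_upwards [ae_mem_cube] with x hx
      rw [Real.norm_eq_abs, abs_mul, abs_mul]
      gcongr
      exact (mul_le_of_le_one_right (abs_nonneg _) (abs_prod_cutoff_le_one N _ x)).trans
        (hb0 x (cube_subset_closedCube hx))
    · filter_upwards [ae_mem_cube] with x hx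
      refine tendsto_const_nhds.congr' ?_
      filter_upwards [cubeCutoff_eventually_eq_one hx] with N hN
      rw [cubeCutoff, Finset.prod_eq_one fun m _ => (hN m).1, mul_one]
  refine tendsto_nhds_unique (t1.congr fun N => ?_) t2
  exact hw _ (hφN N) (hasCompactSupport_mul_cubeCutoff N φ) (tsupport_mul_cubeCutoff_subset N φ)

/-- Weak second derivatives are symmetric. -/
theorem MemH2.symm_ae (h : MemH2 R u Du D2u) (i j : Fin (d + 1)) :
    ∀ᵐ x ∂cubeMeasure d R, D2u i j x = D2u j i x := by
  have hij := (h.h1_deriv i).memLp_deriv j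
  have hji := (h.h1_deriv j).memLp_deriv i
  have key : ∀ᵐ x ∂volume, x ∈ cube d R → D2u i j x - D2u j i x = 0 := by
    refine isOpen_cube.ae_eq_zero_of_integral_contDiff_smul_eq_zero ?_ ?_
    · have : IntegrableOn (fun x => D2u i j x - D2u j i x) (cube d R) :=
        (hij.integrable (by norm_num)).sub (hji.integrable (by norm_num))
      exact this.locallyIntegrableOn
    · intro φ hφ hc hs
      have ts : ∀ k, tsupport (partialDeriv k φ) ⊆ cube d R := fun k =>
        (tsupport_fderiv_apply_subset ℝ (Pi.single k 1)).trans hs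
      have cs : ∀ k, HasCompactSupport (partialDeriv k φ) := fun k =>
        hc.fderiv_apply ℝ (Pi.single k 1)
      have e1 := (h.h1_deriv i).weak j φ hφ hc hs
      have e2 := (h.h1_deriv j).weak i φ hφ hc hs
      have e3 := h.h1.weak i _ (contDiff_partialDeriv hφ j) (cs j) (ts j)
      have e4 := h.h1.weak j _ (contDiff_partialDeriv hφ i) (cs i) (ts i)
      have e5 : partialDeriv i (partialDeriv j φ) = partialDeriv j (partialDeriv i φ) :=
        funext fun x => partialDeriv_comm hφ i j x
      rw [e5] at e3
      have e6 : ∫ x, D2u i j x * φ x ∂cubeMeasure d R = ∫ x, D2u j i x * φ x ∂cubeMeasure d R := by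
        linarith
      have e7 : ∫ x, φ x • (D2u i j x - D2u j i x) = ∫ x in cube d R,
          φ x • (D2u i j x - D2u j i x) := by
        refine (setIntegral_eq_integral_of_forall_compl_eq_zero fun x hx => ?_).symm
        rw [image_eq_zero_of_notMem_tsupport fun hx' => hx (hs hx'), zero_smul]
      rw [e7]
      have e8 := integral_sub (integrable_mul_of_memLp hij (memLp_smooth hφ))
        (integrable_mul_of_memLp hji (memLp_smooth (R := R) hφ))
      rw [e6, sub_self] at e8
      rw [← e8]
      exact integral_congr_ae (.of_forall fun x => by simp only [smul_eq_mul]; ring)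
  rw [cubeMeasure, ae_restrict_iff' measurableSet_cube]
  filter_upwards [key] with x hx h'
  exact sub_eq_zero.1 (hx h')

/-- For `u ∈ H²` with zero traces, the tangential derivative `∂ᵢ u` has zero traces on the
faces orthogonal to `xⱼ`, `j ≠ i`: integration by parts in `xⱼ` has no boundary term. -/
theorem MemH2.integral_parts_of_ne (hR : 0 < R) (h : MemH2 R u Du D2u)
    (ht : ∀ i, HasTrace R i R u Du 0) (ht' : ∀ i, HasTrace R i (-R) u Du 0)
    {i j : Fin (d + 1)} (hij : i ≠ j) (hφ : ContDiff ℝ ∞ φ) :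
    ∫ x, Du i x * partialDeriv j φ x ∂cubeMeasure d R
      = -∫ x, D2u i j x * φ x ∂cubeMeasure d R := by
  have W1 : ∀ k (χ : Pt d → ℝ), ContDiff ℝ ∞ χ →
      ∫ x, u x * partialDeriv k χ x ∂cubeMeasure d R = -∫ x, Du k x * χ x ∂cubeMeasure d R :=
    fun k χ hχ => integral_parts_of_traces_zero hR h.h1.memLp (h.h1.memLp_deriv k) (ht k) (ht' k) hχ
  have step : ∀ χ : Pt d → ℝ, ContDiff ℝ ∞ χ → (∀ x : Pt d, x i = R ∨ x i = -R → χ x = 0) →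
      ∫ x, Du i x * partialDeriv j χ x ∂cubeMeasure d R
        = -∫ x, D2u i j x * χ x ∂cubeMeasure d R := by
    intro χ hχ h0
    have e1 := W1 i _ (contDiff_partialDeriv hχ j)
    have e2 := W1 j _ (contDiff_partialDeriv hχ i)
    have e3 := ((h.h1_deriv j).weak i).integral_parts hR (h.h1_deriv j).memLp
      ((h.h1_deriv j).memLp_deriv i) hχ h0
    have e5 : partialDeriv i (partialDeriv j χ) = partialDeriv j (partialDeriv i χ) :=
      funext fun x => partialDeriv_comm hχ i j x
    rw [e5] at e1
    have e4 : ∫ x, D2u i j x * χ x ∂cubeMeasure d R = ∫ x, D2u j i x * χ x ∂cubeMeasure d R := by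
      refine integral_congr_ae ?_
      filter_upwards [h.symm_ae i j] with x hx
      rw [hx]
    linarith
  have hφ' := contDiff_partialDeriv hφ j
  obtain ⟨C0, hC0, hb0⟩ := exists_bound_smooth (R := R) hφ
  obtain ⟨C1, hC1, hb1⟩ := exists_bound_smooth (R := R) hφ'
  have hχ : ∀ N, ContDiff ℝ ∞ fun x : Pt d => cutoff R N (x i) := fun N =>
    contDiff_comp_coord (contDiff_cutoff N) i
  have hder : ∀ N x, partialDeriv j (fun x => φ x * cutoff R N (x i)) x
      = partialDeriv j φ x * cutoff R N (x i) := by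
    intro N x
    rw [partialDeriv_mul hφ (hχ N), partialDeriv_comp_coord (contDiff_cutoff N), if_neg hij]
    simp
  have lim : ∀ f w : Pt d → ℝ, MemLp f 2 (cubeMeasure d R) → ContDiff ℝ ∞ w →
      Tendsto (fun N : ℕ => ∫ x, f x * (w x * cutoff R N (x i)) ∂cubeMeasure d R) atTop
        (𝓝 (∫ x, f x * w x ∂cubeMeasure d R)) := by
    intro f w hf hw
    obtain ⟨C, hC, hb⟩ := exists_bound_smooth (R := R) hw
    refine tendsto_integral_of_dominated_convergence (fun x => |f x| * C)
      (fun N => hf.1.mul (hw.mul (hχ N)).continuous.aestronglyMeasurable)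
      ((hf.integrable (by norm_num)).abs.mul_const _) (fun N => ?_) ?_
    · filter_upwards [ae_mem_cube] with x hx
      rw [Real.norm_eq_abs, abs_mul, abs_mul]
      gcongr
      exact (mul_le_of_le_one_right (abs_nonneg _) (abs_cutoff_le_one N _)).trans
        (hb x (cube_subset_closedCube hx))
    · filter_upwards [ae_mem_cube] with x hx
      refine tendsto_const_nhds.congr' ?_
      filter_upwards [cubeCutoff_eventually_eq_one hx] with N hN
      rw [(hN i).1, mul_one]
  have t1 := lim _ _ (h.h1.memLp_deriv i) hφ'
  have t2 := (lim _ _ ((h.h1_deriv i).memLp_deriv j) hφ).neg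
  refine tendsto_nhds_unique (t1.congr fun N => ?_) t2
  rw [← step _ (hφ.mul (hχ N)) fun x hx => by simp [cutoff_eq_zero_of_endpoint hx]]
  exact integral_congr_ae (.of_forall fun x => by simp only [hder])

end WeakUpToBoundary

/-! ### Products of sines and cosines -/

section HilbertSums

/-- In an inner product space, the partial sums of the expansion in an orthogonal family with dense
span converge. Members of the family may be zero; their coefficients are `0 / 0 = 0`. -/
theorem tendsto_orthogonal_expansion {E ι : Type*} [NormedAddCommGroup E] [InnerProductSpace ℝ E]
    {b : ι → E} (hb : ∀ k l, k ≠ l → inner ℝ (b k) (b l) = 0)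
    (hd : (Submodule.span ℝ (range b)).topologicalClosure = ⊤) {s : ℕ → Finset ι}
    (hs : Monotone s) (hs' : ∀ k, ∃ N, k ∈ s N) (f : E) :
    Tendsto (fun N => ∑ k ∈ s N, (inner ℝ (b k) f / inner ℝ (b k) (b k)) • b k) atTop (𝓝 f) := by
  set S : ℕ → E := fun N => ∑ k ∈ s N, (inner ℝ (b k) f / inner ℝ (b k) (b k)) • b k with hS
  have horth : ∀ N, ∀ k ∈ s N, inner ℝ (b k) (f - S N) = 0 := by
    intro N k hk
    rw [inner_sub_right, hS, inner_sum, Finset.sum_eq_single k]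
    · rw [inner_smul_right]
      by_cases h0 : inner ℝ (b k) (b k) = 0
      · rw [inner_self_eq_zero.1 h0]; simp
      · field_simp; ring
    · intro l _ hl
      rw [inner_smul_right, hb k l hl.symm, mul_zero]
    · exact fun h => absurd hk h
  rw [Metric.tendsto_atTop]
  intro ε hε
  have hf : f ∈ closure (Submodule.span ℝ (range b) : Set E) := by
    rw [← Submodule.topologicalClosure_coe, hd]; trivial
  obtain ⟨g, hg, hgf⟩ := Metric.mem_closure_iff.1 hf ε hε
  obtain ⟨c, rfl⟩ := (Finsupp.mem_span_range_iff_exists_finsupp).1 hg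
  choose N hN using hs'
  refine ⟨c.support.sup N, fun n hn => lt_of_le_of_lt ?_ hgf⟩
  have hsub : ∀ k ∈ c.support, k ∈ s n := fun k hk =>
    hs ((Finset.le_sup (f := N) hk).trans hn) (hN k)
  have h0 : inner ℝ (f - S n) (S n - c.sum fun i a => a • b i) = 0 := by
    have z : ∀ k ∈ s n, ∀ a : ℝ, inner ℝ (f - S n) (a • b k) = 0 := fun k hk a => by
      rw [inner_smul_right, real_inner_comm, horth n k hk, mul_zero]
    rw [inner_sub_right, show inner ℝ (f - S n) (S n) = 0 from
        (inner_sum _ _ _).trans (Finset.sum_eq_zero fun k hk => z k hk _),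
      show inner ℝ (f - S n) (c.sum fun i a => a • b i) = 0 from
        (inner_sum _ _ _).trans (Finset.sum_eq_zero fun k hk => z k (hsub k hk) _), sub_zero]
  have h1 := norm_add_sq_real (f - S n) (S n - c.sum fun i a => a • b i)
  rw [h0, sub_add_sub_cancel] at h1
  rw [dist_comm, dist_eq_norm, dist_eq_norm]
  refine le_of_sq_le_sq ?_ (norm_nonneg _)
  nlinarith [sq_nonneg ‖S n - c.sum fun i a => a • b i‖]

theorem toLp_sum {α ι : Type*} {m : MeasurableSpace α} {μ : Measure α} (s : Finset ι) (c : ι → ℝ)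
    {F : ι → α → ℝ} (hF : ∀ i, MemLp (F i) 2 μ) (h : MemLp (fun x => ∑ i ∈ s, c i * F i x) 2 μ) :
    h.toLp _ = ∑ i ∈ s, c i • (hF i).toLp (F i) := by
  classical
  induction s using Finset.induction_on with
  | empty =>
    rw [Finset.sum_empty]
    exact (Lp.eq_zero_iff_ae_eq_zero).2 (h.coeFn_toLp.trans (.of_forall fun x => by simp))
  | insert a s ha ih =>
    have h' : MemLp (fun x => ∑ i ∈ s, c i * F i x) 2 μ :=
      memLp_finsetSum _ fun i _ => (hF i).const_mul (c i)
    rw [Finset.sum_insert ha, ← ih h', ← MemLp.toLp_const_smul, ← MemLp.toLp_add]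
    exact MemLp.toLp_congr _ _ (.of_forall fun x => Finset.sum_insert ha)

end HilbertSums

section Trig

variable {R : ℝ}

/-- The functions `sin (k π (t + R) / 2R)` (for `s = true`) and `cos (k π (t + R) / 2R)`
(for `s = false`). -/
noncomputable def trig (R : ℝ) (s : Bool) (k : ℕ) (t : ℝ) : ℝ :=
  if s then Real.sin (k * (Real.pi / (2 * R)) * (t + R))
  else Real.cos (k * (Real.pi / (2 * R)) * (t + R))

theorem contDiff_trig (s : Bool) (k : ℕ) : ContDiff ℝ ∞ (trig R s k) := by
  unfold trig
  cases s <;> simp only [if_true, Bool.false_eq_true, if_false]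
  · exact Real.contDiff_cos.comp (by fun_prop)
  · exact Real.contDiff_sin.comp (by fun_prop)

theorem abs_trig_le_one (s : Bool) (k : ℕ) (t : ℝ) : |trig R s k t| ≤ 1 := by
  cases s <;> simp only [trig, if_true, Bool.false_eq_true, if_false]
  · exact Real.abs_cos_le_one _
  · exact Real.abs_sin_le_one _

theorem deriv_trig (s : Bool) (k : ℕ) (t : ℝ) : deriv (trig R s k) t
    = (if s then 1 else -1) * (k * (Real.pi / (2 * R))) * trig R (!s) k t := by
  have h : HasDerivAt (fun t => k * (Real.pi / (2 * R)) * (t + R)) (k * (Real.pi / (2 * R))) t := by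
    simpa using ((hasDerivAt_id t).add_const R).const_mul (k * (Real.pi / (2 * R)))
  cases s
  · rw [show trig R false k = fun t => Real.cos (k * (Real.pi / (2 * R)) * (t + R)) by
      ext; simp [trig], h.cos.deriv]
    simp [trig]; ring
  · rw [show trig R true k = fun t => Real.sin (k * (Real.pi / (2 * R)) * (t + R)) by
      ext; simp [trig], h.sin.deriv]
    simp [trig]; ring

theorem trig_sin_endpoint (hR : 0 < R) (k : ℕ) {t : ℝ} (ht : t = R ∨ t = -R) :
    trig R true k t = 0 := by
  rcases ht with rfl | rfl
  · have : k * (Real.pi / (2 * t)) * (t + t) = k * Real.pi := by field_simp; ring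
    simp [trig, this, Real.sin_nat_mul_pi]
  · simp [trig]

theorem integral_cos_eq_zero (hR : 0 < R) {m : ℤ} (hm : m ≠ 0) :
    ∫ t in Ioo (-R) R, Real.cos (m * (Real.pi / (2 * R)) * (t + R)) = 0 := by
  have hω : (m : ℝ) * (Real.pi / (2 * R)) ≠ 0 := by
    have : (m : ℝ) ≠ 0 := by exact_mod_cast hm
    have := Real.pi_pos
    positivity
  have h : ∀ t : ℝ, HasDerivAt (fun t => (m * (Real.pi / (2 * R)))⁻¹ *
      Real.sin (m * (Real.pi / (2 * R)) * (t + R)))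
      (Real.cos (m * (Real.pi / (2 * R)) * (t + R))) t := by
    intro t
    have h1 : HasDerivAt (fun t => m * (Real.pi / (2 * R)) * (t + R))
        (m * (Real.pi / (2 * R))) t := by
      simpa using ((hasDerivAt_id t).add_const R).const_mul (m * (Real.pi / (2 * R)))
    refine (h1.sin.const_mul (m * (Real.pi / (2 * R)))⁻¹).congr_deriv ?_
    field_simp
  have hc : Continuous fun t => Real.cos (m * (Real.pi / (2 * R)) * (t + R)) := by fun_prop
  rw [← integral_Ioc_eq_integral_Ioo, ← intervalIntegral.integral_of_le (by linarith),
    intervalIntegral.integral_eq_sub_of_hasDerivAt (fun t _ => h t) (hc.intervalIntegrable _ _)]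
  have : m * (Real.pi / (2 * R)) * (R + R) = m * Real.pi := by field_simp; ring
  simp [this, Real.sin_int_mul_pi]

theorem integrable_of_continuous_Ioo {f : ℝ → ℝ} (hf : Continuous f) :
    Integrable f (volume.restrict (Ioo (-R) R)) :=
  (hf.integrableOn_Icc (a := -R) (b := R)).mono_set Ioo_subset_Icc_self

theorem integral_trig_mul_trig (hR : 0 < R) (s : Bool) {k l : ℕ} (hkl : k ≠ l) :
    ∫ t in Ioo (-R) R, trig R s k t * trig R s l t = 0 := by
  have h1 := integral_cos_eq_zero hR (m := (k : ℤ) - l) (by omega)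
  have h2 := integral_cos_eq_zero hR (m := (k : ℤ) + l) (by omega)
  have i1 : Integrable (fun t => Real.cos (((k : ℤ) - l : ℤ) * (Real.pi / (2 * R)) * (t + R)))
      (volume.restrict (Ioo (-R) R)) := integrable_of_continuous_Ioo (by fun_prop)
  have i2 : Integrable (fun t => Real.cos (((k : ℤ) + l : ℤ) * (Real.pi / (2 * R)) * (t + R)))
      (volume.restrict (Ioo (-R) R)) := integrable_of_continuous_Ioo (by fun_prop)
  have e1 : ∀ t, (((k : ℤ) - l : ℤ) : ℝ) * (Real.pi / (2 * R)) * (t + R)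
      = k * (Real.pi / (2 * R)) * (t + R) - l * (Real.pi / (2 * R)) * (t + R) := by
    intro t; push_cast; ring
  have e2 : ∀ t, (((k : ℤ) + l : ℤ) : ℝ) * (Real.pi / (2 * R)) * (t + R)
      = k * (Real.pi / (2 * R)) * (t + R) + l * (Real.pi / (2 * R)) * (t + R) := by
    intro t; push_cast; ring
  cases s
  · have : ∀ t, trig R false k t * trig R false l t
        = (1 / 2) * (Real.cos (((k : ℤ) - l : ℤ) * (Real.pi / (2 * R)) * (t + R))
          + Real.cos (((k : ℤ) + l : ℤ) * (Real.pi / (2 * R)) * (t + R))) := by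
      intro t
      rw [e1, e2, Real.cos_sub, Real.cos_add]
      simp only [trig, Bool.false_eq_true, if_false]
      ring
    simp only [this]
    rw [integral_const_mul, integral_add i1 i2, h1, h2]
    simp
  · have : ∀ t, trig R true k t * trig R true l t
        = (1 / 2) * (Real.cos (((k : ℤ) - l : ℤ) * (Real.pi / (2 * R)) * (t + R))
          - Real.cos (((k : ℤ) + l : ℤ) * (Real.pi / (2 * R)) * (t + R))) := by
      intro t
      rw [e1, e2, Real.cos_sub, Real.cos_add]
      simp only [trig, if_true]
      ring
    simp only [this]
    rw [integral_const_mul, integral_sub i1 i2, h1, h2]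
    simp

theorem integral_trig_sq (hR : 0 < R) (s : Bool) {k : ℕ} (hk : k ≠ 0) :
    ∫ t in Ioo (-R) R, trig R (!s) k t * trig R (!s) k t
      = ∫ t in Ioo (-R) R, trig R s k t * trig R s k t := by
  have ic : ∀ s', Integrable (fun t => trig R s' k t * trig R s' k t)
      (volume.restrict (Ioo (-R) R)) := fun s' =>
    integrable_of_continuous_Ioo ((contDiff_trig s' k).continuous.mul (contDiff_trig s' k).continuous)
  have key : ∫ t in Ioo (-R) R, trig R false k t * trig R false k t
      = ∫ t in Ioo (-R) R, trig R true k t * trig R true k t := by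
    rw [← sub_eq_zero, ← integral_sub (ic _) (ic _),
      ← integral_cos_eq_zero hR (m := 2 * k) (by omega)]
    refine integral_congr_ae (.of_forall fun t => ?_)
    have : (((2 * k : ℤ) : ℝ)) * (Real.pi / (2 * R)) * (t + R)
        = 2 * (k * (Real.pi / (2 * R)) * (t + R)) := by push_cast; ring
    simp only [this, Real.cos_two_mul', trig]
    simp; ring
  cases s
  · exact key.symm
  · exact key

theorem exists_cos_mul_trig (s : Bool) (k : ℕ) : ∃ (k₁ k₂ : ℕ) (α β : ℝ), ∀ t,
    trig R false 1 t * trig R s k t = α * trig R s k₁ t + β * trig R s k₂ t := by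
  rcases Nat.eq_zero_or_pos k with rfl | hk
  · cases s
    · exact ⟨1, 0, 1, 0, fun t => by simp [trig]⟩
    · exact ⟨0, 0, 0, 0, fun t => by simp [trig]⟩
  · obtain ⟨m, rfl⟩ : ∃ m, k = m + 1 := ⟨k - 1, by omega⟩
    refine ⟨m + 2, m, 1 / 2, 1 / 2, fun t => ?_⟩
    have e1 : ((m + 2 : ℕ) : ℝ) * (Real.pi / (2 * R)) * (t + R)
        = ((m + 1 : ℕ) : ℝ) * (Real.pi / (2 * R)) * (t + R)
          + ((1 : ℕ) : ℝ) * (Real.pi / (2 * R)) * (t + R) := by push_cast; ring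
    have e2 : (m : ℝ) * (Real.pi / (2 * R)) * (t + R)
        = ((m + 1 : ℕ) : ℝ) * (Real.pi / (2 * R)) * (t + R)
          - ((1 : ℕ) : ℝ) * (Real.pi / (2 * R)) * (t + R) := by push_cast; ring
    cases s <;> simp only [trig, if_true, Bool.false_eq_true, if_false, e1, e2]
    · rw [Real.cos_add, Real.cos_sub]; ring
    · rw [Real.sin_add, Real.sin_sub]; ring

end Trig

section TrigProd

variable {d : ℕ} {R : ℝ}

/-- The product over the coordinates `i` of sines (where `σ i = true`) and cosines (where
`σ i = false`) with frequencies `k i`. -/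
noncomputable def trigProd (R : ℝ) (σ : Fin (d + 1) → Bool) (k : Fin (d + 1) → ℕ) (x : Pt d) : ℝ :=
  ∏ i, trig R (σ i) (k i) (x i)

theorem contDiff_trigProd (σ : Fin (d + 1) → Bool) (k : Fin (d + 1) → ℕ) :
    ContDiff ℝ ∞ (trigProd R σ k) :=
  contDiff_prod_coord fun _ => contDiff_trig _ _

theorem abs_trigProd_le_one (σ : Fin (d + 1) → Bool) (k : Fin (d + 1) → ℕ) (x : Pt d) :
    |trigProd R σ k x| ≤ 1 := by
  rw [trigProd, Finset.abs_prod]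
  exact Finset.prod_le_one (fun _ _ => abs_nonneg _) fun m _ => abs_trig_le_one _ _ _

/-- Exchange sine and cosine in the coordinate `i`. -/
def flip (i : Fin (d + 1)) (σ : Fin (d + 1) → Bool) : Fin (d + 1) → Bool :=
  Function.update σ i (!σ i)

theorem flip_self (i : Fin (d + 1)) (σ : Fin (d + 1) → Bool) : flip i σ i = !σ i := by simp [flip]

theorem flip_of_ne {i j : Fin (d + 1)} (h : j ≠ i) (σ : Fin (d + 1) → Bool) :
    flip i σ j = σ j := by simp [flip, h]

theorem flip_flip (i : Fin (d + 1)) (σ : Fin (d + 1) → Bool) : flip i (flip i σ) = σ := by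
  simp [flip]

theorem partialDeriv_trigProd (σ : Fin (d + 1) → Bool) (k : Fin (d + 1) → ℕ) (i : Fin (d + 1))
    (x : Pt d) : partialDeriv i (trigProd R σ k) x
      = (if σ i then 1 else -1) * (k i * (Real.pi / (2 * R))) * trigProd R (flip i σ) k x := by
  rw [show trigProd R σ k = fun x : Pt d => ∏ m, trig R (σ m) (k m) (x m) from rfl,
    partialDeriv_prod (fun _ => contDiff_trig _ _), deriv_trig, trigProd,
    ← Finset.mul_prod_erase _ _ (Finset.mem_univ i), flip_self, mul_assoc]
  congr 2
  refine Finset.prod_congr rfl fun m hm => ?_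
  rw [flip_of_ne (Finset.ne_of_mem_erase hm)]

theorem integral_trigProd_mul (σ : Fin (d + 1) → Bool) (k l : Fin (d + 1) → ℕ) :
    ∫ x, trigProd R σ k x * trigProd R σ l x ∂cubeMeasure d R
      = ∏ i, ∫ t in Ioo (-R) R, trig R (σ i) (k i) t * trig R (σ i) (l i) t := by
  rw [cubeMeasure_eq_pi, ← integral_fintype_prod_eq_prod]
  simp only [trigProd, Finset.prod_mul_distrib]

theorem integral_trigProd_mul_of_ne (hR : 0 < R) (σ : Fin (d + 1) → Bool)
    {k l : Fin (d + 1) → ℕ} (hkl : k ≠ l) :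
    ∫ x, trigProd R σ k x * trigProd R σ l x ∂cubeMeasure d R = 0 := by
  obtain ⟨i, hi⟩ := Function.ne_iff.1 hkl
  rw [integral_trigProd_mul]
  exact Finset.prod_eq_zero (Finset.mem_univ i) (integral_trig_mul_trig hR _ hi)

theorem integral_trigProd_flip (hR : 0 < R) (σ : Fin (d + 1) → Bool) {k : Fin (d + 1) → ℕ}
    {i : Fin (d + 1)} (hk : k i ≠ 0) :
    ∫ x, trigProd R (flip i σ) k x * trigProd R (flip i σ) k x ∂cubeMeasure d R
      = ∫ x, trigProd R σ k x * trigProd R σ k x ∂cubeMeasure d R := by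
  rw [integral_trigProd_mul, integral_trigProd_mul]
  refine Finset.prod_congr rfl fun j _ => ?_
  rcases eq_or_ne j i with rfl | h
  · rw [flip_self, integral_trig_sq hR _ hk]
  · rw [flip_of_ne h]

theorem trigProd_update (σ : Fin (d + 1) → Bool) (k : Fin (d + 1) → ℕ) (i : Fin (d + 1)) (m : ℕ)
    (x : Pt d) : trigProd R σ (Function.update k i m) x
      = trig R (σ i) m (x i) * ∏ j ∈ Finset.univ.erase i, trig R (σ j) (k j) (x j) := by
  rw [trigProd, ← Finset.mul_prod_erase _ _ (Finset.mem_univ i), Function.update_self]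
  congr 1
  refine Finset.prod_congr rfl fun j hj => ?_
  rw [Function.update_of_ne (Finset.ne_of_mem_erase hj)]

theorem injOn_cos_coord (hR : 0 < R) : InjOn (trig R false 1) (Icc (-R) R) := by
  intro s hs t ht h
  simp only [trig, Bool.false_eq_true, if_false, Nat.cast_one, one_mul] at h
  have hp := Real.pi_pos
  have mem : ∀ s ∈ Icc (-R) R, Real.pi / (2 * R) * (s + R) ∈ Icc 0 Real.pi := by
    intro s hs
    have h1 : 0 ≤ s + R := by linarith [hs.1]
    refine ⟨by positivity, ?_⟩
    rw [div_mul_eq_mul_div, div_le_iff₀ (by positivity)]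
    nlinarith [hs.2]
  have := Real.injOn_cos (mem s hs) (mem t ht) h
  have h2 := mul_left_cancel₀ (by positivity) this
  linarith

/-- The products of sines and cosines of a given parity type are complete. The idea: multiplication
by `cos (π (xᵢ + R) / 2R)` preserves their linear span, and by the Stone–Weierstrass theorem these
cosines generate a dense algebra of continuous functions on the closed cube; so a function
orthogonal to the whole family has a product with one particular member, positive in
the open cube, that is orthogonal to all continuous functions. -/
theorem ae_eq_zero_of_integral_trigProd (hR : 0 < R) (σ : Fin (d + 1) → Bool) {f : Pt d → ℝ}
    (hf : Integrable f (cubeMeasure d R))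
    (h : ∀ k, ∫ x, f x * trigProd R σ k x ∂cubeMeasure d R = 0) :
    f =ᵐ[cubeMeasure d R] 0 := by
  let Φ : (Pt d → ℝ) → Prop := fun G =>
    ∀ k, ∫ x, f x * (G x * trigProd R σ k x) ∂cubeMeasure d R = 0
  have hint : ∀ G : Pt d → ℝ, Continuous G → Integrable (fun x => f x * G x) (cubeMeasure d R) := by
    intro G hG
    obtain ⟨C, hC⟩ := isCompact_closedCube.exists_bound_of_continuousOn
      (hG.continuousOn (s := closedCube d R))
    refine hf.mul_bdd (c := C) hG.aestronglyMeasurable ?_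
    filter_upwards [ae_mem_cube] with x hx using hC x (cube_subset_closedCube hx)
  have cm : ∀ {G H : Pt d → ℝ}, Continuous G → Continuous H → Continuous fun x => G x * H x :=
    fun hG hH => hG.mul hH
  have cB : ∀ k, Continuous (trigProd (d := d) R σ k) := fun k => (contDiff_trigProd σ k).continuous
  have : CompactSpace (closedCube d R) := isCompact_iff_compactSpace.1 isCompact_closedCube
  have cc : ∀ i, Continuous fun x : Pt d => trig R false 1 (x i) := fun i =>
    (contDiff_trig false 1).continuous.comp (continuous_apply i)
  let cosC : Fin (d + 1) → C(closedCube d R, ℝ) := fun i =>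
    ⟨fun x => trig R false 1 (x.1 i), (cc i).comp continuous_subtype_val⟩
  let A : Subalgebra ℝ C(closedCube d R, ℝ) := Algebra.adjoin ℝ (range cosC)
  have hA : A.topologicalClosure = ⊤ := by
    refine ContinuousMap.subalgebra_topologicalClosure_eq_top_of_separatesPoints A ?_
    intro x y hxy
    obtain ⟨i, hi⟩ := Function.ne_iff.1 fun h => hxy (Subtype.ext h)
    refine ⟨_, ⟨cosC i, Algebra.subset_adjoin ⟨i, rfl⟩, rfl⟩, fun he => hi ?_⟩
    exact injOn_cos_coord hR (mem_closedCube.1 x.2 i) (mem_closedCube.1 y.2 i) he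
  have hΦ : ∀ g ∈ A, ∃ H : Pt d → ℝ, Continuous H ∧ (∀ x : closedCube d R, H x = g x) ∧
      ∀ G, Continuous G → Φ G → Φ fun x => H x * G x := by
    intro g hg
    induction hg using Algebra.adjoin_induction with
    | mem g hg =>
      obtain ⟨i, rfl⟩ := hg
      refine ⟨_, cc i, fun x => rfl, fun G hG hΦG k => ?_⟩
      obtain ⟨k₁, k₂, α, β, hαβ⟩ := exists_cos_mul_trig (R := R) (σ i) (k i)
      have e : ∀ x : Pt d, f x * (trig R false 1 (x i) * G x * trigProd R σ k x)
          = α * (f x * (G x * trigProd R σ (Function.update k i k₁) x))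
            + β * (f x * (G x * trigProd R σ (Function.update k i k₂) x)) := by
        intro x
        have e1 := trigProd_update (R := R) σ k i (k i) x
        rw [Function.update_eq_self] at e1
        rw [e1, trigProd_update, trigProd_update]
        linear_combination (f x * G x * ∏ j ∈ Finset.univ.erase i, trig R (σ j) (k j) (x j))
          * hαβ (x i)
      simp only [e]
      rw [integral_add, integral_const_mul, integral_const_mul, hΦG, hΦG]
      · simp
      · exact (hint _ (hG.mul (cB _))).const_mul α
      · exact (hint _ (hG.mul (cB _))).const_mul β
    | algebraMap r =>
      refine ⟨fun _ => r, continuous_const, fun x => by simp, fun G hG hΦG k => ?_⟩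
      have e : ∀ x : Pt d, f x * (r * G x * trigProd R σ k x)
          = r * (f x * (G x * trigProd R σ k x)) := fun x => by ring
      simp only [e]
      rw [integral_const_mul, hΦG, mul_zero]
    | add g₁ g₂ _ _ h₁ h₂ =>
      obtain ⟨H₁, c₁, r₁, h₁⟩ := h₁
      obtain ⟨H₂, c₂, r₂, h₂⟩ := h₂
      refine ⟨fun x => H₁ x + H₂ x, c₁.add c₂, fun x => by simp [r₁, r₂], fun G hG hΦG k => ?_⟩
      have e : ∀ x : Pt d, f x * ((H₁ x + H₂ x) * G x * trigProd R σ k x)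
          = f x * (H₁ x * G x * trigProd R σ k x) + f x * (H₂ x * G x * trigProd R σ k x) :=
        fun x => by ring
      simp only [e]
      rw [integral_add (hint _ (cm (cm c₁ hG) (cB k))) (hint _ (cm (cm c₂ hG) (cB k))),
        h₁ G hG hΦG, h₂ G hG hΦG, add_zero]
    | mul g₁ g₂ _ _ h₁ h₂ =>
      obtain ⟨H₁, c₁, r₁, h₁⟩ := h₁
      obtain ⟨H₂, c₂, r₂, h₂⟩ := h₂
      refine ⟨fun x => H₁ x * H₂ x, c₁.mul c₂, fun x => by simp [r₁, r₂], fun G hG hΦG => ?_⟩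
      have := h₁ _ (cm c₂ hG) (h₂ G hG hΦG)
      simpa only [mul_assoc] using this
  set S : Pt d → ℝ := trigProd R σ fun i => if σ i then 1 else 0 with hS
  have hSpos : ∀ x ∈ cube d R, S x ≠ 0 := by
    intro x hx
    refine Finset.prod_ne_zero_iff.2 fun i _ => ?_
    have hxi := mem_cube.1 hx i
    cases hσ : σ i
    · simp [trig, hσ]
    · simp only [trig, hσ, if_true, Nat.cast_one, one_mul]
      have hp := Real.pi_pos
      have h1 : 0 < x i + R := by linarith
      refine (Real.sin_pos_of_pos_of_lt_pi (by positivity) ?_).ne'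
      rw [div_mul_eq_mul_div, div_lt_iff₀ (by positivity)]
      nlinarith
  have hcont : ∀ g : Pt d → ℝ, Continuous g →
      ∫ x, f x * (g x * S x) ∂cubeMeasure d R = 0 := by
    intro g hg
    let g' : C(closedCube d R, ℝ) := ⟨fun x => g x.1, hg.comp continuous_subtype_val⟩
    have hg' : g' ∈ closure (A : Set C(closedCube d R, ℝ)) := by
      rw [← Subalgebra.topologicalClosure_coe, hA]; trivial
    by_contra hne
    have hpos : 0 < |∫ x, f x * (g x * S x) ∂cubeMeasure d R| := abs_pos.2 hne
    set I := ∫ x, |f x| ∂cubeMeasure d R with hI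
    have hI0 : 0 ≤ I := integral_nonneg fun _ => abs_nonneg _
    obtain ⟨h', hh', hlt⟩ := Metric.mem_closure_iff.1 hg'
      (|∫ x, f x * (g x * S x) ∂cubeMeasure d R| / (I + 1)) (by positivity)
    obtain ⟨H, cH, rH, hH⟩ := hΦ h' hh'
    have z : ∫ x, f x * (H x * S x) ∂cubeMeasure d R = 0 := by
      have := hH (fun _ => 1) continuous_const (fun k => by simpa using h k)
      simpa using this fun i => if σ i then 1 else 0
    have e1 : ∫ x, f x * (g x * S x) ∂cubeMeasure d R
        = ∫ x, f x * ((g x - H x) * S x) ∂cubeMeasure d R := by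
      have := integral_sub (hint _ (cm hg (cB fun i => if σ i then 1 else 0)))
        (hint _ (cm cH (cB fun i => if σ i then 1 else 0)))
      rw [← hS, z, sub_zero] at this
      rw [← this]
      exact integral_congr_ae (.of_forall fun x => by ring)
    have e2 : |∫ x, f x * ((g x - H x) * S x) ∂cubeMeasure d R| ≤ I * dist g' h' := by
      rw [hI, ← integral_mul_const]
      rw [← Real.norm_eq_abs]
      refine norm_integral_le_of_norm_le (hf.abs.mul_const _) ?_
      filter_upwards [ae_mem_cube] with x hx
      rw [Real.norm_eq_abs, abs_mul, abs_mul]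
      gcongr
      refine (mul_le_of_le_one_right (abs_nonneg _) (abs_trigProd_le_one _ _ _)).trans ?_
      have := ContinuousMap.dist_apply_le_dist (f := g') (g := h') ⟨x, cube_subset_closedCube hx⟩
      rw [← rH, Real.dist_eq] at this
      exact this
    rw [← e1] at e2
    have e3 : I * dist g' h' ≤
        I * (|∫ x, f x * (g x * S x) ∂cubeMeasure d R| / (I + 1)) := by gcongr
    have e4 : I * (|∫ x, f x * (g x * S x) ∂cubeMeasure d R| / (I + 1))
        < |∫ x, f x * (g x * S x) ∂cubeMeasure d R| := by
      rw [mul_div_assoc', div_lt_iff₀ (by positivity)]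
      nlinarith
    linarith
  have hfS := hint S (cB _)
  have key : ∀ᵐ x ∂volume, x ∈ cube d R → f x * S x = 0 := by
    refine isOpen_cube.ae_eq_zero_of_integral_contDiff_smul_eq_zero
      (IntegrableOn.locallyIntegrableOn hfS) fun g hg _ hs => ?_
    rw [← hcont g hg.continuous]
    refine (setIntegral_eq_integral_of_forall_compl_eq_zero (s := cube d R) fun x hx => ?_).symm.trans
      (integral_congr_ae (.of_forall fun x => by simp only [smul_eq_mul]; ring))
    rw [image_eq_zero_of_notMem_tsupport fun hx' => hx (hs hx'), zero_smul]
  rw [EventuallyEq, cubeMeasure, ae_restrict_iff' measurableSet_cube]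
  filter_upwards [key] with x hx hxc
  exact (mul_eq_zero.1 (hx hxc)).resolve_right (hSpos x hxc)

/-! ### Multiple sine and cosine series -/

/-- The partial sums of the expansion of `f` in the products of parity type `σ`. -/
noncomputable def trigSum (R : ℝ) (σ : Fin (d + 1) → Bool) (f : Pt d → ℝ) (N : ℕ) (x : Pt d) : ℝ :=
  ∑ k ∈ Fintype.piFinset fun _ : Fin (d + 1) => Finset.range N,
    ((∫ y, trigProd R σ k y * f y ∂cubeMeasure d R) /
      ∫ y, trigProd R σ k y * trigProd R σ k y ∂cubeMeasure d R) * trigProd R σ k x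

theorem contDiff_trigSum (σ : Fin (d + 1) → Bool) (f : Pt d → ℝ) (N : ℕ) :
    ContDiff ℝ ∞ (trigSum R σ f N) :=
  ContDiff.sum fun _ _ => contDiff_const.mul (contDiff_trigProd _ _)

theorem tendsto_trigSum (hR : 0 < R) (σ : Fin (d + 1) → Bool) {f : Pt d → ℝ}
    (hf : MemLp f 2 (cubeMeasure d R)) :
    Tendsto (fun N => eLpNorm (fun x => trigSum R σ f N x - f x) 2 (cubeMeasure d R)) atTop
      (𝓝 0) := by
  have hB : ∀ k, MemLp (trigProd R σ k) 2 (cubeMeasure d R) := fun k =>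
    memLp_smooth (contDiff_trigProd σ k)
  have hS : ∀ N, MemLp (trigSum R σ f N) 2 (cubeMeasure d R) := fun N =>
    memLp_smooth (contDiff_trigSum σ f N)
  refine (Lp.tendsto_Lp_iff_tendsto_eLpNorm'' (trigSum R σ f) hS f hf).1 ?_
  have key := tendsto_orthogonal_expansion (b := fun k => (hB k).toLp)
    (s := fun N => Fintype.piFinset fun _ : Fin (d + 1) => Finset.range N) ?_ ?_ ?_ ?_ (hf.toLp f)
  · refine key.congr fun N => ?_
    simp only [inner_toLp]
    exact (toLp_sum _ _ hB (hS N)).symm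
  · intro k l hkl
    rw [inner_toLp]
    exact integral_trigProd_mul_of_ne hR σ hkl
  · rw [Submodule.topologicalClosure_eq_top_iff, Submodule.eq_bot_iff]
    intro g hg
    have hgz : (g : Pt d → ℝ) =ᵐ[cubeMeasure d R] 0 := by
      refine ae_eq_zero_of_integral_trigProd hR σ ((Lp.memLp g).integrable (by norm_num)) fun k => ?_
      have h1 := (Submodule.mem_orthogonal _ g).1 hg _ (Submodule.subset_span ⟨k, rfl⟩)
      rw [← Lp.toLp_coeFn g (Lp.memLp g), inner_toLp] at h1
      rw [← h1]
      exact integral_congr_ae (.of_forall fun x => mul_comm _ _)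
    exact (Lp.eq_zero_iff_ae_eq_zero).2 hgz
  · intro N N' h
    exact Fintype.piFinset_subset _ _ fun _ => Finset.range_mono h
  · intro k
    refine ⟨Finset.univ.sup k + 1, Fintype.mem_piFinset.2 fun i => Finset.mem_range.2 ?_⟩
    exact Nat.lt_succ_of_le (Finset.le_sup (Finset.mem_univ i))

/-- Termwise differentiation of the partial sums. -/
theorem partialDeriv_trigSum (hR : 0 < R) (σ : Fin (d + 1) → Bool) {f g : Pt d → ℝ}
    {i : Fin (d + 1)} (h : ∀ k, ∫ x, f x * partialDeriv i (trigProd R (flip i σ) k) x ∂cubeMeasure d R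
      = -∫ x, g x * trigProd R (flip i σ) k x ∂cubeMeasure d R) (N : ℕ) :
    partialDeriv i (trigSum R σ f N) = trigSum R (flip i σ) g N := by
  ext x
  have hd : ∀ k, DifferentiableAt ℝ (trigProd R σ k) x := fun k =>
    (contDiff_trigProd σ k).differentiable (by simp) x
  have e : partialDeriv i (trigSum R σ f N) x
      = ∑ k ∈ Fintype.piFinset fun _ : Fin (d + 1) => Finset.range N,
        ((∫ y, trigProd R σ k y * f y ∂cubeMeasure d R) /
          ∫ y, trigProd R σ k y * trigProd R σ k y ∂cubeMeasure d R)
            * partialDeriv i (trigProd R σ k) x := by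
    have e0 : fderiv ℝ (trigSum R σ f N) x = _ :=
      fderiv_fun_sum fun k _ => (hd k).const_mul _
    rw [partialDeriv, e0, sum_apply]
    refine Finset.sum_congr rfl fun k _ => ?_
    rw [fderiv_const_mul (hd k)]
    rfl
  rw [e, trigSum]
  refine Finset.sum_congr rfl fun k _ => ?_
  have hk := h k
  simp only [partialDeriv_trigProd, flip_flip, flip_self] at hk
  rw [partialDeriv_trigProd]
  have hc : ∀ G : Pt d → ℝ, ∀ τ, ∫ y, trigProd R τ k y * G y ∂cubeMeasure d R
      = ∫ y, G y * trigProd R τ k y ∂cubeMeasure d R := fun G τ =>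
    integral_congr_ae (.of_forall fun y => mul_comm _ _)
  have hk2 : ∫ y, trigProd R (flip i σ) k y * g y ∂cubeMeasure d R
      = (if σ i then 1 else -1) * (k i * (Real.pi / (2 * R))) *
        ∫ y, trigProd R σ k y * f y ∂cubeMeasure d R := by
    rw [hc, hc, eq_neg_iff_add_eq_zero.1 hk |> eq_neg_of_add_eq_zero_right]
    rw [← integral_const_mul, ← integral_neg]
    refine integral_congr_ae (.of_forall fun y => ?_)
    cases σ i <;> simp <;> ring
  rw [hk2]
  by_cases h0 : k i = 0
  · simp [h0]
  · rw [integral_trigProd_flip hR σ h0]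
    ring

end TrigProd

/-! ### Approximation by smooth functions that vanish on the boundary -/

section Approximation

variable {d : ℕ} {R : ℝ}

theorem tendsto_integral_sq_sub {α : Type*} {m : MeasurableSpace α} {μ : Measure α}
    {F : ℕ → α → ℝ} {f : α → ℝ} (hF : ∀ n, MemLp (F n) 2 μ) (hf : MemLp f 2 μ)
    (h : Tendsto (fun n => eLpNorm (fun x => F n x - f x) 2 μ) atTop (𝓝 0)) :
    Tendsto (fun n => ∫ x, (F n x - f x) ^ 2 ∂μ) atTop (𝓝 0) := by
  have hd : ∀ n, MemLp (fun x => F n x - f x) 2 μ := fun n => (hF n).sub hf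
  have h' : Tendsto (fun n => eLpNorm (fun x => (F n x - f x) - (0 : α → ℝ) x) 2 μ) atTop (𝓝 0) := by
    simpa using h
  have := tendsto_integral_mul hd hd (f := 0) (g := 0) (by simp) (by simp) h' h'
  simpa [sq] using this

theorem integrable_sq_smooth {f : Pt d → ℝ} (hf : ContDiff ℝ ∞ f) :
    Integrable (fun x => f x ^ 2) (cubeMeasure d R) :=
  integrable_of_continuousOn (hf.continuous.pow 2).continuousOn

/-- The trace inequality for smooth functions. -/
theorem integral_face_sq_le (hR : 0 < R) {w : Pt d → ℝ} (hw : ContDiff ℝ ∞ w) (i : Fin (d + 1)) :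
    ∫ y, w (facePt i R y) ^ 2 ∂faceMeasure d R
      ≤ ((2 * R)⁻¹ + 1) * (∫ x, w x ^ 2 ∂cubeMeasure d R
        + ∫ x, partialDeriv i w x ^ 2 ∂cubeMeasure d R) := by
  have hw' := contDiff_partialDeriv hw i
  have hg : ContDiff ℝ ∞ fun x : Pt d => (2 * R)⁻¹ * (x i + R) := by fun_prop
  have key := integral_parts_smooth hR (hw.mul hw) hg i
  have e1 : ∀ x, partialDeriv i (fun x : Pt d => (2 * R)⁻¹ * (x i + R)) x = (2 * R)⁻¹ := by
    intro x
    have hd : ∀ t, HasDerivAt (fun t : ℝ => (2 * R)⁻¹ * (t + R)) ((2 * R)⁻¹) t := fun t => by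
      simpa using ((hasDerivAt_id t).add_const R).const_mul (2 * R)⁻¹
    rw [partialDeriv_comp_coord (h := fun t => (2 * R)⁻¹ * (t + R)) (by fun_prop) i i x,
      if_pos rfl, (hd _).deriv]
  have e2 : ∀ y, (2 * R)⁻¹ * (facePt i R y i + R) = 1 := fun y => by
    simp [facePt]; field_simp; ring
  have e3 : ∀ y, (2 * R)⁻¹ * (facePt i (-R) y i + R) = 0 := fun y => by simp [facePt]
  simp only [e1, e2, e3, mul_zero, mul_one, integral_zero, sub_zero] at key
  rw [integral_mul_const] at key
  have hb : ∫ x, partialDeriv i (fun x => w x * w x) x * ((2 * R)⁻¹ * (x i + R)) ∂cubeMeasure d R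
      ≤ ∫ x, w x ^ 2 + partialDeriv i w x ^ 2 ∂cubeMeasure d R := by
    refine integral_mono_ae (integrable_mul_of_memLp
      (memLp_smooth (contDiff_partialDeriv (hw.mul hw) i)) (memLp_smooth hg))
      ((integrable_sq_smooth hw).add (integrable_sq_smooth hw')) ?_
    filter_upwards [ae_mem_cube] with x hx
    have hxi := mem_cube.1 hx i
    have hR' : (2 * R) * (2 * R)⁻¹ = 1 := mul_inv_cancel₀ (by positivity)
    have hp : 0 < (2 * R)⁻¹ := by positivity
    set s := (2 * R)⁻¹ * (x i + R) with hs
    have s0 : 0 ≤ s := mul_nonneg hp.le (by linarith)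
    have s1 : s ≤ 1 := by rw [hs]; nlinarith
    rw [partialDeriv_mul hw hw]
    nlinarith [mul_nonneg s0 (sq_nonneg (w x - partialDeriv i w x)),
      mul_nonneg (sub_nonneg.2 s1) (add_nonneg (sq_nonneg (w x)) (sq_nonneg (partialDeriv i w x)))]
  rw [integral_add (integrable_sq_smooth hw) (integrable_sq_smooth hw')] at hb
  have hA : 0 ≤ ∫ x, w x ^ 2 ∂cubeMeasure d R := integral_nonneg fun _ => sq_nonneg _
  have hB : 0 ≤ ∫ x, partialDeriv i w x ^ 2 ∂cubeMeasure d R := integral_nonneg fun _ => sq_nonneg _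
  have hp : 0 < (2 * R)⁻¹ := by positivity
  simp only [← sq] at key hb ⊢
  rw [← key]
  nlinarith [mul_nonneg hp.le hB]

/-- Functions of `H²` with zero trace on the boundary, and with zero trace of the normal
derivative on the top face, are limits in `H²` of smooth functions that vanish on the boundary and
whose normal derivatives on the top face tend to zero in `L²`. The approximations are the
partial sums of the multiple sine series. -/
theorem MemH2ZeroSharp.exists_smooth_approx (hR : 0 < R) {u : Pt d → ℝ}
    {Du : Fin (d + 1) → Pt d → ℝ} {D2u : Fin (d + 1) → Fin (d + 1) → Pt d → ℝ}
    (h : MemH2ZeroSharp R u Du D2u) :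
    ∃ U : ℕ → Pt d → ℝ, (∀ N, ContDiff ℝ ∞ (U N)) ∧
      (∀ N x i, x i = R ∨ x i = -R → U N x = 0) ∧
      Tendsto (fun N => eLpNorm (fun x => U N x - u x) 2 (cubeMeasure d R)) atTop (𝓝 0) ∧
      (∀ i, Tendsto (fun N => eLpNorm (fun x => partialDeriv i (U N) x - Du i x) 2
        (cubeMeasure d R)) atTop (𝓝 0)) ∧
      (∀ i j, Tendsto (fun N => eLpNorm (fun x => partialDeriv j (partialDeriv i (U N)) x
        - D2u i j x) 2 (cubeMeasure d R)) atTop (𝓝 0)) ∧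
      Tendsto (fun N => ∫ y, partialDeriv (Fin.last d) (U N) (facePt (Fin.last d) R y) ^ 2
        ∂faceMeasure d R) atTop (𝓝 0) := by
  obtain ⟨hH2, ht, ht', htop⟩ := h
  set σ : Fin (d + 1) → Bool := fun _ => true with hσ
  set U : ℕ → Pt d → ℝ := trigSum R σ u with hU
  have cU : ∀ N, ContDiff ℝ ∞ (U N) := contDiff_trigSum σ u
  have d1 : ∀ i N, partialDeriv i (U N) = trigSum R (flip i σ) (Du i) N := fun i N =>
    partialDeriv_trigSum hR σ (fun k => integral_parts_of_traces_zero hR hH2.h1.memLp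
      (hH2.h1.memLp_deriv i) (ht i) (ht' i) (contDiff_trigProd _ _)) N
  have d2 : ∀ i j N, partialDeriv j (partialDeriv i (U N))
      = trigSum R (flip j (flip i σ)) (D2u i j) N := by
    intro i j N
    rw [d1]
    refine partialDeriv_trigSum hR _ (fun k => ?_) N
    rcases eq_or_ne i j with rfl | hij
    · refine ((hH2.h1_deriv i).weak i).integral_parts hR (hH2.h1_deriv i).memLp
        ((hH2.h1_deriv i).memLp_deriv i) (contDiff_trigProd _ _) fun x hx => ?_
      rw [flip_flip]
      exact Finset.prod_eq_zero (Finset.mem_univ i) (trig_sin_endpoint hR _ hx)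
    · exact hH2.integral_parts_of_ne hR ht ht' hij (contDiff_trigProd _ _)
  have t1 : ∀ i, Tendsto (fun N => eLpNorm (fun x => partialDeriv i (U N) x - Du i x) 2
      (cubeMeasure d R)) atTop (𝓝 0) := fun i => by
    simp only [d1]; exact tendsto_trigSum hR _ (hH2.h1.memLp_deriv i)
  have t2 : ∀ i j, Tendsto (fun N => eLpNorm (fun x => partialDeriv j (partialDeriv i (U N)) x
        - D2u i j x) 2 (cubeMeasure d R)) atTop (𝓝 0) := fun i j => by
    simp only [d2]; exact tendsto_trigSum hR _ ((hH2.h1_deriv i).memLp_deriv j)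
  refine ⟨U, cU, fun N x i hx => ?_, tendsto_trigSum hR σ hH2.h1.memLp, t1, t2, ?_⟩
  · refine Finset.sum_eq_zero fun k _ => ?_
    rw [trigProd, Finset.prod_eq_zero (Finset.mem_univ i) (trig_sin_endpoint hR _ hx), mul_zero]
  obtain ⟨-, v, hv, hv0, hv1, hvt⟩ := htop
  set n := Fin.last d
  have cn : ∀ N, ContDiff ℝ ∞ (partialDeriv n (U N)) := fun N => contDiff_partialDeriv (cU N) n
  have cnn : ∀ N, ContDiff ℝ ∞ (partialDeriv n (partialDeriv n (U N))) := fun N =>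
    contDiff_partialDeriv (cn N) n
  set C := (2 * R)⁻¹ + 1 with hC
  have mg := hH2.h1.memLp_deriv n
  have mg' := (hH2.h1_deriv n).memLp_deriv n
  have bound : ∀ N, ∫ y, partialDeriv n (U N) (facePt n R y) ^ 2 ∂faceMeasure d R
      ≤ 2 * (C * (∫ x, (partialDeriv n (U N) x - Du n x) ^ 2 ∂cubeMeasure d R
        + ∫ x, (partialDeriv n (partialDeriv n (U N)) x - D2u n n x) ^ 2 ∂cubeMeasure d R)) := by
    intro N
    have s0 := tendsto_integral_sq_sub (fun k => memLp_face (R := R) (p := 2)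
      ((hv k).continuous.comp (continuous_facePt n R))) (f := 0) (by simp) hvt
    have conv : ∀ (F : ℕ → Pt d → ℝ) (f g : Pt d → ℝ), (∀ k, ContDiff ℝ ∞ (F k)) →
        MemLp f 2 (cubeMeasure d R) → ContDiff ℝ ∞ g →
        Tendsto (fun k => eLpNorm (fun x => F k x - f x) 2 (cubeMeasure d R)) atTop (𝓝 0) →
        Tendsto (fun k => ∫ x, (g x - F k x) ^ 2 ∂cubeMeasure d R) atTop
          (𝓝 (∫ x, (g x - f x) ^ 2 ∂cubeMeasure d R)) := by
      intro F f g hF hf hg hl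
      have mF : ∀ k, MemLp (fun x => g x - F k x) 2 (cubeMeasure d R) := fun k =>
        (memLp_smooth hg).sub (memLp_smooth (hF k))
      have mf : MemLp (fun x => g x - f x) 2 (cubeMeasure d R) := (memLp_smooth hg).sub hf
      have hl' : Tendsto (fun k => eLpNorm (fun x => (g x - F k x) - (g x - f x)) 2
          (cubeMeasure d R)) atTop (𝓝 0) := by
        refine hl.congr fun k => ?_
        rw [← eLpNorm_neg]
        congr 1
        ext x
        simp
      simpa only [sq] using tendsto_integral_mul mF mF mf mf hl' hl'
    have s1 := conv v (Du n) _ hv mg (cn N) hv0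
    have s2 := conv (fun k => partialDeriv n (v k)) (D2u n n) _
      (fun k => contDiff_partialDeriv (hv k) n) mg' (cnn N) (hv1 n)
    have lim := (s0.const_mul 2).add (((s1.add s2).const_mul C).const_mul 2)
    rw [mul_zero, zero_add] at lim
    refine ge_of_tendsto' lim fun k => ?_
    have hw : ContDiff ℝ ∞ fun x => partialDeriv n (U N) x - v k x := (cn N).sub (hv k)
    have tr := integral_face_sq_le hR hw n
    simp only [partialDeriv_sub (cn N) (hv k)] at tr
    have i1 : Integrable (fun y => (v k (facePt n R y)) ^ 2) (faceMeasure d R) :=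
      memLp_one_iff_integrable.1
        (memLp_face (((hv k).continuous.comp (continuous_facePt n R)).pow 2))
    have i2 : Integrable (fun y => (partialDeriv n (U N) (facePt n R y) - v k (facePt n R y)) ^ 2)
        (faceMeasure d R) := memLp_one_iff_integrable.1
          (memLp_face ((hw.continuous.comp (continuous_facePt n R)).pow 2))
    have i3 : Integrable (fun y => partialDeriv n (U N) (facePt n R y) ^ 2)
        (faceMeasure d R) := memLp_one_iff_integrable.1
          (memLp_face (((cn N).continuous.comp (continuous_facePt n R)).pow 2))
    calc ∫ y, partialDeriv n (U N) (facePt n R y) ^ 2 ∂faceMeasure d R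
        ≤ ∫ y, 2 * v k (facePt n R y) ^ 2
            + 2 * (partialDeriv n (U N) (facePt n R y) - v k (facePt n R y)) ^ 2
            ∂faceMeasure d R := by
          refine integral_mono i3 ((i1.const_mul 2).add (i2.const_mul 2)) fun y => ?_
          dsimp only
          nlinarith [sq_nonneg (partialDeriv n (U N) (facePt n R y) - 2 * v k (facePt n R y))]
      _ = 2 * ∫ y, v k (facePt n R y) ^ 2 ∂faceMeasure d R
          + 2 * ∫ y, (partialDeriv n (U N) (facePt n R y) - v k (facePt n R y)) ^ 2
            ∂faceMeasure d R := by
          rw [integral_add (i1.const_mul 2) (i2.const_mul 2), integral_const_mul,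
            integral_const_mul]
      _ ≤ _ := by
          simp only [Pi.zero_apply, sub_zero, Function.comp]
          gcongr
  have l1 := tendsto_integral_sq_sub (fun N => memLp_smooth (cn N)) mg (t1 n)
  have l2 := tendsto_integral_sq_sub (fun N => memLp_smooth (cnn N)) mg' (t2 n n)
  have l3 := ((l1.add l2).const_mul C).const_mul 2
  rw [add_zero, mul_zero, mul_zero] at l3
  exact squeeze_zero (fun N => integral_nonneg fun _ => sq_nonneg _) bound l3

end Approximation

/-! ### The pointwise inequality -/

section Algebra

variable {ι : Type*} [Fintype ι]

/-- The terms with second derivatives in the divergence of the field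
`W_m = ∑ᵢₖ (2 aᵢₘ aₖₙ - aₘₙ aᵢₖ) vᵢ vₖ` add up to `2 (∑ aᵢⱼ vᵢⱼ) (∑ aₖₙ vₖ)`. -/
theorem sum_rellich (n : ι) (a v2 : ι → ι → ℝ) (v1 : ι → ℝ) (ha : ∀ i j, a i j = a j i)
    (hv : ∀ i j, v2 i j = v2 j i) :
    ∑ m, ∑ i, ∑ k, (2 * (a i m * a k n) - a m n * a i k) * (v2 i m * v1 k + v1 i * v2 k m)
      = 2 * ((∑ i, ∑ j, a i j * v2 i j) * ∑ k, a k n * v1 k) := by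
  have e1 : (∑ i, ∑ j, a i j * v2 i j) * ∑ k, a k n * v1 k
      = ∑ m, ∑ i, ∑ k, a i m * a k n * v2 i m * v1 k := by
    rw [Finset.sum_comm, Finset.sum_mul]
    refine Finset.sum_congr rfl fun m _ => ?_
    rw [Finset.sum_mul]
    refine Finset.sum_congr rfl fun i _ => ?_
    rw [Finset.mul_sum]
    exact Finset.sum_congr rfl fun k _ => by ring
  have e2 : ∑ m, ∑ i, ∑ k, a i m * a k n * v1 i * v2 k m
      = ∑ m, ∑ i, ∑ k, a m n * a i k * v1 i * v2 k m := by
    rw [Finset.sum_comm]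
    conv_rhs => rw [Finset.sum_comm]
    refine Finset.sum_congr rfl fun i _ => ?_
    rw [Finset.sum_comm]
    refine Finset.sum_congr rfl fun k _ => Finset.sum_congr rfl fun m _ => ?_
    rw [hv k m]; ring
  have e3 : ∑ m, ∑ i, ∑ k, a m n * a i k * v2 i m * v1 k
      = ∑ m, ∑ i, ∑ k, a m n * a i k * v1 i * v2 k m := by
    refine Finset.sum_congr rfl fun m _ => ?_
    rw [Finset.sum_comm]
    refine Finset.sum_congr rfl fun k _ => Finset.sum_congr rfl fun i _ => ?_
    rw [ha i k]; ring
  have e4 : ∑ m, ∑ i, ∑ k, (2 * (a i m * a k n) - a m n * a i k) * (v2 i m * v1 k + v1 i * v2 k m)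
      = 2 * ∑ m, ∑ i, ∑ k, a i m * a k n * v2 i m * v1 k
        + 2 * ∑ m, ∑ i, ∑ k, a i m * a k n * v1 i * v2 k m
        - ∑ m, ∑ i, ∑ k, a m n * a i k * v2 i m * v1 k
        - ∑ m, ∑ i, ∑ k, a m n * a i k * v1 i * v2 k m := by
    simp only [Finset.mul_sum, ← Finset.sum_add_distrib, ← Finset.sum_sub_distrib]
    refine Finset.sum_congr rfl fun m _ => Finset.sum_congr rfl fun i _ =>
      Finset.sum_congr rfl fun k _ => by ring
  rw [e4, e1, e2, e3]
  ring

theorem abs_sum_cubic_le {c : ι → ι → ι → ℝ} {B : ℝ} (hB : 0 ≤ B) (hc : ∀ m i k, |c m i k| ≤ B)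
    (v1 : ι → ℝ) :
    |∑ m, ∑ i, ∑ k, c m i k * (v1 i * v1 k)| ≤ B * (Fintype.card ι) ^ 2 * ∑ i, v1 i ^ 2 := by
  have h1 : ∀ m i k, |c m i k * (v1 i * v1 k)| ≤ B * (v1 i ^ 2 / 2 + v1 k ^ 2 / 2) := by
    intro m i k
    rw [abs_mul]
    refine mul_le_mul (hc m i k) ?_ (abs_nonneg _) hB
    rw [abs_mul]
    nlinarith [sq_nonneg (|v1 i| - |v1 k|), sq_abs (v1 i), sq_abs (v1 k)]
  have h2 : |∑ m, ∑ i, ∑ k, c m i k * (v1 i * v1 k)|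
      ≤ ∑ _m : ι, ∑ i, ∑ k, B * (v1 i ^ 2 / 2 + v1 k ^ 2 / 2) := by
    refine (Finset.abs_sum_le_sum_abs _ _).trans (Finset.sum_le_sum fun m _ => ?_)
    refine (Finset.abs_sum_le_sum_abs _ _).trans (Finset.sum_le_sum fun i _ => ?_)
    exact (Finset.abs_sum_le_sum_abs _ _).trans (Finset.sum_le_sum fun k _ => h1 m i k)
  refine h2.trans (le_of_eq ?_)
  simp only [← Finset.mul_sum, Finset.sum_add_distrib, Finset.sum_const, Finset.card_univ,
    nsmul_eq_mul, ← Finset.sum_div]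
  ring

theorem mul_abs_sum_le {c : ι → ι → ℝ} {M K : ℝ} (hK : 0 ≤ K) (hc : ∀ m i, |c m i| ≤ M)
    (v1 : ι → ℝ) (v : ℝ) :
    K * |∑ m, ∑ i, c m i * v1 i * v|
      ≤ (∑ i, v1 i ^ 2) + Fintype.card ι * (K * M * Fintype.card ι) ^ 2 / 4 * v ^ 2 := by
  have h1 : |∑ m, ∑ i, c m i * v1 i * v| ≤ ∑ _m : ι, ∑ i, M * (|v1 i| * |v|) := by
    refine (Finset.abs_sum_le_sum_abs _ _).trans (Finset.sum_le_sum fun m _ => ?_)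
    refine (Finset.abs_sum_le_sum_abs _ _).trans (Finset.sum_le_sum fun i _ => ?_)
    rw [mul_assoc, abs_mul, abs_mul]
    gcongr
    exact hc m i
  rw [Finset.sum_const, Finset.card_univ, nsmul_eq_mul] at h1
  calc K * |∑ m, ∑ i, c m i * v1 i * v|
      ≤ K * (Fintype.card ι * ∑ i, M * (|v1 i| * |v|)) := by gcongr
    _ = ∑ i, K * M * Fintype.card ι * (|v1 i| * |v|) := by
        simp only [← Finset.mul_sum]; ring
    _ ≤ ∑ i, (v1 i ^ 2 + (K * M * Fintype.card ι) ^ 2 / 4 * v ^ 2) := by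
        refine Finset.sum_le_sum fun i _ => ?_
        nlinarith [sq_nonneg (|v1 i| - K * M * Fintype.card ι * |v| / 2), sq_abs (v1 i), sq_abs v]
    _ = _ := by
        rw [Finset.sum_add_distrib, Finset.sum_const, Finset.card_univ, nsmul_eq_mul]; ring

/-- The scalar inequality behind the Carleman estimate. Here `L` and `T` stand for `∑ aᵢⱼ vᵢⱼ` and
`∑ aₖₙ vₖ`, and `F` for the conjugated operator applied to `v`; `q` and `r q` are the first two
derivatives of the phase, `G = |∇v|²`, and the bracket on the right-hand side is a divergence. The
cross term of `F² / q` yields the positive term `λ³ v²`, which is large when `r` is large; the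
multiplier `K λ v` trades a part of it for `λ |∇v|²`. -/
theorem carleman_scalar {F L T v G q r α Q D E γ δ lam K M N C₁ B₁ μ q₀ q₁ r₀ r₁ : ℝ}
    (hF : F = L + lam ^ 2 * q ^ 2 * α * v - 2 * lam * q * T - lam * (r * q) * α * v)
    (hq₀ : 0 < q₀) (hq : q₀ ≤ q) (hq' : q ≤ q₁) (hr₀ : 0 ≤ r₀) (hr : r₀ ≤ r) (hr' : r ≤ r₁)
    (hμ : 0 < μ) (hα : μ ≤ α) (hα' : α ≤ M) (hN : 0 ≤ N) (hK : 0 ≤ K) (hlam : 1 ≤ lam)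
    (hB₁ : 0 ≤ B₁)
    (hQ : |Q| ≤ C₁ * G) (hγ : |γ| ≤ 2 * N * M ^ 2) (hD : K * |D| ≤ G + B₁ * v ^ 2)
    (hE : μ * G ≤ E) (hδ : |δ| ≤ N * M) (hKμ : K * μ = 2 * C₁ + 2)
    (hr₀' : 4 * N * M ^ 2 + K * M + 1 ≤ 4 * r₀ * μ ^ 2)
    (hlam' : 2 * (K * q₁ * (N * M) + K ^ 2 / 4 + q₁ * r₁ ^ 2 * M ^ 2 + B₁) ≤ lam * q₀ ^ 2) :
    lam * G + lam ^ 3 * q₀ ^ 2 / 2 * v ^ 2 ≤ (1 / q₀ + 1) * F ^ 2 +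
      (2 * lam * (Q + 2 * (L * T))
        + 2 * lam ^ 3 * ((2 * q * (r * q) * α ^ 2 + q ^ 2 * γ) * v ^ 2 + 2 * (q ^ 2 * α * v * T))
        + K * lam * (D + L * v + E)
        - K * lam ^ 2 * ((r * q * α + q * δ) * v ^ 2 + 2 * (q * v * T))) := by
  have hqpos : 0 < q := hq₀.trans_le hq
  have hM : 0 < M := hμ.trans_le (hα.trans hα')
  have hαpos : 0 < α := hμ.trans_le hα
  have hl : 0 < lam := by linarith
  have hr0 : 0 ≤ r := hr₀.trans hr
  have hv : 0 ≤ v ^ 2 := sq_nonneg v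
  have h0 : F ^ 2 / q ≤ 1 / q₀ * F ^ 2 := by
    rw [div_eq_mul_one_div, mul_comm]
    gcongr
  have h1 : 0 ≤ F ^ 2 / q + lam ^ 2 * r ^ 2 * q * α ^ 2 * v ^ 2
      + 4 * lam * (L + lam ^ 2 * q ^ 2 * α * v) * T := by
    have e : F ^ 2 / q + lam ^ 2 * r ^ 2 * q * α ^ 2 * v ^ 2
        + 4 * lam * (L + lam ^ 2 * q ^ 2 * α * v) * T
        = ((F - lam * r * q * α * v) ^ 2
          + (L + lam ^ 2 * q ^ 2 * α * v + 2 * lam * q * T) ^ 2) / (2 * q) := by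
      rw [hF]; field_simp; ring
    rw [e]; positivity
  have h2 : 0 ≤ F ^ 2 + K * lam * F * v + K ^ 2 * lam ^ 2 * v ^ 2 / 4 := by
    linear_combination sq_nonneg (F + K * lam * v / 2)
  have h3 : 2 * lam * Q + 2 * lam ^ 3 * ((2 * r * q ^ 2 * α ^ 2 + q ^ 2 * γ) * v ^ 2)
      + K * lam * (D + E) - K * lam ^ 3 * q ^ 2 * α * v ^ 2 - K * lam ^ 2 * (q * δ) * v ^ 2
      - lam ^ 2 * r ^ 2 * q * α ^ 2 * v ^ 2 - K ^ 2 * lam ^ 2 * v ^ 2 / 4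
      ≤ F ^ 2 / q + F ^ 2 + (2 * lam * (Q + 2 * (L * T))
        + 2 * lam ^ 3 * ((2 * q * (r * q) * α ^ 2 + q ^ 2 * γ) * v ^ 2 + 2 * (q ^ 2 * α * v * T))
        + K * lam * (D + L * v + E)
        - K * lam ^ 2 * ((r * q * α + q * δ) * v ^ 2 + 2 * (q * v * T))) := by
    linear_combination h1 + h2 + K * lam * v * hF
  -- First-order terms.
  have g1 : 2 * lam * Q ≥ -(2 * lam * (C₁ * G)) := by
    have h : -(C₁ * G) ≤ Q := (neg_le_neg hQ).trans (neg_abs_le Q)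
    linear_combination mul_le_mul_of_nonneg_left h (by positivity : 0 ≤ 2 * lam)
  have g2 : K * lam * D ≥ -(lam * (G + B₁ * v ^ 2)) := by
    have h : K * -D ≤ K * |D| := mul_le_mul_of_nonneg_left (neg_le_abs D) hK
    linear_combination mul_le_mul_of_nonneg_left (h.trans hD) hl.le
  have g3 : K * lam * E ≥ lam * ((2 * C₁ + 2) * G) := by
    rw [← hKμ]
    linear_combination mul_le_mul_of_nonneg_left hE (mul_nonneg hK hl.le)
  -- Terms of order `λ³`.
  have a2 : μ ^ 2 ≤ α ^ 2 := by gcongr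
  have k1 : 1 ≤ 4 * r * α ^ 2 + 2 * γ - K * α := by
    have s1 : 4 * r₀ * μ ^ 2 ≤ 4 * r * α ^ 2 := by gcongr
    have s2 := neg_abs_le γ
    have s3 : K * α ≤ K * M := by gcongr
    linarith
  have k2 : lam ^ 3 * q ^ 2 * v ^ 2 ≤ 2 * lam ^ 3 * ((2 * r * q ^ 2 * α ^ 2 + q ^ 2 * γ) * v ^ 2)
      - K * lam ^ 3 * q ^ 2 * α * v ^ 2 := by
    have : 0 ≤ lam ^ 3 * q ^ 2 * v ^ 2 := by positivity
    linear_combination mul_le_mul_of_nonneg_left k1 this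
  have k3 : lam ^ 3 * q₀ ^ 2 * v ^ 2 ≤ lam ^ 3 * q ^ 2 * v ^ 2 := by gcongr
  -- Lower-order terms.
  have b1 : K * (q * δ) ≤ K * q₁ * (N * M) := by
    rw [mul_assoc]
    refine mul_le_mul_of_nonneg_left ?_ hK
    exact (mul_le_mul_of_nonneg_left ((le_abs_self δ).trans hδ) hqpos.le).trans
      (mul_le_mul_of_nonneg_right hq' (by positivity))
  have b2 : r ^ 2 * q * α ^ 2 ≤ q₁ * r₁ ^ 2 * M ^ 2 := by
    have : r ^ 2 * q ≤ q₁ * r₁ ^ 2 := by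
      rw [mul_comm]; gcongr
      exact hqpos.le.trans hq'
    gcongr
    exact (by positivity : 0 ≤ r ^ 2 * q).trans this
  have b3 : lam * B₁ ≤ lam ^ 2 * B₁ := by
    gcongr
    exact le_self_pow₀ hlam two_ne_zero
  have b4 : (lam ^ 2 * (K * (q * δ) + r ^ 2 * q * α ^ 2 + K ^ 2 / 4) + lam * B₁)
      ≤ lam ^ 3 * q₀ ^ 2 / 2 := by
    have : lam ^ 2 * (K * (q * δ) + r ^ 2 * q * α ^ 2 + K ^ 2 / 4 + B₁)
        ≤ lam ^ 2 * (lam * q₀ ^ 2 / 2) := by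
      gcongr
      linear_combination hlam' / 2 + b1 + b2
    linear_combination this + b3
  have b5 := mul_le_mul_of_nonneg_right b4 hv
  linear_combination h3 + h0 + g1 + g2 + g3 + k2 + k3 + b5

end Algebra

/-! ### Integration of the divergence terms -/

section Divergence

variable {d : ℕ} {R : ℝ}

theorem CubeC1.sub {f g : Pt d → ℝ} {f' g' : Fin (d + 1) → Pt d → ℝ} (hf : CubeC1 R f f')
    (hg : CubeC1 R g g') : CubeC1 R (fun x => f x - g x) fun k x => f' k x - g' k x := by
  simpa [sub_eq_add_neg] using hf.add (hg.const_mul (-1))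

/-- The divergence theorem for a vector field `W` with divergence `g`. -/
theorem integral_div (hR : 0 < R) {W : Fin (d + 1) → Pt d → ℝ}
    {W' : Fin (d + 1) → Fin (d + 1) → Pt d → ℝ} (hW : ∀ m, CubeC1 R (W m) (W' m)) {g : Pt d → ℝ}
    (hg : ∀ x ∈ cube d R, ∑ m, W' m m x = g x) :
    Integrable g (cubeMeasure d R) ∧ ∫ x, g x ∂cubeMeasure d R
      = ∑ m, (∫ y, W m (facePt m R y) ∂faceMeasure d R
        - ∫ y, W m (facePt m (-R) y) ∂faceMeasure d R) := by
  have hi : ∀ m, Integrable (W' m m) (cubeMeasure d R) := fun m =>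
    integrable_of_continuousOn ((hW m).cont' m)
  have he : (fun x => ∑ m, W' m m x) =ᵐ[cubeMeasure d R] g := by
    filter_upwards [ae_mem_cube] with x hx using hg x hx
  refine ⟨(integrable_finsetSum _ fun m _ => hi m).congr he, ?_⟩
  rw [← integral_congr_ae he, integral_finsetSum _ fun m _ => hi m]
  exact Finset.sum_congr rfl fun m _ => (hW m).integral_partial hR m

theorem integral_face_eq_zero {f : Pt d → ℝ} {m : Fin (d + 1)} {c : ℝ}
    (h : ∀ y ∈ faceCube d R, f (facePt m c y) = 0) :
    ∫ y, f (facePt m c y) ∂faceMeasure d R = 0 := by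
  refine integral_eq_zero_of_ae ?_
  filter_upwards [ae_mem_faceCube] with y hy using h y hy

theorem facePt_mem_frontier (hR : 0 < R) {c : ℝ} (hc : c = R ∨ c = -R) {m : Fin (d + 1)}
    {y : Fin d → ℝ} (hy : y ∈ faceCube d R) : facePt m c y ∈ frontier (cube d R) := by
  rw [isOpen_cube.frontier_eq]
  refine ⟨?_, fun h => ?_⟩
  · rw [cube, closure_pi_set]
    simp only [closure_Ioo (by linarith : -R ≠ R)]
    exact facePt_mem_closedCube hR hc hy
  · have := mem_cube.1 h m
    simp only [facePt, Fin.insertNth_apply_same] at this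
    rcases hc with rfl | rfl <;> linarith

/-- On the lateral faces the coefficients `aₘₙ` vanish. -/
theorem Admissible.lateral_face {μ₁ μ₂ M : ℝ} {a : Fin (d + 1) → Fin (d + 1) → Pt d → ℝ}
    (ha : Admissible R μ₁ μ₂ M a) (hR : 0 < R) {c : ℝ} (hc : c = R ∨ c = -R) {m : Fin (d + 1)}
    (hm : m ≠ Fin.last d) {y : Fin d → ℝ} (hy : y ∈ faceCube d R) :
    a m (Fin.last d) (facePt m c y) = 0 := by
  obtain ⟨j, hj⟩ := Fin.exists_succAbove_eq hm.symm
  have hz : zc (facePt m c y) = y j := by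
    rw [zc, ← hj]; simp [facePt]
  have hyj := hy j (mem_univ _)
  exact ha.lateral _ (facePt_mem_frontier hR hc hy) (by rw [hz]; exact hyj.2.ne)
    (by rw [hz]; exact hyj.1.ne') m hm

variable {μ₁ μ₂ M : ℝ} {a : Fin (d + 1) → Fin (d + 1) → Pt d → ℝ}

theorem Admissible.cubeC1 (ha : Admissible R μ₁ μ₂ M a) (hR : 0 < R) (i j : Fin (d + 1)) :
    CubeC1 R (a i j) fun k => partialDerivOn R k (a i j) :=
  CubeC1.of_contDiffOn hR (ha.c1 i j).contDiffOn

/-- The derivative `∑ₖ aₖₙ vₖ` of `v` in the conormal direction of the levels of the weight. -/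
noncomputable def conormal (a : Fin (d + 1) → Fin (d + 1) → Pt d → ℝ)
    (v1 : Fin (d + 1) → Pt d → ℝ) (x : Pt d) : ℝ := ∑ k, a k (Fin.last d) x * v1 k x

variable {v : Pt d → ℝ} {v1 : Fin (d + 1) → Pt d → ℝ} {v2 : Fin (d + 1) → Fin (d + 1) → Pt d → ℝ}

/-- The quadratic form in `∇v` that arises from the derivatives of the coefficients in the
divergence of the field `W_m = ∑ᵢₖ (2 aᵢₘ aₖₙ - aₘₙ aᵢₖ) vᵢ vₖ`. -/
noncomputable def rellichForm (R : ℝ) (a : Fin (d + 1) → Fin (d + 1) → Pt d → ℝ)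
    (v1 : Fin (d + 1) → Pt d → ℝ) (x : Pt d) : ℝ :=
  ∑ m, ∑ i, ∑ k,
    (2 * (partialDerivOn R m (a i m) x * a k (Fin.last d) x
        + a i m x * partialDerivOn R m (a k (Fin.last d)) x)
      - (partialDerivOn R m (a m (Fin.last d)) x * a i k x
        + a m (Fin.last d) x * partialDerivOn R m (a i k) x)) * (v1 i x * v1 k x)

/-- The integrated Rellich identity: for `v` that vanishes on the boundary, the lateral faces do not
contribute because `aₘₙ = 0` there, and the bottom face contributes with a favourable sign. -/
theorem Admissible.integral_rellich_le (ha : Admissible R μ₁ μ₂ M a) (hR : 0 < R)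
    (hv1 : ∀ i, CubeC1 R (v1 i) (v2 i))
    (hsym : ∀ x ∈ cube d R, ∀ i j, v2 i j x = v2 j i x)
    (hb : ∀ m i c, c = R ∨ c = -R → i ≠ m → ∀ y ∈ faceCube d R, v1 i (facePt m c y) = 0) :
    Integrable (fun x => rellichForm R a v1 x + 2 * (L0 a v2 x * conormal a v1 x))
      (cubeMeasure d R) ∧
    ∫ x, rellichForm R a v1 x + 2 * (L0 a v2 x * conormal a v1 x) ∂cubeMeasure d R
      ≤ ∫ y, (a (Fin.last d) (Fin.last d) (facePt (Fin.last d) R y)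
        * v1 (Fin.last d) (facePt (Fin.last d) R y)) ^ 2 ∂faceMeasure d R := by
  set n := Fin.last d with hn
  have hac := fun i j => ha.cubeC1 hR i j
  have hW : ∀ m, CubeC1 R (fun x => ∑ i, ∑ k, (2 * (a i m x * a k n x) - a m n x * a i k x)
      * (v1 i x * v1 k x)) _ := fun m =>
    CubeC1.sum _ fun i _ => CubeC1.sum _ fun k _ =>
      ((((hac i m).mul (hac k n)).const_mul 2).sub ((hac m n).mul (hac i k))).mul
        ((hv1 i).mul (hv1 k))
  obtain ⟨h1, h2⟩ := integral_div hR hW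
    (g := fun x => rellichForm R a v1 x + 2 * (L0 a v2 x * conormal a v1 x)) (by
      intro x hx
      simp only [Finset.sum_add_distrib]
      congr 1
      exact sum_rellich n (fun i j => a i j x) (fun i j => v2 i j x) (fun i => v1 i x)
        (ha.symm x (cube_subset_closedCube hx)) (hsym x hx))
  refine ⟨h1, h2.trans_le ?_⟩
  have hface : ∀ m c, c = R ∨ c = -R → ∀ y ∈ faceCube d R,
      ∑ i, ∑ k, (2 * (a i m (facePt m c y) * a k n (facePt m c y))
        - a m n (facePt m c y) * a i k (facePt m c y)) * (v1 i (facePt m c y) * v1 k (facePt m c y))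
      = a m m (facePt m c y) * a m n (facePt m c y) * v1 m (facePt m c y) ^ 2 := by
    intro m c hc y hy
    rw [Finset.sum_eq_single m, Finset.sum_eq_single m]
    · ring
    · intro k _ hk
      rw [hb m k c hc hk y hy]; ring
    · simp
    · intro i _ hi
      refine Finset.sum_eq_zero fun k _ => ?_
      rw [hb m i c hc hi y hy]; ring
    · simp
  rw [Finset.sum_eq_single n]
  · have e : ∀ c, c = R ∨ c = -R → ∫ y, ∑ i, ∑ k,
        (2 * (a i n (facePt n c y) * a k n (facePt n c y))
          - a n n (facePt n c y) * a i k (facePt n c y))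
          * (v1 i (facePt n c y) * v1 k (facePt n c y)) ∂faceMeasure d R
        = ∫ y, (a n n (facePt n c y) * v1 n (facePt n c y)) ^ 2 ∂faceMeasure d R := by
      intro c hc
      refine integral_congr_ae ?_
      filter_upwards [ae_mem_faceCube] with y hy
      rw [hface n c hc y hy]; ring
    rw [e R (Or.inl rfl), e (-R) (Or.inr rfl)]
    have : 0 ≤ ∫ y, (a n n (facePt n (-R) y) * v1 n (facePt n (-R) y)) ^ 2 ∂faceMeasure d R :=
      integral_nonneg fun _ => sq_nonneg _
    linarith
  · intro m _ hm
    have z : ∀ c, c = R ∨ c = -R → ∫ y, ∑ i, ∑ k,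
        (2 * (a i m (facePt m c y) * a k n (facePt m c y))
          - a m n (facePt m c y) * a i k (facePt m c y))
          * (v1 i (facePt m c y) * v1 k (facePt m c y)) ∂faceMeasure d R = 0 := by
      intro c hc
      refine integral_eq_zero_of_ae ?_
      filter_upwards [ae_mem_faceCube] with y hy
      rw [hface m c hc y hy, ha.lateral_face hR hc hm hy]
      simp
    rw [z R (Or.inl rfl), z (-R) (Or.inr rfl), sub_zero]
  · simp

/-- A field with a factor `v` that vanishes on the boundary has a divergence of integral zero. -/
theorem integral_div_eq_zero (hR : 0 < R) {W : Fin (d + 1) → Pt d → ℝ}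
    {W' : Fin (d + 1) → Fin (d + 1) → Pt d → ℝ} (hW : ∀ m, CubeC1 R (W m) (W' m)) {g : Pt d → ℝ}
    (hg : ∀ x ∈ cube d R, ∑ m, W' m m x = g x)
    (h0 : ∀ m c, c = R ∨ c = -R → ∀ y ∈ faceCube d R, W m (facePt m c y) = 0) :
    Integrable g (cubeMeasure d R) ∧ ∫ x, g x ∂cubeMeasure d R = 0 := by
  obtain ⟨h1, h2⟩ := integral_div hR hW hg
  refine ⟨h1, h2.trans (Finset.sum_eq_zero fun m _ => ?_)⟩
  rw [integral_face_eq_zero (h0 m R (Or.inl rfl)), integral_face_eq_zero (h0 m (-R) (Or.inr rfl)),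
    sub_zero]

variable {q r : Pt d → ℝ}

theorem Admissible.integral_zeroth_order (ha : Admissible R μ₁ μ₂ M a) (hR : 0 < R)
    (hq : CubeC1 R q fun k x => (if k = Fin.last d then 1 else 0) * (r x * q x))
    (hv : CubeC1 R v v1)
    (h0 : ∀ m c, c = R ∨ c = -R → ∀ y ∈ faceCube d R, v (facePt m c y) = 0) :
    Integrable (fun x => (2 * q x * (r x * q x) * a (Fin.last d) (Fin.last d) x ^ 2
      + q x ^ 2 * ∑ m, (partialDerivOn R m (a (Fin.last d) (Fin.last d)) x * a m (Fin.last d) x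
        + a (Fin.last d) (Fin.last d) x * partialDerivOn R m (a m (Fin.last d)) x)) * v x ^ 2
      + 2 * (q x ^ 2 * a (Fin.last d) (Fin.last d) x * v x * conormal a v1 x))
      (cubeMeasure d R) ∧
    ∫ x, (2 * q x * (r x * q x) * a (Fin.last d) (Fin.last d) x ^ 2
      + q x ^ 2 * ∑ m, (partialDerivOn R m (a (Fin.last d) (Fin.last d)) x * a m (Fin.last d) x
        + a (Fin.last d) (Fin.last d) x * partialDerivOn R m (a m (Fin.last d)) x)) * v x ^ 2
      + 2 * (q x ^ 2 * a (Fin.last d) (Fin.last d) x * v x * conormal a v1 x)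
      ∂cubeMeasure d R = 0 := by
  set n := Fin.last d with hn
  have hac := fun i j => ha.cubeC1 hR i j
  have hW : ∀ m, CubeC1 R (fun x => (q x * q x) * (a n n x * a m n x) * (v x * v x)) _ := fun m =>
    ((hq.mul hq).mul ((hac n n).mul (hac m n))).mul (hv.mul hv)
  refine integral_div_eq_zero hR hW (fun x _ => ?_) fun m c hc y hy => by
    rw [h0 m c hc y hy]; ring
  rw [show conormal a v1 x = ∑ k, a k n x * v1 k x from rfl]
  have e : ∀ m, (((if m = n then 1 else 0) * (r x * q x) * q x
      + q x * ((if m = n then 1 else 0) * (r x * q x))) * (a n n x * a m n x)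
      + q x * q x * (partialDerivOn R m (a n n) x * a m n x
        + a n n x * partialDerivOn R m (a m n) x)) * (v x * v x)
      + q x * q x * (a n n x * a m n x) * (v1 m x * v x + v x * v1 m x)
      = (if m = n then 2 * q x * (r x * q x) * a n n x * a m n x * v x ^ 2 else 0)
        + q x ^ 2 * v x ^ 2 * (partialDerivOn R m (a n n) x * a m n x
          + a n n x * partialDerivOn R m (a m n) x)
        + 2 * q x ^ 2 * a n n x * v x * (a m n x * v1 m x) := by
    intro m
    by_cases h : m = n
    · simp only [h, if_true]; ring
    · simp only [h, if_false]; ring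
  simp only [e]
  rw [Finset.sum_add_distrib, Finset.sum_add_distrib, ← Finset.mul_sum, ← Finset.mul_sum,
    Finset.sum_ite_eq' Finset.univ n]
  simp only [Finset.mem_univ, if_true]
  ring

theorem Admissible.integral_energy (ha : Admissible R μ₁ μ₂ M a) (hR : 0 < R)
    (hv : CubeC1 R v v1) (hv1 : ∀ i, CubeC1 R (v1 i) (v2 i))
    (h0 : ∀ m c, c = R ∨ c = -R → ∀ y ∈ faceCube d R, v (facePt m c y) = 0) :
    Integrable (fun x => (∑ m, ∑ i, partialDerivOn R m (a i m) x * v1 i x * v x)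
      + L0 a v2 x * v x + ∑ i, ∑ j, a i j x * v1 i x * v1 j x) (cubeMeasure d R) ∧
    ∫ x, (∑ m, ∑ i, partialDerivOn R m (a i m) x * v1 i x * v x)
      + L0 a v2 x * v x + ∑ i, ∑ j, a i j x * v1 i x * v1 j x ∂cubeMeasure d R = 0 := by
  have hac := fun i j => ha.cubeC1 hR i j
  have hW : ∀ m, CubeC1 R (fun x => ∑ i, a i m x * v1 i x * v x) _ := fun m =>
    CubeC1.sum _ fun i _ => ((hac i m).mul (hv1 i)).mul hv
  refine integral_div_eq_zero hR hW (fun x _ => ?_) fun m c hc y hy => by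
    simp [h0 m c hc y hy]
  rw [L0, Finset.sum_comm (f := fun i j => a i j x * v2 i j x),
    Finset.sum_comm (f := fun i j => a i j x * v1 i x * v1 j x), Finset.sum_mul]
  simp only [Finset.sum_mul, ← Finset.sum_add_distrib]
  exact Finset.sum_congr rfl fun m _ => Finset.sum_congr rfl fun i _ => by ring

theorem Admissible.integral_first_order (ha : Admissible R μ₁ μ₂ M a) (hR : 0 < R)
    (hq : CubeC1 R q fun k x => (if k = Fin.last d then 1 else 0) * (r x * q x))
    (hv : CubeC1 R v v1)
    (h0 : ∀ m c, c = R ∨ c = -R → ∀ y ∈ faceCube d R, v (facePt m c y) = 0) :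
    Integrable (fun x => (r x * q x * a (Fin.last d) (Fin.last d) x
      + q x * ∑ m, partialDerivOn R m (a m (Fin.last d)) x) * v x ^ 2
      + 2 * (q x * v x * conormal a v1 x)) (cubeMeasure d R) ∧
    ∫ x, (r x * q x * a (Fin.last d) (Fin.last d) x
      + q x * ∑ m, partialDerivOn R m (a m (Fin.last d)) x) * v x ^ 2
      + 2 * (q x * v x * conormal a v1 x) ∂cubeMeasure d R = 0 := by
  set n := Fin.last d with hn
  have hac := fun i j => ha.cubeC1 hR i j
  have hW : ∀ m, CubeC1 R (fun x => q x * a m n x * (v x * v x)) _ := fun m =>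
    (hq.mul (hac m n)).mul (hv.mul hv)
  refine integral_div_eq_zero hR hW (fun x _ => ?_) fun m c hc y hy => by
    rw [h0 m c hc y hy]; ring
  rw [show conormal a v1 x = ∑ k, a k n x * v1 k x from rfl]
  have e : ∀ m, ((if m = n then 1 else 0) * (r x * q x) * a m n x
      + q x * partialDerivOn R m (a m n) x) * (v x * v x)
      + q x * a m n x * (v1 m x * v x + v x * v1 m x)
      = (if m = n then (r x * q x) * a m n x * v x ^ 2 else 0)
        + q x * v x ^ 2 * partialDerivOn R m (a m n) x
        + 2 * q x * v x * (a m n x * v1 m x) := by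
    intro m
    by_cases h : m = n
    · simp only [h, if_true]; ring
    · simp only [h, if_false]; ring
  simp only [e]
  rw [Finset.sum_add_distrib, Finset.sum_add_distrib, ← Finset.mul_sum, ← Finset.mul_sum,
    Finset.sum_ite_eq' Finset.univ n]
  simp only [Finset.mem_univ, if_true]
  ring

end Divergence

/-! ### The Carleman estimate for smooth functions -/

section Smooth

variable {d : ℕ} {R μ₁ μ₂ M : ℝ} {a : Fin (d + 1) → Fin (d + 1) → Pt d → ℝ}

theorem Admissible.le_diag (ha : Admissible R μ₁ μ₂ M a) {x : Pt d} (hx : x ∈ closedCube d R)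
    (n : Fin (d + 1)) : μ₁ ≤ a n n x := by
  have := (ha.elliptic x hx (Pi.single n 1)).1
  simpa [Pi.single_apply] using this

/-- The factor in front of the multiplier `λ v`. -/
noncomputable def multiplierConst (d : ℕ) (μ₁ M : ℝ) : ℝ := (12 * M ^ 2 * (d + 1) ^ 2 + 2) / μ₁

/-- The factor of `v²` in the bound for the lower-order term of the multiplier identity. -/
noncomputable def lowerOrderConst (d : ℕ) (μ₁ M : ℝ) : ℝ :=
  (d + 1) * (multiplierConst d μ₁ M * M * (d + 1)) ^ 2 / 4

/-- The Carleman estimate for the conjugated operator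
`F = L v + λ² q² aₙₙ v - 2 λ q ∑ aₖₙ vₖ - λ q' aₙₙ v`, where `q' = r q` is the derivative of `q`
in the last variable. -/
theorem Admissible.carleman_conjugated (ha : Admissible R μ₁ μ₂ M a) (hR : 0 < R) (hμ : 0 < μ₁)
    {q r v F : Pt d → ℝ} {v1 : Fin (d + 1) → Pt d → ℝ} {v2 : Fin (d + 1) → Fin (d + 1) → Pt d → ℝ}
    {lam q₀ q₁ r₀ r₁ : ℝ}
    (hq : CubeC1 R q fun k x => (if k = Fin.last d then 1 else 0) * (r x * q x))
    (hv : CubeC1 R v v1) (hv1 : ∀ i, CubeC1 R (v1 i) (v2 i))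
    (hsym : ∀ x ∈ cube d R, ∀ i j, v2 i j x = v2 j i x)
    (h0 : ∀ m c, c = R ∨ c = -R → ∀ y ∈ faceCube d R, v (facePt m c y) = 0)
    (hb : ∀ m i c, c = R ∨ c = -R → i ≠ m → ∀ y ∈ faceCube d R, v1 i (facePt m c y) = 0)
    (hFc : ContinuousOn F (closedCube d R))
    (hF : ∀ x ∈ cube d R, F x = L0 a v2 x
      + lam ^ 2 * q x ^ 2 * a (Fin.last d) (Fin.last d) x * v x
      - 2 * lam * q x * conormal a v1 x
      - lam * (r x * q x) * a (Fin.last d) (Fin.last d) x * v x)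
    (hq₀ : 0 < q₀) (hqb : ∀ x ∈ cube d R, q₀ ≤ q x ∧ q x ≤ q₁)
    (hr₀ : 0 ≤ r₀) (hrb : ∀ x ∈ cube d R, r₀ ≤ r x ∧ r x ≤ r₁) (hlam : 1 ≤ lam)
    (hr₀' : 4 * (d + 1) * M ^ 2 + multiplierConst d μ₁ M * M + 1 ≤ 4 * r₀ * μ₁ ^ 2)
    (hlam' : 2 * (multiplierConst d μ₁ M * q₁ * ((d + 1) * M) + multiplierConst d μ₁ M ^ 2 / 4
      + q₁ * r₁ ^ 2 * M ^ 2 + lowerOrderConst d μ₁ M) ≤ lam * q₀ ^ 2) :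
    lam * ∫ x, ∑ i, v1 i x ^ 2 ∂cubeMeasure d R
      + lam ^ 3 * q₀ ^ 2 / 2 * ∫ x, v x ^ 2 ∂cubeMeasure d R
      ≤ (1 / q₀ + 1) * ∫ x, F x ^ 2 ∂cubeMeasure d R
        + 2 * lam * ∫ y, (a (Fin.last d) (Fin.last d) (facePt (Fin.last d) R y)
          * v1 (Fin.last d) (facePt (Fin.last d) R y)) ^ 2 ∂faceMeasure d R := by
  set n := Fin.last d with hn
  set K := multiplierConst d μ₁ M with hK
  set B₁ := lowerOrderConst d μ₁ M with hB
  have hKpos : 0 ≤ K := by rw [hK, multiplierConst]; positivity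
  have hKμ : K * μ₁ = 2 * (6 * M ^ 2 * (d + 1) ^ 2) + 2 := by
    rw [hK, multiplierConst]; field_simp; ring
  have hB0 : 0 ≤ B₁ := by rw [hB, lowerOrderConst]; positivity
  obtain ⟨i1, e1⟩ := ha.integral_rellich_le hR hv1 hsym hb
  obtain ⟨i2, e2⟩ := ha.integral_zeroth_order hR hq hv h0
  obtain ⟨i3, e3⟩ := ha.integral_energy hR hv hv1 h0
  obtain ⟨i4, e4⟩ := ha.integral_first_order hR hq hv h0
  have iG : Integrable (fun x => ∑ i, v1 i x ^ 2) (cubeMeasure d R) :=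
    integrable_of_continuousOn (continuousOn_finsetSum _ fun i _ => (hv1 i).cont.pow 2)
  have iv : Integrable (fun x => v x ^ 2) (cubeMeasure d R) :=
    integrable_of_continuousOn (hv.cont.pow 2)
  have iF : Integrable (fun x => F x ^ 2) (cubeMeasure d R) :=
    integrable_of_continuousOn (hFc.pow 2)
  have main := integral_mono_ae ((iG.const_mul lam).add (iv.const_mul (lam ^ 3 * q₀ ^ 2 / 2)))
    ((iF.const_mul (1 / q₀ + 1)).add ((((i1.const_mul (2 * lam)).add
      (i2.const_mul (2 * lam ^ 3))).add (i3.const_mul (K * lam))).sub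
        (i4.const_mul (K * lam ^ 2)))) (by
    filter_upwards [ae_mem_cube] with x hx
    have hx' := cube_subset_closedCube hx
    have hM : ∀ i j, |a i j x| ≤ M := fun i j => (ha.c1 i j).bound x hx'
    have hM' : ∀ i j k, |partialDerivOn R k (a i j) x| ≤ M := fun i j k =>
      (ha.c1 i j).bound_deriv x hx' k
    have hM0 : 0 ≤ M := (abs_nonneg _).trans (hM n n)
    have hprod : ∀ s t : ℝ, |s| ≤ M → |t| ≤ M → |s * t| ≤ M ^ 2 := fun s t hs ht => by
      rw [abs_mul, sq]; gcongr
    have hpair : ∀ s t s' t' : ℝ, |s| ≤ M → |t| ≤ M → |s'| ≤ M → |t'| ≤ M →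
        |s * t + s' * t'| ≤ 2 * M ^ 2 := fun s t s' t' h1 h2 h3 h4 => by
      have := (abs_add_le (s * t) (s' * t'))
      linarith [hprod s t h1 h2, hprod s' t' h3 h4]
    have hQ := abs_sum_cubic_le (B := 6 * M ^ 2) (by positivity) (c := fun m i k =>
      2 * (partialDerivOn R m (a i m) x * a k n x + a i m x * partialDerivOn R m (a k n) x)
      - (partialDerivOn R m (a m n) x * a i k x + a m n x * partialDerivOn R m (a i k) x))
      (fun m i k => by
        refine (abs_sub _ _).trans ?_
        rw [abs_mul, abs_two]
        linarith [hpair _ _ _ _ (hM' i m m) (hM k n) (hM i m) (hM' k n m),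
          hpair _ _ _ _ (hM' m n m) (hM i k) (hM m n) (hM' i k m)]) (fun i => v1 i x)
    have hD := mul_abs_sum_le (K := K) (M := M) hKpos
      (c := fun m i => partialDerivOn R m (a i m) x) (fun m i => hM' i m m) (fun i => v1 i x) (v x)
    have hγ : |∑ m, (partialDerivOn R m (a n n) x * a m n x
        + a n n x * partialDerivOn R m (a m n) x)| ≤ 2 * (d + 1) * M ^ 2 := by
      refine (Finset.abs_sum_le_sum_abs _ _).trans ?_
      refine (Finset.sum_le_sum fun m _ =>
        hpair _ _ _ _ (hM' n n m) (hM m n) (hM n n) (hM' m n m)).trans (le_of_eq ?_)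
      simp; ring
    have hδ : |∑ m, partialDerivOn R m (a m n) x| ≤ (d + 1) * M := by
      refine (Finset.abs_sum_le_sum_abs _ _).trans ?_
      refine (Finset.sum_le_sum fun m _ => hM' m n m).trans (le_of_eq ?_)
      simp
    simp only [Fintype.card_fin, Nat.cast_add, Nat.cast_one] at hQ hD
    exact carleman_scalar (hF x hx) hq₀ (hqb x hx).1 (hqb x hx).2 hr₀ (hrb x hx).1 (hrb x hx).2 hμ
      (ha.le_diag hx' n) ((le_abs_self _).trans (hM n n)) (by positivity) hKpos hlam hB0 hQ hγ hD
      (ha.elliptic x hx' fun i => v1 i x).1 hδ hKμ hr₀' hlam')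
  have j1 := i1.const_mul (2 * lam)
  have j2 := i2.const_mul (2 * lam ^ 3)
  have j3 := i3.const_mul (K * lam)
  have j4 := i4.const_mul (K * lam ^ 2)
  rw [integral_add' (iG.const_mul lam) (iv.const_mul _),
    integral_add' (iF.const_mul _) (((j1.add j2).add j3).sub j4),
    integral_sub' ((j1.add j2).add j3) j4, integral_add' (j1.add j2) j3, integral_add' j1 j2,
    integral_const_mul, integral_const_mul, integral_const_mul, integral_const_mul,
    integral_const_mul, integral_const_mul, integral_const_mul, e2, e3, e4] at main
  have hl : 0 ≤ 2 * lam := by linarith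
  linear_combination main + mul_le_mul_of_nonneg_left e1 hl

theorem CubeC1.of_zc {h h' : ℝ → ℝ} (hh : ∀ t ∈ Icc (-R) R, HasDerivAt h (h' t) t)
    (hc : ContinuousOn h' (Icc (-R) R)) :
    CubeC1 R (fun x : Pt d => h (zc x)) fun k x =>
      (if k = Fin.last d then 1 else 0) * h' (zc x) where
  cont := by
    have : ContinuousOn h (Icc (-R) R) := fun t ht => (hh t ht).continuousAt.continuousWithinAt
    exact this.comp (continuous_apply (Fin.last d)).continuousOn fun x hx =>
      mem_closedCube.1 hx _
  cont' k := by
    refine continuousOn_const.mul ?_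
    exact hc.comp (continuous_apply (Fin.last d)).continuousOn fun x hx =>
      mem_closedCube.1 hx _
  hasFDerivAt x hx := by
    have h1 := hh (zc x) (mem_closedCube.1 (cube_subset_closedCube hx) _)
    have h2 : HasFDerivAt (fun x : Pt d => zc x)
        (ContinuousLinearMap.proj (Fin.last d) : Pt d →L[ℝ] ℝ) x := hasFDerivAt_apply _ x
    refine (h1.comp_hasFDerivAt x h2).congr_fderiv ?_
    ext y
    simp [linForm_apply, mul_comm]

/-- The tangential derivatives of a smooth function that vanishes on the faces vanish there. -/
theorem partialDeriv_eq_zero_of_face {u : Pt d → ℝ} (hu : ContDiff ℝ ∞ u) {m i : Fin (d + 1)}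
    {c : ℝ} (h0 : ∀ x : Pt d, x m = c → u x = 0) (hi : i ≠ m) {x : Pt d} (hx : x m = c) :
    partialDeriv i u x = 0 := by
  have h1 : HasDerivAt (fun t : ℝ => u (x + t • Pi.single i 1)) (partialDeriv i u x) 0 := by
    have hl : HasDerivAt (fun t : ℝ => x + t • (Pi.single i 1 : Pt d)) (Pi.single i 1) 0 := by
      simpa using ((hasDerivAt_id (0 : ℝ)).smul_const (Pi.single i 1 : Pt d)).const_add x
    have hd : HasFDerivAt u (fderiv ℝ u x) (x + (0 : ℝ) • (Pi.single i 1 : Pt d)) := by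
      simpa using (hu.differentiable (by simp) x).hasFDerivAt
    exact hd.comp_hasDerivAt 0 hl
  have h2 : (fun t : ℝ => u (x + t • (Pi.single i 1 : Pt d))) = fun _ => 0 := by
    ext t
    refine h0 _ ?_
    simp [hi.symm, hx]
  rw [h2] at h1
  exact h1.unique (hasDerivAt_const _ _)

end Smooth

section SmoothEstimate

variable {d : ℕ} {R b μ₁ μ₂ M : ℝ} {a : Fin (d + 1) → Fin (d + 1) → Pt d → ℝ}

/-- The principal part of `e · u` when `∂ₙ e = λ q e`, `∂ₙ q = r q` and the other derivatives of `e`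
and `q` vanish. -/
theorem sum_conjugated {ι : Type*} [Fintype ι] [DecidableEq ι] (n : ι) (a u2 : ι → ι → ℝ)
    (u1 : ι → ℝ) (ha : ∀ i j, a i j = a j i) (u e q r lam : ℝ) :
    ∑ i, ∑ j, a i j * (u2 i j * e + u1 i * ((if j = n then 1 else 0) * (lam * (q * e)))
      + (u1 j * ((if i = n then 1 else 0) * (lam * (q * e)))
        + u * ((if i = n then 1 else 0) * (lam * ((if j = n then 1 else 0) * (r * q) * e
          + q * ((if j = n then 1 else 0) * (lam * (q * e))))))))
      = (∑ i, ∑ j, a i j * u2 i j) * e + 2 * lam * q * e * ∑ k, a k n * u1 k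
        + (lam * (r * q) + lam ^ 2 * q ^ 2) * e * u * a n n := by
  have e1 : ∀ i j, a i j * (u2 i j * e + u1 i * ((if j = n then 1 else 0) * (lam * (q * e)))
      + (u1 j * ((if i = n then 1 else 0) * (lam * (q * e)))
        + u * ((if i = n then 1 else 0) * (lam * ((if j = n then 1 else 0) * (r * q) * e
          + q * ((if j = n then 1 else 0) * (lam * (q * e))))))))
      = e * (a i j * u2 i j) + (if j = n then lam * q * e * (a i j * u1 i) else 0)
        + (if i = n then lam * q * e * (a i j * u1 j) else 0)
        + (if i = n then (if j = n then
          (lam * (r * q) + lam ^ 2 * q ^ 2) * e * u * a i j else 0) else 0) := by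
    intro i j
    split_ifs <;> ring
  have e2 : ∑ k, a n k * u1 k = ∑ k, a k n * u1 k :=
    Finset.sum_congr rfl fun k _ => by rw [ha n k]
  simp only [e1, Finset.sum_add_distrib]
  rw [Finset.sum_comm (f := fun i j => if i = n then lam * q * e * (a i j * u1 j) else 0),
    Finset.sum_comm (f := fun i j => if i = n then (if j = n then
          (lam * (r * q) + lam ^ 2 * q ^ 2) * e * u * a i j else 0) else 0)]
  simp only [Finset.sum_ite_eq', Finset.mem_univ, if_true, ← Finset.mul_sum, e2]
  ring

/-- The Carleman estimate for smooth functions that vanish on the boundary, with an additional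
term on the top face. The numbers `p (b ∓ R) ^ (p - 1)` are the extreme values of the derivative of
the phase `(z + b) ^ p`. -/
theorem Admissible.carleman_smooth (ha : Admissible R μ₁ μ₂ M a) (hR : 0 < R) (hb : R < b)
    (hμ : 0 < μ₁) {p lam q₀ q₁ C : ℝ} (hp : 1 < p)
    (hp' : 4 * (d + 1) * M ^ 2 + multiplierConst d μ₁ M * M + 1
      ≤ 4 * ((p - 1) / (b + R)) * μ₁ ^ 2)
    (hq₀ : q₀ = p * (b - R) ^ (p - 1)) (hq₁ : q₁ = p * (b + R) ^ (p - 1)) (hlam : 1 ≤ lam)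
    (hlam' : 2 * (multiplierConst d μ₁ M * q₁ * ((d + 1) * M) + multiplierConst d μ₁ M ^ 2 / 4
      + q₁ * ((p - 1) / (b - R)) ^ 2 * M ^ 2 + lowerOrderConst d μ₁ M) ≤ lam * q₀ ^ 2)
    (hC : C = 2 + 2 * (2 * q₁ ^ 2 + 1) / q₀ ^ 2) {u : Pt d → ℝ} (hu : ContDiff ℝ ∞ u)
    (h0 : ∀ x i, x i = R ∨ x i = -R → u x = 0) :
    lam * ∫ x, ((∑ i, partialDeriv i u x ^ 2) + lam ^ 2 * u x ^ 2) * weight b lam p x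
        ∂cubeMeasure d R
      ≤ C * ((1 / q₀ + 1) * ∫ x, L0 a (fun i j => partialDeriv j (partialDeriv i u)) x ^ 2
          * weight b lam p x ∂cubeMeasure d R
        + 2 * lam * (M ^ 2 * Real.exp (2 * lam * (R + b) ^ p)
          * ∫ y, partialDeriv (Fin.last d) u (facePt (Fin.last d) R y) ^ 2 ∂faceMeasure d R)) := by
  set n := Fin.last d with hn
  have hbR : 0 < b - R := by linarith
  have hbR' : 0 < b + R := by linarith
  have hq0pos : 0 < q₀ := by rw [hq₀]; positivity
  have hpos : ∀ t ∈ Icc (-R) R, 0 < t + b := fun t ht => by linarith [ht.1]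
  let e : Pt d → ℝ := fun x => Real.exp (lam * (zc x + b) ^ p)
  let q : Pt d → ℝ := fun x => p * (zc x + b) ^ (p - 1)
  let r : Pt d → ℝ := fun x => (p - 1) / (zc x + b)
  -- The phase, its derivative and the exponential weight.
  have dq : ∀ t ∈ Icc (-R) R, HasDerivAt (fun t => p * (t + b) ^ (p - 1))
      ((p - 1) / (t + b) * (p * (t + b) ^ (p - 1))) t := by
    intro t ht
    have h1 := (((hasDerivAt_id t).add_const b).rpow_const (p := p - 1)
      (Or.inl (hpos t ht).ne')).const_mul p
    refine h1.congr_deriv ?_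
    rw [id, Real.rpow_sub_one (hpos t ht).ne']
    have := (hpos t ht).ne'
    field_simp
  have de : ∀ t ∈ Icc (-R) R, HasDerivAt (fun t => Real.exp (lam * (t + b) ^ p))
      (lam * (p * (t + b) ^ (p - 1) * Real.exp (lam * (t + b) ^ p))) t := by
    intro t ht
    have h1 := ((((hasDerivAt_id t).add_const b).rpow_const (p := p)
      (Or.inl (hpos t ht).ne')).const_mul lam).exp
    refine h1.congr_deriv ?_
    simp only [id]
    ring
  have cq : ContinuousOn (fun t => p * (t + b) ^ (p - 1)) (Icc (-R) R) := fun t ht =>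
    (dq t ht).continuousAt.continuousWithinAt
  have ce : ContinuousOn (fun t => Real.exp (lam * (t + b) ^ p)) (Icc (-R) R) := fun t ht =>
    (de t ht).continuousAt.continuousWithinAt
  have cr : ContinuousOn (fun t => (p - 1) / (t + b)) (Icc (-R) R) :=
    continuousOn_const.div (by fun_prop) fun t ht => (hpos t ht).ne'
  have hq : CubeC1 R q fun k x => (if k = n then 1 else 0) * (r x * q x) :=
    CubeC1.of_zc dq (cr.mul cq)
  have he : CubeC1 R e fun k x => (if k = n then 1 else 0) * (lam * (q x * e x)) :=
    CubeC1.of_zc de (continuousOn_const.mul (cq.mul ce))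
  have hu0 : CubeC1 R u fun k => partialDeriv k u := CubeC1.of_contDiff (by simp) hu
  have hu1 : ∀ i, CubeC1 R (partialDeriv i u) fun k => partialDeriv k (partialDeriv i u) :=
    fun i => CubeC1.of_contDiff (by simp) (contDiff_partialDeriv hu i)
  have hv := hu0.mul he
  have hv1 : ∀ i, CubeC1 R (fun x => partialDeriv i u x * e x
      + u x * ((if i = n then 1 else 0) * (lam * (q x * e x)))) _ := fun i =>
    ((hu1 i).mul he).add (hu0.mul (((hq.mul he).const_mul lam).const_mul (if i = n then 1 else 0)))
  have hzc : ∀ x ∈ cube d R, -R < zc x ∧ zc x < R := fun x hx => mem_cube.1 hx _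
  have qb : ∀ x ∈ cube d R, q₀ ≤ q x ∧ q x ≤ q₁ := by
    intro x hx
    have hz := hzc x hx
    rw [hq₀, hq₁]
    constructor
    · exact mul_le_mul_of_nonneg_left
        (Real.rpow_le_rpow (by linarith) (by linarith) (by linarith)) (by linarith)
    · exact mul_le_mul_of_nonneg_left
        (Real.rpow_le_rpow (by linarith) (by linarith) (by linarith)) (by linarith)
  have rb : ∀ x ∈ cube d R, (p - 1) / (b + R) ≤ r x ∧ r x ≤ (p - 1) / (b - R) := by
    intro x hx
    have hz := hzc x hx
    constructor
    · exact div_le_div_of_nonneg_left (by linarith) (by linarith) (by linarith)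
    · exact div_le_div_of_nonneg_left (by linarith) (by linarith) (by linarith)
  have face0 : ∀ m c, c = R ∨ c = -R → ∀ y : Fin d → ℝ, u (facePt m c y) = 0 := fun m c hc y =>
    h0 _ m (by simpa [facePt] using hc)
  have cL : ContinuousOn (fun x => L0 a (fun i j => partialDeriv j (partialDeriv i u)) x)
      (closedCube d R) :=
    continuousOn_finsetSum _ fun i _ => continuousOn_finsetSum _ fun j _ =>
      (ha.cubeC1 hR i j).cont.mul ((hu1 i).cont' j)
  have key := ha.carleman_conjugated hR hμ hq hv hv1 (lam := lam) (q₀ := q₀) (q₁ := q₁)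
    (r₀ := (p - 1) / (b + R)) (r₁ := (p - 1) / (b - R))
    (F := fun x => L0 a (fun i j => partialDeriv j (partialDeriv i u)) x * e x)
    (fun x _ i j => by
      rw [partialDeriv_comm hu j i x]
      ring)
    (fun m c hc y _ => by rw [face0 m c hc y, zero_mul])
    (fun m i c hc hi y _ => by
      rw [face0 m c hc y, partialDeriv_eq_zero_of_face hu (m := m) (c := c)
        (fun x hx => h0 x m (by rcases hc with rfl | rfl <;> simp [hx])) hi (by simp [facePt])]
      ring)
    (cL.mul he.cont)
    (fun x hx => by
      have hs := sum_conjugated n (fun i j => a i j x)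
        (fun i j => partialDeriv j (partialDeriv i u) x) (fun i => partialDeriv i u x)
        (ha.symm x (cube_subset_closedCube hx)) (u x) (e x) (q x) (r x) lam
      have hT : conormal a (fun k x => partialDeriv k u x * e x
          + u x * ((if k = n then 1 else 0) * (lam * (q x * e x)))) x
          = e x * (∑ k, a k n x * partialDeriv k u x) + lam * q x * e x * u x * a n n x := by
        have e1 : ∀ k, a k n x * (partialDeriv k u x * e x
            + u x * ((if k = n then 1 else 0) * (lam * (q x * e x))))
            = e x * (a k n x * partialDeriv k u x)
              + (if k = n then lam * q x * e x * u x * a k n x else 0) := fun k => by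
          split_ifs <;> ring
        rw [conormal]
        simp only [← hn, e1, Finset.sum_add_distrib, ← Finset.mul_sum, Finset.sum_ite_eq',
          Finset.mem_univ, if_true]
      rw [hT]
      simp only [L0]
      rw [hs]
      ring)
    hq0pos qb (div_nonneg (by linarith) hbR'.le) rb hlam hp' hlam'
  have hwt : ∀ x : Pt d, weight b lam p x = e x ^ 2 := fun x => by
    rw [weight, ← Real.exp_nat_mul]; congr 1; push_cast; ring
  have hl : 0 < lam := by linarith
  -- Return from `v = e u` to `u` in the volume terms.
  have hCpos : 0 < C := by rw [hC]; positivity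
  have iG : Integrable (fun x => ∑ i, (partialDeriv i u x * e x
      + u x * ((if i = n then 1 else 0) * (lam * (q x * e x)))) ^ 2) (cubeMeasure d R) :=
    integrable_of_continuousOn (continuousOn_finsetSum _ fun i _ => (hv1 i).cont.pow 2)
  have iv : Integrable (fun x => (u x * e x) ^ 2) (cubeMeasure d R) :=
    integrable_of_continuousOn (hv.cont.pow 2)
  have vol : ∫ x, ((∑ i, partialDeriv i u x ^ 2) + lam ^ 2 * u x ^ 2) * weight b lam p x
        ∂cubeMeasure d R
      ≤ ∫ x, C * (∑ i, (partialDeriv i u x * e x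
          + u x * ((if i = n then 1 else 0) * (lam * (q x * e x)))) ^ 2)
          + C * (lam ^ 2 * q₀ ^ 2 / 2) * (u x * e x) ^ 2 ∂cubeMeasure d R := by
    refine integral_mono_ae ?_ ((iG.const_mul C).add (iv.const_mul _)) ?_
    · simp only [hwt]
      refine integrable_of_continuousOn (ContinuousOn.mul ?_ (he.cont.pow 2))
      exact (continuousOn_finsetSum _ fun i _ => (hu1 i).cont.pow 2).add
        (continuousOn_const.mul (hu0.cont.pow 2))
    · filter_upwards [ae_mem_cube] with x hx
      rw [hwt]
      have h1 : ∀ i, (partialDeriv i u x * e x) ^ 2 ≤ 2 * (partialDeriv i u x * e x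
          + u x * ((if i = n then 1 else 0) * (lam * (q x * e x)))) ^ 2
          + (if i = n then 2 * (lam * q x * (u x * e x)) ^ 2 else 0) := by
        intro i
        split_ifs
        · nlinarith [sq_nonneg (partialDeriv i u x * e x + 2 * (lam * q x * (u x * e x)))]
        · nlinarith [sq_nonneg (partialDeriv i u x * e x)]
      have h2 := Finset.sum_le_sum fun i (_ : i ∈ Finset.univ) => h1 i
      rw [Finset.sum_add_distrib, ← Finset.mul_sum, Finset.sum_ite_eq' Finset.univ n,
        if_pos (Finset.mem_univ n)] at h2
      have h3 : 2 * (lam * q x * (u x * e x)) ^ 2 ≤ 2 * q₁ ^ 2 * lam ^ 2 * (u x * e x) ^ 2 := by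
        have hqx := qb x hx
        have : q x ^ 2 ≤ q₁ ^ 2 := pow_le_pow_left₀ (hq0pos.le.trans hqx.1) hqx.2 2
        have h4 : 0 ≤ 2 * lam ^ 2 * (u x * e x) ^ 2 := by positivity
        linear_combination mul_le_mul_of_nonneg_left this h4
      have h5 : (2 * q₁ ^ 2 + 1) * (lam ^ 2 * (u x * e x) ^ 2)
          ≤ C * (lam ^ 2 * q₀ ^ 2 / 2) * (u x * e x) ^ 2 := by
        have : 2 * q₁ ^ 2 + 1 ≤ C * (q₀ ^ 2 / 2) := by
          have : (2 + 2 * (2 * q₁ ^ 2 + 1) / q₀ ^ 2) * (q₀ ^ 2 / 2)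
              = q₀ ^ 2 + (2 * q₁ ^ 2 + 1) := by field_simp
          rw [hC, this]
          linarith [sq_nonneg q₀]
        have h6 : 0 ≤ lam ^ 2 * (u x * e x) ^ 2 := by positivity
        linear_combination mul_le_mul_of_nonneg_right this h6
      have h7 : 0 ≤ ∑ i, (partialDeriv i u x * e x
          + u x * ((if i = n then 1 else 0) * (lam * (q x * e x)))) ^ 2 :=
        Finset.sum_nonneg fun _ _ => sq_nonneg _
      have h8 : 2 ≤ C := by rw [hC]; linarith [show 0 ≤ 2 * (2 * q₁ ^ 2 + 1) / q₀ ^ 2 by positivity]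
      have h9 : (∑ i, partialDeriv i u x ^ 2) * e x ^ 2 = ∑ i, (partialDeriv i u x * e x) ^ 2 := by
        rw [Finset.sum_mul]; exact Finset.sum_congr rfl fun i _ => by ring
      have h10 := mul_le_mul_of_nonneg_right h8 h7
      linear_combination h2 + h3 + h5 + h10 + h9
  rw [integral_add (iG.const_mul C) (iv.const_mul _), integral_const_mul, integral_const_mul] at vol
  -- The boundary term on the top face, where `v = 0` gives `∂ₙ v = e ∂ₙ u`.
  have top : ∫ y, (a n n (facePt n R y) * (partialDeriv n u (facePt n R y) * e (facePt n R y)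
        + u (facePt n R y) * ((if n = n then 1 else 0) * (lam * (q (facePt n R y)
          * e (facePt n R y)))))) ^ 2 ∂faceMeasure d R
      ≤ M ^ 2 * Real.exp (2 * lam * (R + b) ^ p)
          * ∫ y, partialDeriv n u (facePt n R y) ^ 2 ∂faceMeasure d R := by
    rw [← integral_const_mul]
    refine integral_mono_of_nonneg (.of_forall fun _ => sq_nonneg _) ?_ ?_
    · refine Integrable.const_mul ?_ _
      exact memLp_one_iff_integrable.1 (memLp_face
        (((contDiff_partialDeriv hu n).continuous.comp (continuous_facePt n R)).pow 2))
    · filter_upwards [ae_mem_faceCube] with y hy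
      have hM := (ha.c1 n n).bound _ (facePt_mem_closedCube hR (Or.inl rfl) (i := n) hy)
      have hw := hwt (facePt n R y)
      rw [weight, show zc (facePt n R y) = R by simp [zc, facePt, hn]] at hw
      rw [face0 n R (Or.inl rfl) y, zero_mul, add_zero, hw, mul_pow, mul_pow]
      have : a n n (facePt n R y) ^ 2 ≤ M ^ 2 := sq_le_sq' (abs_le.1 hM).1 (abs_le.1 hM).2
      have h4 : 0 ≤ partialDeriv n u (facePt n R y) ^ 2 * e (facePt n R y) ^ 2 := by positivity
      linear_combination mul_le_mul_of_nonneg_right this h4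
  have hF : ∫ x, (L0 a (fun i j => partialDeriv j (partialDeriv i u)) x * e x) ^ 2 ∂cubeMeasure d R
      = ∫ x, L0 a (fun i j => partialDeriv j (partialDeriv i u)) x ^ 2 * weight b lam p x
        ∂cubeMeasure d R := by
    simp only [hwt, mul_pow]
  rw [hF] at key
  linear_combination lam * vol + C * key + 2 * lam * C * top

end SmoothEstimate

/-! ### Passage to the limit -/

section Limit

variable {d : ℕ} {R b μ₁ μ₂ M : ℝ} {a : Fin (d + 1) → Fin (d + 1) → Pt d → ℝ}

theorem memLp_continuousOn_mul {c f : Pt d → ℝ} (hc : ContinuousOn c (closedCube d R))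
    (hf : MemLp f 2 (cubeMeasure d R)) : MemLp (fun x => c x * f x) 2 (cubeMeasure d R) := by
  obtain ⟨C, hC⟩ := isCompact_closedCube.exists_bound_of_continuousOn hc
  refine hf.of_le_mul (c := C) ((integrable_of_continuousOn hc).1.mul hf.1) ?_
  filter_upwards [ae_mem_cube] with x hx
  rw [norm_mul]
  gcongr
  exact hC x (cube_subset_closedCube hx)

theorem tendsto_continuousOn_mul {c f : Pt d → ℝ} {F : ℕ → Pt d → ℝ}
    (hc : ContinuousOn c (closedCube d R))
    (h : Tendsto (fun N => eLpNorm (fun x => F N x - f x) 2 (cubeMeasure d R)) atTop (𝓝 0)) :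
    Tendsto (fun N => eLpNorm (fun x => c x * F N x - c x * f x) 2 (cubeMeasure d R)) atTop
      (𝓝 0) := by
  obtain ⟨C, hC⟩ := isCompact_closedCube.exists_bound_of_continuousOn hc
  have hb : ∀ N, eLpNorm (fun x => c x * F N x - c x * f x) 2 (cubeMeasure d R)
      ≤ ENNReal.ofReal C * eLpNorm (fun x => F N x - f x) 2 (cubeMeasure d R) := by
    intro N
    refine eLpNorm_le_mul_eLpNorm_of_ae_le_mul ?_ 2
    filter_upwards [ae_mem_cube] with x hx
    rw [← mul_sub, norm_mul]
    gcongr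
    exact hC x (cube_subset_closedCube hx)
  refine tendsto_of_tendsto_of_tendsto_of_le_of_le tendsto_const_nhds ?_ (fun _ => zero_le) hb
  simpa using ENNReal.Tendsto.const_mul h (Or.inr ENNReal.ofReal_ne_top)

theorem tendsto_eLpNorm_sum {α ι : Type*} {m : MeasurableSpace α} {μ : Measure α} (s : Finset ι)
    {F : ι → ℕ → α → ℝ} {f : ι → α → ℝ} (hF : ∀ i N, MemLp (F i N) 2 μ) (hf : ∀ i, MemLp (f i) 2 μ)
    (h : ∀ i, Tendsto (fun N => eLpNorm (fun x => F i N x - f i x) 2 μ) atTop (𝓝 0)) :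
    Tendsto (fun N => eLpNorm (fun x => ∑ i ∈ s, F i N x - ∑ i ∈ s, f i x) 2 μ) atTop (𝓝 0) := by
  have hb : ∀ N, eLpNorm (fun x => ∑ i ∈ s, F i N x - ∑ i ∈ s, f i x) 2 μ
      ≤ ∑ i ∈ s, eLpNorm (fun x => F i N x - f i x) 2 μ := by
    intro N
    have := eLpNorm_sum_le (μ := μ) (p := 2) (s := s) (f := fun i x => F i N x - f i x)
      (fun i _ => ((hF i N).sub (hf i)).1) (by norm_num)
    convert this using 2
    ext x
    simp [Finset.sum_sub_distrib]
  refine tendsto_of_tendsto_of_tendsto_of_le_of_le tendsto_const_nhds ?_ (fun _ => zero_le) hb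
  simpa using tendsto_finsetSum s fun i _ => h i

theorem continuousOn_weight (hb : R < b) (lam p : ℝ) :
    ContinuousOn (weight b lam p) (closedCube d R) := by
  have hz : ContinuousOn (fun x : Pt d => zc x + b) (closedCube d R) :=
    ((continuous_apply (Fin.last d)).add continuous_const).continuousOn
  refine Real.continuous_exp.comp_continuousOn (continuousOn_const.mul ?_)
  refine hz.rpow_const fun x hx => Or.inl ?_
  have := (mem_closedCube.1 hx (Fin.last d)).1
  simp only [zc]
  linarith

theorem tendsto_integral_sq_mul_weight (hb : R < b) (lam p : ℝ) {F : ℕ → Pt d → ℝ} {f : Pt d → ℝ}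
    (hF : ∀ N, MemLp (F N) 2 (cubeMeasure d R)) (hf : MemLp f 2 (cubeMeasure d R))
    (h : Tendsto (fun N => eLpNorm (fun x => F N x - f x) 2 (cubeMeasure d R)) atTop (𝓝 0)) :
    Tendsto (fun N => ∫ x, F N x ^ 2 * weight b lam p x ∂cubeMeasure d R) atTop
      (𝓝 (∫ x, f x ^ 2 * weight b lam p x ∂cubeMeasure d R)) := by
  have hw := continuousOn_weight (d := d) hb lam p
  have e : ∀ g : Pt d → ℝ, ∫ x, g x ^ 2 * weight b lam p x ∂cubeMeasure d R
      = ∫ x, (weight b lam p x * g x) * g x ∂cubeMeasure d R := fun g =>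
    integral_congr_ae (.of_forall fun x => by ring)
  simp only [e]
  exact tendsto_integral_mul (fun N => memLp_continuousOn_mul hw (hF N)) hF
    (memLp_continuousOn_mul hw hf) hf (tendsto_continuousOn_mul hw h) h

theorem integrable_sq_mul_weight (hb : R < b) (lam p : ℝ) {f : Pt d → ℝ}
    (hf : MemLp f 2 (cubeMeasure d R)) :
    Integrable (fun x => f x ^ 2 * weight b lam p x) (cubeMeasure d R) := by
  refine (integrable_mul_of_memLp
    (memLp_continuousOn_mul (continuousOn_weight hb lam p) hf) hf).congr (.of_forall fun x => ?_)
  ring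

theorem integral_energy_eq (hb : R < b) (lam p : ℝ) {f : Pt d → ℝ} {g : Fin (d + 1) → Pt d → ℝ}
    (hf : MemLp f 2 (cubeMeasure d R)) (hg : ∀ i, MemLp (g i) 2 (cubeMeasure d R)) :
    Integrable (fun x => ((∑ i, g i x ^ 2) + lam ^ 2 * f x ^ 2) * weight b lam p x)
      (cubeMeasure d R) ∧
    ∫ x, ((∑ i, g i x ^ 2) + lam ^ 2 * f x ^ 2) * weight b lam p x ∂cubeMeasure d R
      = ∑ i, ∫ x, g i x ^ 2 * weight b lam p x ∂cubeMeasure d R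
        + lam ^ 2 * ∫ x, f x ^ 2 * weight b lam p x ∂cubeMeasure d R := by
  have i1 := fun i => integrable_sq_mul_weight hb lam p (hg i)
  have i2 := (integrable_sq_mul_weight hb lam p hf).const_mul (lam ^ 2)
  have i3 := integrable_finsetSum Finset.univ fun i _ => i1 i
  have e : (fun x => ((∑ i, g i x ^ 2) + lam ^ 2 * f x ^ 2) * weight b lam p x)
      = fun x => (∑ i, g i x ^ 2 * weight b lam p x)
        + lam ^ 2 * (f x ^ 2 * weight b lam p x) := by
    ext x; rw [add_mul, Finset.sum_mul, mul_assoc]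
  rw [e]
  exact ⟨i3.add i2, by
    rw [integral_add i3 i2, integral_finsetSum _ fun i _ => i1 i, integral_const_mul]⟩

theorem Admissible.memLp_L0 (ha : Admissible R μ₁ μ₂ M a)
    {w : Fin (d + 1) → Fin (d + 1) → Pt d → ℝ} (hw : ∀ i j, MemLp (w i j) 2 (cubeMeasure d R)) :
    MemLp (L0 a w) 2 (cubeMeasure d R) :=
  memLp_finsetSum _ fun i _ => memLp_finsetSum _ fun j _ =>
    memLp_continuousOn_mul (ha.c1 i j).contDiffOn.continuousOn (hw i j)

theorem Admissible.tendsto_L0 (ha : Admissible R μ₁ μ₂ M a)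
    {w : Fin (d + 1) → Fin (d + 1) → Pt d → ℝ}
    {W : ℕ → Fin (d + 1) → Fin (d + 1) → Pt d → ℝ} (hw : ∀ i j, MemLp (w i j) 2 (cubeMeasure d R))
    (hW : ∀ N i j, MemLp (W N i j) 2 (cubeMeasure d R))
    (h : ∀ i j, Tendsto (fun N => eLpNorm (fun x => W N i j x - w i j x) 2 (cubeMeasure d R)) atTop
      (𝓝 0)) :
    Tendsto (fun N => eLpNorm (fun x => L0 a (W N) x - L0 a w x) 2 (cubeMeasure d R)) atTop
      (𝓝 0) := by
  have hc : ∀ i j, ContinuousOn (a i j) (closedCube d R) := fun i j =>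
    (ha.c1 i j).contDiffOn.continuousOn
  have m1 : ∀ i j N, MemLp (fun x => a i j x * W N i j x) 2 (cubeMeasure d R) := fun i j N =>
    memLp_continuousOn_mul (hc i j) (hW N i j)
  have m2 : ∀ i j, MemLp (fun x => a i j x * w i j x) 2 (cubeMeasure d R) := fun i j =>
    memLp_continuousOn_mul (hc i j) (hw i j)
  exact tendsto_eLpNorm_sum Finset.univ (fun i N => memLp_finsetSum _ fun j _ => m1 i j N)
    (fun i => memLp_finsetSum _ fun j _ => m2 i j) fun i =>
    tendsto_eLpNorm_sum Finset.univ (m1 i) (m2 i) fun j => tendsto_continuousOn_mul (hc i j) (h i j)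

/-- The Carleman estimate in `H²` for large `λ`, with a threshold that depends on `p`. -/
theorem Admissible.carleman_large (ha : Admissible R μ₁ μ₂ M a) (hR : 0 < R) (hb : R < b)
    (hμ : 0 < μ₁) {p lam q₀ q₁ C : ℝ} (hp : 1 < p)
    (hp' : 4 * (d + 1) * M ^ 2 + multiplierConst d μ₁ M * M + 1
      ≤ 4 * ((p - 1) / (b + R)) * μ₁ ^ 2)
    (hq₀ : q₀ = p * (b - R) ^ (p - 1)) (hq₁ : q₁ = p * (b + R) ^ (p - 1)) (hlam : 1 ≤ lam)
    (hlam' : 2 * (multiplierConst d μ₁ M * q₁ * ((d + 1) * M) + multiplierConst d μ₁ M ^ 2 / 4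
      + q₁ * ((p - 1) / (b - R)) ^ 2 * M ^ 2 + lowerOrderConst d μ₁ M) ≤ lam * q₀ ^ 2)
    (hC : C = 2 + 2 * (2 * q₁ ^ 2 + 1) / q₀ ^ 2) {u : Pt d → ℝ} {Du : Fin (d + 1) → Pt d → ℝ}
    {D2u : Fin (d + 1) → Fin (d + 1) → Pt d → ℝ} (hu : MemH2ZeroSharp R u Du D2u) :
    lam * ∫ x, ((∑ i, Du i x ^ 2) + lam ^ 2 * u x ^ 2) * weight b lam p x ∂cubeMeasure d R
      ≤ C * ((1 / q₀ + 1) * ∫ x, L0 a D2u x ^ 2 * weight b lam p x ∂cubeMeasure d R) := by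
  obtain ⟨U, cU, U0, l0, l1, l2, lt⟩ := hu.exists_smooth_approx hR
  have mu := hu.h2.h1.memLp
  have mDu := hu.h2.h1.memLp_deriv
  have mD2u : ∀ i j, MemLp (D2u i j) 2 (cubeMeasure d R) := fun i => (hu.h2.h1_deriv i).memLp_deriv
  have c1 : ∀ N i, ContDiff ℝ ∞ (partialDeriv i (U N)) := fun N i => contDiff_partialDeriv (cU N) i
  have m2 : ∀ N i j, MemLp (partialDeriv j (partialDeriv i (U N))) 2 (cubeMeasure d R) :=
    fun N i j => memLp_smooth (contDiff_partialDeriv (c1 N i) j)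
  have tl : Tendsto (fun N => lam * ∫ x, ((∑ i, partialDeriv i (U N) x ^ 2)
      + lam ^ 2 * U N x ^ 2) * weight b lam p x ∂cubeMeasure d R) atTop
      (𝓝 (lam * ∫ x, ((∑ i, Du i x ^ 2) + lam ^ 2 * u x ^ 2) * weight b lam p x
        ∂cubeMeasure d R)) := by
    refine Tendsto.const_mul lam ?_
    rw [(integral_energy_eq hb lam p mu mDu).2]
    simp only [fun N => (integral_energy_eq (R := R) hb lam p (memLp_smooth (cU N))
      fun i => memLp_smooth (c1 N i)).2]
    refine Tendsto.add (tendsto_finsetSum _ fun i _ => ?_) (Tendsto.const_mul _ ?_)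
    · exact tendsto_integral_sq_mul_weight hb lam p (fun N => memLp_smooth (c1 N i)) (mDu i) (l1 i)
    · exact tendsto_integral_sq_mul_weight hb lam p (fun N => memLp_smooth (cU N)) mu l0
  have tL := tendsto_integral_sq_mul_weight hb lam p (fun N => ha.memLp_L0 (m2 N))
    (ha.memLp_L0 mD2u) (ha.tendsto_L0 mD2u m2 l2)
  have tr := ((tL.const_mul (1 / q₀ + 1)).add
    ((lt.const_mul (M ^ 2 * Real.exp (2 * lam * (R + b) ^ p))).const_mul (2 * lam))).const_mul C
  rw [mul_zero, mul_zero, add_zero] at tr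
  exact le_of_tendsto_of_tendsto' tl tr fun N =>
    ha.carleman_smooth hR hb hμ hp hp' hq₀ hq₁ hlam hlam' hC (cU N) (U0 N)

end Limit

end CarlemanCube

/-- Carleman estimate on the cube `Ω = (-R, R)ⁿ`, `n = d + 1`. The numbers `p₀`, `lam₀` and `C₂ p`
are chosen before the coefficients `a`, hence depend only on `n, R, b, μ₁, μ₂`, on the bound `M` for
the `C¹` norms of the coefficients, and (only `C₂`) on `p`. -/
theorem theorem4p1 (d : ℕ) (R b μ₁ μ₂ M : ℝ) (hR : 0 < R) (hb : R < b)
    (hμ₁ : 0 < μ₁) (hμ : μ₁ ≤ μ₂) :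
    ∃ p₀ lam₀ : ℝ, 1 < p₀ ∧ 1 ≤ lam₀ ∧ ∃ C₂ : ℝ → ℝ, (∀ p, p₀ ≤ p → 0 < C₂ p) ∧
      ∀ a : Fin (d + 1) → Fin (d + 1) → CarlemanCube.Pt d → ℝ,
        CarlemanCube.Admissible R μ₁ μ₂ M a →
      ∀ lam p : ℝ, lam₀ ≤ lam → p₀ ≤ p →
      ∀ (u : CarlemanCube.Pt d → ℝ) (Du : Fin (d + 1) → CarlemanCube.Pt d → ℝ)
        (D2u : Fin (d + 1) → Fin (d + 1) → CarlemanCube.Pt d → ℝ),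
        CarlemanCube.MemH2ZeroSharp R u Du D2u →
        C₂ p * lam * ∫ x, ((∑ i, Du i x ^ 2) + lam ^ 2 * u x ^ 2) * CarlemanCube.weight b lam p x
            ∂CarlemanCube.cubeMeasure d R
          ≤ ∫ x, CarlemanCube.L0 a D2u x ^ 2 * CarlemanCube.weight b lam p x
            ∂CarlemanCube.cubeMeasure d R := by
  open CarlemanCube in
  have hbR : 0 < b - R := by linarith
  have hbR' : 0 < b + R := by linarith
  set K := multiplierConst d μ₁ M with hK
  have hK0 : 0 ≤ K := by rw [hK, multiplierConst]; positivity
  set S := 4 * (d + 1) * M ^ 2 + K * |M| + 1 with hS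
  have hS0 : 0 < S := by positivity
  let q₀ : ℝ → ℝ := fun p => p * (b - R) ^ (p - 1)
  let q₁ : ℝ → ℝ := fun p => p * (b + R) ^ (p - 1)
  -- Above `Λ p` the estimate holds with the constant `1 / D p`; below, it follows from the estimate
  -- with `lam = Λ p`, because there the weights lie between `1` and `E p`.
  let Λ : ℝ → ℝ := fun p => max 1 (2 * (K * q₁ p * ((d + 1) * M) + K ^ 2 / 4
    + q₁ p * ((p - 1) / (b - R)) ^ 2 * M ^ 2 + lowerOrderConst d μ₁ M) / q₀ p ^ 2)
  let D : ℝ → ℝ := fun p => (2 + 2 * (2 * q₁ p ^ 2 + 1) / q₀ p ^ 2) * (1 / q₀ p + 1)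
  let E : ℝ → ℝ := fun p => Real.exp (2 * Λ p * (b + R) ^ p)
  have hq0 : ∀ p, 1 < p → 0 < q₀ p := fun p hp =>
    mul_pos (by linarith) (Real.rpow_pos_of_pos hbR _)
  have hD : ∀ p, 1 < p → 0 < D p := fun p hp => by
    have := hq0 p hp
    simp only [D]; positivity
  have hp₀ : 1 < 2 + S * (b + R) / (4 * μ₁ ^ 2) := by
    have : 0 ≤ S * (b + R) / (4 * μ₁ ^ 2) := by positivity
    linarith
  refine ⟨2 + S * (b + R) / (4 * μ₁ ^ 2), 1, hp₀, le_rfl, fun p => 1 / (D p * E p),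
    fun p hp => ?_, fun a ha lam p hlam hp u Du D2u hu => ?_⟩
  · exact one_div_pos.2 (mul_pos (hD p (hp₀.trans_le hp)) (Real.exp_pos _))
  have hp1 : 1 < p := hp₀.trans_le hp
  have hq0p := hq0 p hp1
  have hDp := hD p hp1
  have hE1 : 1 ≤ E p := by
    refine Real.one_le_exp ?_
    have : 1 ≤ Λ p := le_max_left _ _
    positivity
  have hp' : 4 * (d + 1) * M ^ 2 + K * M + 1 ≤ 4 * ((p - 1) / (b + R)) * μ₁ ^ 2 := by
    have h1 : S ≤ 4 * ((p - 1) / (b + R)) * μ₁ ^ 2 := by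
      have h2 : S * (b + R) / (4 * μ₁ ^ 2) ≤ p - 1 := by linarith
      rw [div_le_iff₀ (by positivity)] at h2
      rw [show 4 * ((p - 1) / (b + R)) * μ₁ ^ 2 = (p - 1) * (4 * μ₁ ^ 2) / (b + R) by ring,
        le_div_iff₀ hbR']
      exact h2
    have := mul_le_mul_of_nonneg_left (le_abs_self M) hK0
    linarith
  have hlarge : ∀ lam, Λ p ≤ lam →
      lam * ∫ x, ((∑ i, Du i x ^ 2) + lam ^ 2 * u x ^ 2) * weight b lam p x ∂cubeMeasure d R
        ≤ D p * ∫ x, L0 a D2u x ^ 2 * weight b lam p x ∂cubeMeasure d R := by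
    intro lam hl
    have h1 : 1 ≤ lam := (le_max_left _ _).trans hl
    have h2 := (le_max_right _ _).trans hl
    rw [div_le_iff₀ (by positivity)] at h2
    have := ha.carleman_large hR hb hμ₁ hp1 hp' (q₀ := q₀ p) (q₁ := q₁ p) rfl rfl h1 h2 rfl hu
    simpa only [D, mul_assoc] using this
  have mu := hu.h2.h1.memLp
  have mDu := hu.h2.h1.memLp_deriv
  have mL := ha.memLp_L0 fun i => (hu.h2.h1_deriv i).memLp_deriv
  have hL0 : 0 ≤ ∫ x, L0 a D2u x ^ 2 * weight b lam p x ∂cubeMeasure d R :=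
    integral_nonneg fun x => mul_nonneg (sq_nonneg _) (Real.exp_pos _).le
  have goal : lam * ∫ x, ((∑ i, Du i x ^ 2) + lam ^ 2 * u x ^ 2) * weight b lam p x
      ∂cubeMeasure d R ≤ D p * E p * ∫ x, L0 a D2u x ^ 2 * weight b lam p x ∂cubeMeasure d R := by
    rcases le_total (Λ p) lam with hl | hl
    · refine (hlarge lam hl).trans ?_
      gcongr
      exact le_mul_of_one_le_right hDp.le hE1
    · have s1 : lam * ∫ x, ((∑ i, Du i x ^ 2) + lam ^ 2 * u x ^ 2) * weight b lam p x
            ∂cubeMeasure d R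
          ≤ Λ p * ∫ x, ((∑ i, Du i x ^ 2) + Λ p ^ 2 * u x ^ 2) * weight b (Λ p) p x
            ∂cubeMeasure d R := by
        have hl0 : 0 ≤ lam := by linarith
        refine mul_le_mul hl ?_ (integral_nonneg fun x => mul_nonneg (by positivity)
          (Real.exp_pos _).le) (hl0.trans hl)
        refine integral_mono_ae (integral_energy_eq hb lam p mu mDu).1
          (integral_energy_eq hb (Λ p) p mu mDu).1 ?_
        filter_upwards [ae_mem_cube] with x hx
        have hz : 0 ≤ zc x + b := by
          have := (mem_cube.1 hx (Fin.last d)).1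
          simp only [zc]; linarith
        have hz' : 0 ≤ (zc x + b) ^ p := Real.rpow_nonneg hz _
        have hw : weight b lam p x ≤ weight b (Λ p) p x := by
          refine Real.exp_le_exp.2 ?_
          gcongr
        refine mul_le_mul ?_ hw (Real.exp_pos _).le (by positivity)
        gcongr
      have s2 : ∫ x, L0 a D2u x ^ 2 * weight b (Λ p) p x ∂cubeMeasure d R
          ≤ E p * ∫ x, L0 a D2u x ^ 2 * weight b lam p x ∂cubeMeasure d R := by
        rw [← integral_const_mul]
        refine integral_mono_ae (integrable_sq_mul_weight hb _ p mL)
          ((integrable_sq_mul_weight hb _ p mL).const_mul _) ?_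
        filter_upwards [ae_mem_cube] with x hx
        have hx1 := mem_cube.1 hx (Fin.last d)
        have hz : 0 ≤ zc x + b := by simp only [zc]; linarith [hx1.1]
        have hz' : 0 ≤ (zc x + b) ^ p := Real.rpow_nonneg hz _
        have hw : weight b (Λ p) p x ≤ E p := by
          refine Real.exp_le_exp.2 ?_
          have h1 : 0 ≤ Λ p := zero_le_one.trans (le_max_left _ _)
          have h2 : zc x + b ≤ b + R := by simp only [zc]; linarith [hx1.2]
          gcongr
        have hw1 : 1 ≤ weight b lam p x := by
          refine Real.one_le_exp ?_
          have : 0 ≤ lam := by linarith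
          positivity
        have h3 : weight b (Λ p) p x ≤ E p * weight b lam p x :=
          hw.trans (le_mul_of_one_le_right (by linarith) hw1)
        linear_combination mul_le_mul_of_nonneg_left h3 (sq_nonneg (L0 a D2u x))
      rw [mul_assoc (D p)]
      exact s1.trans ((hlarge _ le_rfl).trans (mul_le_mul_of_nonneg_left s2 hDp.le))
  dsimp only
  rw [mul_assoc, one_div, inv_mul_le_iff₀ (by positivity)]
  exact goal
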